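/- **Notation.** Let $\mathbb Z^+=\{0,1,2,\dots\}$. For $n\ge 1$ let $P_n$ be the orthogonal projection of $l^2(\mathbb Z^+)$ onto the sequences supported in $\{0,\dots,n-1\}$. For $a\in L^\infty(\mathbb T)$ let $T(a)$ be the Toeplitz operator on $l^2(\mathbb Z^+)$ with matrix $(a_{i-j})_{i,j\ge 0}$, where $a_k$ is the $k$-th Fourier coefficient of $a$. A function $b\in l^\infty(\mathbb Z)$ is *almost periodic*, $b\in AP(\mathbb Z)$, if the set of its translates is relatively compact in the supremum norm. Let $\mathcal A\subseteq L(l^2(\mathbb Z^+))$ be the smallest closed $C^*$-subalgebra which contains all $T(a)$ with $a\in L^\infty(\mathbb T)$ and all operators of multiplication by the restrictions to $\mathbb Z^+$ of functions $b\in AP(\mathbb Z)$. Let $\mathcal F$ be the $C^*$-algebra (entrywise operations, supremum norm) of all sequences $\mathbf A=(A_n)_{n\ge1}$ of operators $A_n$ on $\operatorname{im}P_n$ for which $A_nP_n$ and $A_n^*P_n$ converge strongly, let $W(\mathbf A)$ be the strong limit of $A_nP_n$, and let $\mathcal G\subseteq\mathcal F$ be the ideal of the sequences with $\|A_n\|\to0$.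 The *stability spectrum* of $\mathbf A$ is the spectrum $\sigma(\mathbf A+\mathcal G)$ of the coset $\mathbf A+\mathcal G$ in $\mathcal F/\mathcal G$. Let $\mathcal S=\mathcal S_{L^\infty(\mathbb T),AP(\mathbb Z)}(\mathbb Z^+)$ be the smallest closed $C^*$-subalgebra of $\mathcal F$ which contains all sequences $(P_nTP_n)$ with $T\in\mathcal A$. For a function $g$ holomorphic on an open neighborhood $U\subseteq\mathbb C$ of the spectrum of an operator $B$, set $g(B)=\frac1{2\pi i}\int_\Gamma g(\zeta)(\zeta I-B)^{-1}\,d\zeta$, where $\Gamma$ is any piecewise smooth cycle in $U\setminus\sigma(B)$ with winding number $1$ around every point of $\sigma(B)$ and $0$ around every point outside $U$. For $B\in\mathcal A$ let $D_{ap}(B)$ be the unique $f\in AP(\mathbb Z)$ such that the difference of the $n$-th main diagonal entry of $B$ and $f(n)$ tends to $0$ as $n\to+\infty$. For $f\in AP(\mathbb Z)$ let $M(f)=\lim_{n\to\infty}\frac1n\sum_{r=0}^{n-1}f(r)$ be its mean value. Let $\lambda_1(A_n),\dots,\lambda_n(A_n)$ be the eigenvalues of $A_n$, counted with algebraic multiplicity.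 **Theorem.** Let $\mathbf A=(A_n)$ be any sequence in $\mathcal S_{L^\infty(\mathbb T),AP(\mathbb Z)}(\mathbb Z^+)$ (not necessarily normal), and let $g$ be any function which is holomorphic on an open neighborhood $U\subseteq\mathbb C$ of the stability spectrum $\sigma(\mathbf A+\mathcal G)$. Then the operator $g(W(\mathbf A))$ is well defined, independently of $\Gamma$, and belongs to $\mathcal A$; the almost periodic part $D_{ap}(g(W(\mathbf A)))$ of its main diagonal exists and is unique and has a mean value; and $$\lim_{n\to\infty}\frac{g(\lambda_1(A_n))+\dots+g(\lambda_n(A_n))}{n}=M\bigl(D_{ap}(g(W(\mathbf A)))\bigr).$$ (For all sufficiently large $n$ the eigenvalues of $A_n$ lie in $U$; the finitely many remaining $n$ are irrelevant.) -/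

import Mathlib

open Filter Topology MeasureTheory
open scoped ENNReal BoundedContinuousFunction

namespace SzegoAP

noncomputable section

/-! ## Sequence spaces and sections -/

/-- The Hilbert space `ℓ²(ℤ)`. -/
abbrev L2Z : Type := lp (fun _ : ℤ => ℂ) 2

/-- The Hilbert space `ℓ²(ℤ⁺)`, where `ℤ⁺` is the set of the non-negative integers. -/
abbrev L2N : Type := lp (fun _ : ℕ => ℂ) 2

/-- `Sec n` is the range of the projection `P_{n+1}` of `ℓ²(ℤ⁺)` onto the sequences supported
in `{0, …, n}`, that is, `ℂ^{n+1}` with its Euclidean norm. All sequences of sections are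
indexed by `n + 1` with `n : ℕ`, i.e. by the positive integers. -/
abbrev Sec (n : ℕ) : Type := EuclideanSpace ℂ (Fin (n + 1))

/-- The inclusion of the range of `P_{n+1}` into `ℓ²(ℤ⁺)`. -/
def embed (n : ℕ) : Sec n →L[ℂ] L2N :=
  ∑ i : Fin (n + 1),
    (EuclideanSpace.proj i : Sec n →L[ℂ] ℂ).smulRight (lp.single 2 (i : ℕ) (1 : ℂ))

/-- The projection `P_{n+1}`, as an operator from `ℓ²(ℤ⁺)` onto the range of `P_{n+1}`. -/
def restrict (n : ℕ) : L2N →L[ℂ] Sec n := (embed n).adjoint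

theorem restrict_apply (n : ℕ) (x : L2N) (i : Fin (n + 1)) : restrict n x i = x (i : ℕ) := by
  have h : inner ℂ (EuclideanSpace.single i (1 : ℂ)) (restrict n x) =
      inner ℂ (lp.single 2 (i : ℕ) (1 : ℂ)) x := by
    rw [restrict, ContinuousLinearMap.adjoint_inner_right]
    congr 1
    simp [embed]
  rw [EuclideanSpace.inner_single_left, lp.inner_single_left] at h
  simpa using h

theorem embed_apply (n : ℕ) (x : Sec n) (k : ℕ) :
    embed n x k = if h : k < n + 1 then x ⟨k, h⟩ else 0 := by
  have h : embed n x k = ∑ i : Fin (n + 1), x i * (if k = (i : ℕ) then 1 else 0) := by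
    simp only [embed, sum_apply, ContinuousLinearMap.smulRight_apply,
      lp.coeFn_sum, Finset.sum_apply, lp.coeFn_smul, Pi.smul_apply, smul_eq_mul]
    refine Finset.sum_congr rfl fun i _ => ?_
    rw [lp.coeFn_single, Pi.single_apply]; rfl
  rw [h]
  split_ifs with hk
  · rw [Finset.sum_eq_single ⟨k, hk⟩]
    · simp
    · intro i _ hi
      rw [if_neg, mul_zero]
      rintro rfl
      exact hi rfl
    · simp
  · refine Finset.sum_eq_zero fun i _ => ?_
    rw [if_neg, mul_zero]
    have := i.2
    omega

theorem restrict_embed (n : ℕ) (x : Sec n) : restrict n (embed n x) = x := by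
  ext i
  rw [restrict_apply, embed_apply, dif_pos i.2]

theorem norm_embed (n : ℕ) (x : Sec n) : ‖embed n x‖ = ‖x‖ := by
  have h : inner ℂ (embed n x) (embed n x) = inner ℂ x x := by
    rw [← ContinuousLinearMap.adjoint_inner_right, ← restrict, restrict_embed]
  rw [@norm_eq_sqrt_re_inner ℂ, h, ← @norm_eq_sqrt_re_inner ℂ]

theorem norm_restrict_le (n : ℕ) (x : L2N) : ‖restrict n x‖ ≤ ‖x‖ := by
  have h : ‖restrict n‖ ≤ 1 := by
    rw [restrict, LinearIsometryEquiv.norm_map]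
    exact ContinuousLinearMap.opNorm_le_bound _ zero_le_one fun x => by rw [norm_embed, one_mul]
  simpa using (restrict n).le_of_opNorm_le h x

theorem tendsto_embed_restrict (x : L2N) :
    Tendsto (fun n => embed n (restrict n x)) atTop (𝓝 x) := by
  have h := (lp.hasSum_single (p := 2) (by simp) x).tendsto_sum_nat.comp
    (tendsto_add_atTop_nat 1)
  refine h.congr fun n => ?_
  ext k
  rw [embed_apply]
  simp only [Function.comp_apply, lp.coeFn_sum, Finset.sum_apply, lp.coeFn_single,
    Pi.single_apply, restrict_apply]
  simp

/-! ## The algebra of convergent sequences of sections -/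

/-- The algebra of all bounded sequences `(A_{n+1})` of operators `A_{n+1}` on the range of
`P_{n+1}`, with entrywise operations and involution and with the supremum norm. -/
def SeqAlg : Type := lp (fun n : ℕ => Sec n →L[ℂ] Sec n) ∞

instance : NormedRing SeqAlg :=
  fast_instance% lp.inftyNormedRing (B := fun n : ℕ => Sec n →L[ℂ] Sec n)

instance : NormedAlgebra ℂ SeqAlg :=
  fast_instance% lp.inftyNormedAlgebra (B := fun n : ℕ => Sec n →L[ℂ] Sec n)

instance : StarRing SeqAlg :=
  fast_instance% lp.inftyStarRing (B := fun n : ℕ => Sec n →L[ℂ] Sec n)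

instance : StarModule ℂ SeqAlg :=
  ⟨fun r x => Subtype.ext (funext fun n => star_smul r (x.1 n))⟩

instance : CStarRing SeqAlg := lp.inftyCStarRing (B := fun n : ℕ => Sec n →L[ℂ] Sec n)

instance : IsTopologicalRing SeqAlg := inferInstance

instance : ContinuousStar SeqAlg := inferInstance

instance : CoeFun SeqAlg (fun _ => ∀ n, Sec n →L[ℂ] Sec n) := ⟨fun A => A.1⟩

theorem SeqAlg.norm_apply_le (A : SeqAlg) (n : ℕ) : ‖A n‖ ≤ ‖A‖ :=
  lp.norm_apply_le_norm (by simp) A n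

/-- The operator `A_n P_n` on `ℓ²(ℤ⁺)`, for an operator `A_n` on the range of `P_n`. -/
def extendSec {n : ℕ} (X : Sec n →L[ℂ] Sec n) : L2N →L[ℂ] L2N :=
  embed n ∘L X ∘L restrict n

/-- `V` is the strong limit of the operators `A_n P_n`. -/
def IsStrongLimit (A : SeqAlg) (V : L2N →L[ℂ] L2N) : Prop :=
  ∀ x : L2N, Tendsto (fun n => extendSec (A n) x) atTop (𝓝 (V x))

theorem IsStrongLimit.add {A B : SeqAlg} {V W : L2N →L[ℂ] L2N} (hA : IsStrongLimit A V)
    (hB : IsStrongLimit B W) : IsStrongLimit (A + B) (V + W) := fun x => by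
  refine ((hA x).add (hB x)).congr fun n => ?_
  exact (map_add (embed n) _ _).symm

theorem IsStrongLimit.mul {A B : SeqAlg} {V W : L2N →L[ℂ] L2N} (hA : IsStrongLimit A V)
    (hB : IsStrongLimit B W) : IsStrongLimit (A * B) (V * W) := fun x => by
  have h1 := hA (W x)
  have h2 : Tendsto (fun n => extendSec (A n) (extendSec (B n) x - W x)) atTop (𝓝 0) := by
    have h3 : Tendsto (fun n => ‖A‖ * ‖extendSec (B n) x - W x‖) atTop (𝓝 0) := by
      simpa using (tendsto_iff_norm_sub_tendsto_zero.1 (hB x)).const_mul ‖A‖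
    refine squeeze_zero_norm (fun n => ?_) h3
    simp only [extendSec, ContinuousLinearMap.comp_apply]
    rw [norm_embed]
    exact ((A n).le_of_opNorm_le (A.norm_apply_le n) _).trans
      (mul_le_mul_of_nonneg_left (norm_restrict_le _ _) (norm_nonneg _))
  have h4 := h1.add h2
  rw [add_zero] at h4
  refine h4.congr fun n => ?_
  rw [← map_add, add_sub_cancel]
  simp only [extendSec, ContinuousLinearMap.comp_apply, restrict_embed]
  rfl

theorem isStrongLimit_algebraMap (c : ℂ) :
    IsStrongLimit (algebraMap ℂ SeqAlg c) (algebraMap ℂ (L2N →L[ℂ] L2N) c) :=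
  fun x => by
    refine ((tendsto_embed_restrict x).const_smul c).congr fun n => ?_
    exact (map_smul (embed n) c _).symm

theorem IsStrongLimit.unique {A : SeqAlg} {V W : L2N →L[ℂ] L2N} (hV : IsStrongLimit A V)
    (hW : IsStrongLimit A W) : V = W :=
  ContinuousLinearMap.ext fun x => tendsto_nhds_unique (hV x) (hW x)

/-- The `C*`-algebra of all sequences `(A_n)` for which the strong limits of `A_n P_n` and of
`A_n* P_n` exist, with the supremum norm. (Such sequences are bounded by the uniform boundedness
principle.) -/
def FP : StarSubalgebra ℂ SeqAlg where
  carrier := {A | (∃ V, IsStrongLimit A V) ∧ ∃ V, IsStrongLimit (star A) V}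
  mul_mem' := by
    rintro A B ⟨⟨V, hV⟩, ⟨V', hV'⟩⟩ ⟨⟨W, hW⟩, ⟨W', hW'⟩⟩
    exact ⟨⟨_, hV.mul hW⟩, ⟨_, by rw [star_mul]; exact hW'.mul hV'⟩⟩
  add_mem' := by
    rintro A B ⟨⟨V, hV⟩, ⟨V', hV'⟩⟩ ⟨⟨W, hW⟩, ⟨W', hW'⟩⟩
    exact ⟨⟨_, hV.add hW⟩, ⟨_, by rw [star_add]; exact hV'.add hW'⟩⟩
  algebraMap_mem' c :=
    ⟨⟨_, isStrongLimit_algebraMap c⟩,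
      ⟨_, by rw [← algebraMap_star_comm]; exact isStrongLimit_algebraMap (star c)⟩⟩
  star_mem' := by
    rintro A ⟨hA, hA'⟩
    exact ⟨hA', by rwa [star_star]⟩

/-- The operator `A_{n+1}` on the range of `P_{n+1}`, for a sequence in `FP`. -/
def entry (A : FP) (n : ℕ) : Sec n →L[ℂ] Sec n := (A : SeqAlg) n

/-- The strong limit `W(A)` of `A_n P_n`. -/
def W (A : FP) : L2N →L[ℂ] L2N := A.2.1.choose

theorem W_spec (A : FP) : IsStrongLimit (A : SeqAlg) (W A) := A.2.1.choose_spec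

/-- The ideal of all sequences in `FP` which tend to zero in the norm. -/
def nullIdeal : Ideal FP where
  carrier := {A | Tendsto (fun n => ‖entry A n‖) atTop (𝓝 0)}
  add_mem' := by
    intro A B hA hB
    have h : Tendsto (fun n => ‖entry A n‖ + ‖entry B n‖) atTop (𝓝 0) := by
      simpa using Tendsto.add hA hB
    exact squeeze_zero (fun _ => norm_nonneg _) (fun n => norm_add_le _ _) h
  zero_mem' := by
    refine tendsto_const_nhds.congr fun n => ?_
    exact (norm_zero (E := Sec n →L[ℂ] Sec n)).symm
  smul_mem' := by
    intro C A hA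
    have h : Tendsto (fun n => ‖(C : SeqAlg)‖ * ‖entry A n‖) atTop (𝓝 0) := by
      simpa using Tendsto.const_mul ‖(C : SeqAlg)‖ hA
    refine squeeze_zero (fun _ => norm_nonneg _) (fun n => ?_) h
    exact (norm_mul_le ((C : SeqAlg) n) ((A : SeqAlg) n)).trans
      (mul_le_mul_of_nonneg_right (SeqAlg.norm_apply_le _ n) (norm_nonneg _))

instance : nullIdeal.IsTwoSided where
  mul_mem_of_left := by
    intro A C hA
    have h : Tendsto (fun n => ‖entry A n‖ * ‖(C : SeqAlg)‖) atTop (𝓝 0) := by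
      simpa using Tendsto.mul_const ‖(C : SeqAlg)‖ hA
    refine squeeze_zero (fun _ => norm_nonneg _) (fun n => ?_) h
    exact (norm_mul_le ((A : SeqAlg) n) ((C : SeqAlg) n)).trans
      (mul_le_mul_of_nonneg_left (SeqAlg.norm_apply_le _ n) (norm_nonneg _))

/-- The stability spectrum of a sequence in `FP`: the spectrum of its coset in the quotient
algebra by the null sequences. -/
def stabilitySpectrum (A : FP) : Set ℂ := spectrum ℂ (Ideal.Quotient.mk nullIdeal A)

/-- The eigenvalues of a section, as a multiset, repeated according to algebraic multiplicity. -/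
def eigenvalues {n : ℕ} (X : Sec n →L[ℂ] Sec n) : Multiset ℂ :=
  (X : Sec n →ₗ[ℂ] Sec n).charpoly.roots

/-- The section `P_{n+1} T P_{n+1}` on the range of `P_{n+1}`. -/
def compress (n : ℕ) (T : L2N →L[ℂ] L2N) : Sec n →L[ℂ] Sec n := restrict n ∘L T ∘L embed n

theorem norm_compress_le (n : ℕ) (T : L2N →L[ℂ] L2N) : ‖compress n T‖ ≤ ‖T‖ :=
  ContinuousLinearMap.opNorm_le_bound _ (norm_nonneg _) fun x => by
    refine (norm_restrict_le _ _).trans ((T.le_opNorm (embed n x)).trans ?_)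
    exact (congrArg (fun r => ‖T‖ * r) (norm_embed n x)).le

/-- The finite sections sequence as a bounded sequence. -/
def sectionsSeq (T : L2N →L[ℂ] L2N) : SeqAlg :=
  ⟨fun n => compress n T, memℓp_infty ⟨‖T‖, by rintro _ ⟨n, rfl⟩; exact norm_compress_le n T⟩⟩

theorem star_sectionsSeq (T : L2N →L[ℂ] L2N) : star (sectionsSeq T) = sectionsSeq (star T) := by
  refine Subtype.ext (funext fun n => ?_)
  change ContinuousLinearMap.adjoint (restrict n ∘L T ∘L embed n) =
    restrict n ∘L ContinuousLinearMap.adjoint T ∘L embed n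
  rw [ContinuousLinearMap.adjoint_comp, ContinuousLinearMap.adjoint_comp, restrict,
    ContinuousLinearMap.adjoint_adjoint, ContinuousLinearMap.comp_assoc]

theorem isStrongLimit_sectionsSeq (T : L2N →L[ℂ] L2N) : IsStrongLimit (sectionsSeq T) T := by
  intro x
  have h1 := tendsto_embed_restrict (T x)
  have h2 : Tendsto (fun n => embed n (restrict n (T (embed n (restrict n x) - x))))
      atTop (𝓝 0) := by
    have h3 : Tendsto (fun n => ‖T‖ * ‖embed n (restrict n x) - x‖) atTop (𝓝 0) := by
      simpa using
        (tendsto_iff_norm_sub_tendsto_zero.1 (tendsto_embed_restrict x)).const_mul ‖T‖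
    refine squeeze_zero_norm (fun n => ?_) h3
    rw [norm_embed]
    exact (norm_restrict_le _ _).trans (T.le_opNorm _)
  have h4 := h1.add h2
  rw [add_zero] at h4
  refine h4.congr fun n => ?_
  rw [← map_add, ← map_add, ← map_add, add_sub_cancel]
  rfl

/-- The finite sections sequence `(P_n T P_n)` of an operator `T` on `ℓ²(ℤ⁺)`. -/
def finiteSections (T : L2N →L[ℂ] L2N) : FP :=
  ⟨sectionsSeq T, ⟨T, isStrongLimit_sectionsSeq T⟩,
    ⟨star T, by rw [star_sectionsSeq]; exact isStrongLimit_sectionsSeq _⟩⟩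

/-! ## Laurent, Toeplitz and multiplication operators -/

/-- The algebra `L^∞` of the unit circle; the circle is parametrized by `t ↦ e^{2πit}`, with
`t ∈ ℝ/ℤ`, and carries its normalized arc length measure. -/
abbrev LinftyT : Type := Lp ℂ ∞ (AddCircle.haarAddCircle (T := (1 : ℝ)))

/-- The Laurent operator `L(a)` on `ℓ²(ℤ)`: multiplication by `a` on `L²` of the circle, carried
over to `ℓ²(ℤ)` by the Fourier transform. Its matrix is computed in `laurent_matrix`. -/
def laurent (a : LinftyT) : L2Z →L[ℂ] L2Z :=
  let e := (fourierBasis (T := (1 : ℝ))).repr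
  (e.toContinuousLinearEquiv : _ →L[ℂ] L2Z) ∘L
    ((ContinuousLinearMap.mul ℂ ℂ).holderL AddCircle.haarAddCircle ∞ 2 2 a) ∘L
    (e.symm.toContinuousLinearEquiv : L2Z →L[ℂ] _)

/-- The matrix of `L(a)` is `(a_{i-j})`, with `a_k` the `k`-th Fourier coefficient of `a`. -/
theorem laurent_matrix (a : LinftyT) (i j : ℤ) :
    laurent a (lp.single 2 j 1) i = fourierCoeff a (i - j) := by
  have h1 : (fourierBasis (T := (1 : ℝ))).repr.symm (lp.single 2 j 1) = fourierLp 2 j := by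
    rw [HilbertBasis.repr_symm_single]; simp
  simp only [laurent, ContinuousLinearMap.comp_apply, ContinuousLinearEquiv.coe_coe,
    LinearIsometryEquiv.coe_toContinuousLinearEquiv]
  rw [h1, fourierBasis_repr]
  unfold fourierCoeff
  apply integral_congr_ae
  have h2 := ContinuousLinearMap.coeFn_holder (r := 2) (ContinuousLinearMap.mul ℂ ℂ) a
    (fourierLp (T := (1 : ℝ)) 2 j)
  have h3 := coeFn_fourierLp (T := (1 : ℝ)) 2 j
  filter_upwards [h2, h3] with t h2 h3
  have h4 : (ContinuousLinearMap.mul ℂ ℂ).holderL AddCircle.haarAddCircle ∞ 2 2 a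
      (fourierLp 2 j) =
      (ContinuousLinearMap.mul ℂ ℂ).holder 2 a (fourierLp (T := (1 : ℝ)) 2 j) := rfl
  rw [h4, h2, h3]
  simp only [ContinuousLinearMap.mul_apply', smul_eq_mul]
  rw [show -(i - j) = -i + j by ring, fourier_add]
  ring

theorem hasSum_extendByZero (x : L2N) :
    HasSum (fun k : ℤ => ‖(if 0 ≤ k then x k.toNat else 0 : ℂ)‖ ^ (2 : ℝ≥0∞).toReal)
      (‖x‖ ^ (2 : ℝ≥0∞).toReal) := by
  have hinj : Function.Injective (fun n : ℕ => (n : ℤ)) := Nat.cast_injective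
  have h := lp.hasSum_norm (p := 2) (by simp) x
  refine (hinj.hasSum_iff ?_).1 ?_
  · intro k hk
    have : ¬ 0 ≤ k := fun h0 => hk ⟨k.toNat, by simp [h0]⟩
    simp [this]
  · refine h.congr_fun ?_
    intro n
    simp

/-- The natural embedding of `ℓ²(ℤ⁺)` into `ℓ²(ℤ)`; its adjoint is the restriction to `ℤ⁺`. -/
def includeZ : L2N →ₗᵢ[ℂ] L2Z where
  toFun x := ⟨fun k => if 0 ≤ k then x k.toNat else 0,
    memℓp_gen (hasSum_extendByZero x).summable⟩
  map_add' x y := by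
    ext k
    change (if 0 ≤ k then x k.toNat + y k.toNat else 0 : ℂ) =
      (if 0 ≤ k then x k.toNat else 0) + (if 0 ≤ k then y k.toNat else 0)
    by_cases hk : 0 ≤ k <;> simp [hk]
  map_smul' c x := by
    ext k
    by_cases hk : 0 ≤ k <;> simp [hk]
  norm_map' x := by
    have h := (lp.hasSum_norm (p := 2) (by simp)
      (⟨fun k => if 0 ≤ k then x k.toNat else 0,
        memℓp_gen (hasSum_extendByZero x).summable⟩ : L2Z)).unique (hasSum_extendByZero x)
    exact (Real.rpow_left_inj (norm_nonneg _) (norm_nonneg _) (by simp)).1 h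

/-- The Toeplitz operator `T(a) = P L(a) P` on `ℓ²(ℤ⁺)`. -/
def toeplitz (a : LinftyT) : L2N →L[ℂ] L2N :=
  ContinuousLinearMap.adjoint includeZ.toContinuousLinearMap ∘L laurent a ∘L
    includeZ.toContinuousLinearMap

/-- The matrix of `T(a)` is `(a_{i-j})`, with `i, j ≥ 0`. -/
theorem toeplitz_matrix (a : LinftyT) (i j : ℕ) :
    toeplitz a (lp.single 2 j 1) i = fourierCoeff a ((i : ℤ) - j) := by
  have hs : ∀ k : ℕ, includeZ (lp.single 2 k (1 : ℂ)) = lp.single 2 (k : ℤ) (1 : ℂ) := by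
    intro k
    ext m
    change (if 0 ≤ m then (lp.single 2 k (1 : ℂ) : L2N) m.toNat else 0) = _
    rw [lp.coeFn_single, lp.coeFn_single, Pi.single_apply, Pi.single_apply]
    by_cases hm : 0 ≤ m
    · have : m.toNat = k ↔ m = (k : ℤ) := by omega
      simp [hm, this]
    · have : m ≠ (k : ℤ) := by omega
      simp [hm, this]
  have h : inner ℂ (lp.single 2 i (1 : ℂ)) (toeplitz a (lp.single 2 j 1)) =
      inner ℂ (lp.single 2 (i : ℤ) (1 : ℂ)) (laurent a (lp.single 2 (j : ℤ) 1)) := by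
    rw [toeplitz, ContinuousLinearMap.comp_apply, ContinuousLinearMap.adjoint_inner_right]
    simp only [ContinuousLinearMap.comp_apply, LinearIsometry.coe_toContinuousLinearMap, hs]
  rw [lp.inner_single_left, lp.inner_single_left, laurent_matrix] at h
  simpa using h

/-- The operator `P b P` on `ℓ²(ℤ⁺)` of multiplication by the restriction of `b ∈ ℓ^∞(ℤ)`. -/
def mulOp (b : ℤ →ᵇ ℂ) : L2N →L[ℂ] L2N :=
  LinearMap.mkContinuous
    { toFun := fun x => ⟨fun k => b (k : ℤ) * x k,
        ((lp.memℓp x).const_mul (‖b‖ : ℂ)).mono' fun k => by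
          simpa using mul_le_mul_of_nonneg_right (b.norm_coe_le_norm k) (norm_nonneg (x k))⟩
      map_add' := fun x y => by ext k; exact mul_add _ _ _
      map_smul' := fun c x => by ext k; exact mul_left_comm _ _ _ } ‖b‖ fun x => by
    have h : ‖(‖b‖ : ℂ) • x‖ = ‖b‖ * ‖x‖ := by rw [norm_smul]; simp
    rw [← h]
    refine lp.norm_mono (by simp) fun k => ?_
    have h2 : ‖((‖b‖ : ℂ) • x) k‖ = ‖b‖ * ‖x k‖ := by
      rw [lp.coeFn_smul, Pi.smul_apply, norm_smul]; simp
    rw [h2]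
    change ‖b (k : ℤ) * x k‖ ≤ _
    rw [norm_mul]
    exact mul_le_mul_of_nonneg_right (b.norm_coe_le_norm k) (norm_nonneg (x k))

/-! ## Almost periodic functions -/

/-- The translate `n ↦ b (n + k)` of a bounded function on `ℤ`. -/
def shiftFun (k : ℤ) (b : ℤ →ᵇ ℂ) : ℤ →ᵇ ℂ :=
  b.compContinuous ⟨fun n => n + k, continuous_of_discreteTopology⟩

/-- `b ∈ ℓ^∞(ℤ)` is almost periodic: the set of its translates is relatively compact in the
supremum norm. -/
def IsAlmostPeriodic (b : ℤ →ᵇ ℂ) : Prop :=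
  IsCompact (closure (Set.range fun k : ℤ => shiftFun k b))

/-- `f` has the mean value `m`: the means `(f 0 + ⋯ + f (n-1)) / n` tend to `m`. -/
def HasMeanValue (f : ℤ →ᵇ ℂ) (m : ℂ) : Prop :=
  Tendsto (fun n : ℕ => (∑ r ∈ Finset.range n, f (r : ℤ)) / (n : ℂ)) atTop (𝓝 m)

/-- `f` is an almost periodic part of the main diagonal of `B`: the function `f` on `ℤ` is almost
periodic and the difference of the main diagonal of `B` and of `f` tends to `0` at `+∞`. -/
def IsAPPartOfDiagonal (B : L2N →L[ℂ] L2N) (f : ℤ →ᵇ ℂ) : Prop :=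
  IsAlmostPeriodic f ∧
    Tendsto (fun n : ℕ => B (lp.single 2 n 1) n - f (n : ℤ)) atTop (𝓝 0)

/-! ## The algebras generated by Toeplitz operators and almost periodic functions -/

/-- The smallest closed `C*`-subalgebra of `L(ℓ²(ℤ⁺))` which contains all Toeplitz operators
`T(a)` with `a ∈ L^∞` and all operators `P b P` with `b` almost periodic. (It contains
`I = T(1)`.) -/
def opAlgebra : StarSubalgebra ℂ (L2N →L[ℂ] L2N) :=
  (StarAlgebra.adjoin ℂ (Set.range toeplitz ∪ mulOp '' {b | IsAlmostPeriodic b})).topologicalClosure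

instance : IsSemitopologicalSemiring FP := inferInstance

instance : ContinuousStar FP := inferInstance

/-- The smallest closed `C*`-subalgebra of `FP` which contains all finite sections sequences
`(P_n T P_n)` of operators `T ∈ opAlgebra`. -/
def seqAlgebra : StarSubalgebra ℂ FP :=
  (StarAlgebra.adjoin ℂ (finiteSections '' (opAlgebra : Set (L2N →L[ℂ] L2N)))).topologicalClosure

/-! ## Holomorphic functional calculus -/

/-- A cycle in the plane: finitely many oriented arcs `arc j : [0, 1] → ℂ` of class `C¹` such that
every point is as often an end point as it is a starting point. A closed piecewise `C¹` curve,
or a finite family of such curves, is a cycle. -/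
structure Cycle where
  card : ℕ
  arc : Fin card → ℝ → ℂ
  contDiff : ∀ j, ContDiff ℝ 1 (arc j)
  closed : Finset.univ.val.map (fun j => arc j 1) = Finset.univ.val.map (fun j => arc j 0)

/-- The integral `∫_Γ F(ζ) dζ` along a cycle. -/
def Cycle.integral {V : Type*} [NormedAddCommGroup V] [NormedSpace ℂ V] (Γ : Cycle)
    (F : ℂ → V) : V :=
  ∑ j, ∫ t in (0 : ℝ)..1, deriv (Γ.arc j) t • F (Γ.arc j t)

/-- The winding number of a cycle around `w`. -/
def Cycle.windingNumber (Γ : Cycle) (w : ℂ) : ℂ :=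
  (2 * Real.pi * Complex.I)⁻¹ * Γ.integral fun ζ => (ζ - w)⁻¹

/-- The cycle `Γ` lies in `U \ K` and surrounds `K` in `U`: its winding number is `1` around
the points of `K` and `0` around the points outside `U`. -/
structure Cycle.Surrounds (Γ : Cycle) (K U : Set ℂ) : Prop where
  mem : ∀ j, ∀ t ∈ Set.Icc (0 : ℝ) 1, Γ.arc j t ∈ U \ K
  inner : ∀ w ∈ K, Γ.windingNumber w = 1
  outer : ∀ w ∉ U, Γ.windingNumber w = 0

/-- `c = g(b)` in the sense of the holomorphic functional calculus of the Banach algebra `B`, for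
a function `g` which is holomorphic on the open neighborhood `U` of the spectrum of `b`:
`c = (2πi)⁻¹ ∫_Γ g(ζ) (ζ e - b)⁻¹ dζ` for every cycle `Γ` in `U \ σ(b)` which surrounds `σ(b)`
in `U`, and such cycles exist. -/
def IsHolomorphicFunction {B : Type*} [NormedRing B] [NormedAlgebra ℂ B] (U : Set ℂ) (g : ℂ → ℂ)
    (b c : B) : Prop :=
  (∃ Γ : Cycle, Γ.Surrounds (spectrum ℂ b) U) ∧
    ∀ Γ : Cycle, Γ.Surrounds (spectrum ℂ b) U →
      c = (2 * Real.pi * Complex.I : ℂ)⁻¹ • Γ.integral fun ζ => g ζ • resolvent b ζ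

end

end SzegoAP

/-!
Write `P_n` for the projection onto the range `Sec n` and `J` for the inclusion of `ℓ²(ℤ⁺)` into
`ℓ²(ℤ)`.

**Traces.** The columns of a Toeplitz operator are translates of one vector in `ℓ²`, so the squared
Hilbert–Schmidt norm of `(1 - P_n) T(a) P_n` is a sum of `n` consecutive tails of a convergent
series and hence `o(n)`; multiplication operators commute with `P_n`. Operators `C` for which
`(1 - P_n) C P_n` and `(1 - P_n) C* P_n` have squared Hilbert–Schmidt norm `o(n)` form a closed
`C*`-algebra, so it contains `opAlgebra` (`opAlgebra_le_quasitriangularAlgebra`). Therefore finite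
sections of operators in `opAlgebra` are multiplicative up to sequences that are negligible in
this sense, and every sequence `(A_n)` in `seqAlgebra` agrees with `(P_n W(A) P_n)` up to a
negligible sequence (`seqAlgebra_le_sectionLikeAlgebra`). For `ζ` outside the stability spectrum
the inverses `(ζ - A_n)⁻¹` exist and are bounded for large `n`, and they differ from the sections
of `(ζ - W(A))⁻¹` by a negligible sequence (`secNegligible_resolvent_sub`). By Cauchy–Schwarz, the
traces of a negligible sequence are `o(n)`, while the trace of `(ζ - A_n)⁻¹` is the sum of the
numbers `1 / (ζ - λ)` over the eigenvalues `λ` of `A_n` (`sum_diag_eq_sum_eigenvalues_inv`).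
No normality is needed, as only resolvents occur. Multiplying by `g(ζ)` and integrating along a
cycle gives, by Cauchy's formula and bounded convergence, that the sum of the numbers `g(λ)` and
the sum of the first diagonal entries of `g(W(A))` differ by `o(n)`
(`tendsto_sum_eigenvalues_sub_diagSum`).

**The diagonal.** Laurent operators on `ℓ²(ℤ)` are invariant under translations, and operators of
multiplication by almost periodic functions have relatively compact sets of translates. Operators
`B` such that `J B J*` behaves, together with its adjoint, at `+∞` like an operator `X` with a
relatively compact set of translates form a `C*`-algebra. It is closed because `‖X‖ ≤ ‖B‖`, by
recurrence (`IsAsymptotic.norm_le`). Hence it contains `opAlgebra`, and the diagonal of `X` is an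
almost periodic part of the diagonal of `B` (`exists_isAPPartOfDiagonal`). It is unique, again by
recurrence, and it has a mean value (`IsAlmostPeriodic.exists_hasMeanValue`), which is then the
limit of the means of the diagonal of `B`.

**The functional calculus.** The boundary of the union of the squares of a fine grid that meet a
given compact set is a cycle that surrounds it, and Cauchy's theorem for this cycle follows from
the one for squares (`exists_cycle_of_isCompact`). Together with Fubini's theorem this yields the
homology version of Cauchy's theorem (`Cycle.integral_eq_of_windingNumber_eq`), hence the
independence of `g(W(A))` of the cycle. The cycle used for the limit surrounds a compact
neighborhood of the spectrum of `W(A)` and of all points at which `(ζ - A_n)` is not stable;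
both sets are contained in the stability spectrum.
-/

namespace SzegoAP

noncomputable section

/-! ### Integrals along cycles -/

section Cycles

variable {V : Type*} [NormedAddCommGroup V] [NormedSpace ℂ V]

/-- The trace of a cycle: the compact set of all points on its arcs. -/
def Cycle.trace (Γ : Cycle) : Set ℂ := ⋃ j, Γ.arc j '' Set.Icc (0 : ℝ) 1

theorem Cycle.arc_mem_trace (Γ : Cycle) (j : Fin Γ.card) {t : ℝ} (ht : t ∈ Set.Icc (0 : ℝ) 1) :
    Γ.arc j t ∈ Γ.trace :=
  Set.mem_iUnion.2 ⟨j, t, ht, rfl⟩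

theorem Cycle.isCompact_trace (Γ : Cycle) : IsCompact Γ.trace :=
  isCompact_iUnion fun j => isCompact_Icc.image (Γ.contDiff j).continuous

theorem Cycle.continuousOn_integrand (Γ : Cycle) {F : ℂ → V} (hF : ContinuousOn F Γ.trace)
    (j : Fin Γ.card) :
    ContinuousOn (fun t => deriv (Γ.arc j) t • F (Γ.arc j t)) (Set.Icc (0 : ℝ) 1) :=
  ((Γ.contDiff j).continuous_deriv le_rfl).continuousOn.smul
    (hF.comp (Γ.contDiff j).continuous.continuousOn fun _ ht => Γ.arc_mem_trace j ht)

theorem Cycle.intervalIntegrable_integrand (Γ : Cycle) {F : ℂ → V} (hF : ContinuousOn F Γ.trace)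
    (j : Fin Γ.card) :
    IntervalIntegrable (fun t => deriv (Γ.arc j) t • F (Γ.arc j t)) volume (0 : ℝ) 1 :=
  ContinuousOn.intervalIntegrable (by
    rw [Set.uIcc_of_le zero_le_one]; exact Γ.continuousOn_integrand hF j)

theorem Cycle.integral_congr (Γ : Cycle) {F G : ℂ → V} (h : Set.EqOn F G Γ.trace) :
    Γ.integral F = Γ.integral G := by
  refine Finset.sum_congr rfl fun j _ => intervalIntegral.integral_congr fun t ht => ?_
  rw [Set.uIcc_of_le zero_le_one] at ht
  simp only [h (Γ.arc_mem_trace j ht)]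

theorem Cycle.integral_sub (Γ : Cycle) {F G : ℂ → V} (hF : ContinuousOn F Γ.trace)
    (hG : ContinuousOn G Γ.trace) :
    Γ.integral (fun ζ => F ζ - G ζ) = Γ.integral F - Γ.integral G := by
  simp only [Cycle.integral, ← Finset.sum_sub_distrib, smul_sub]
  exact Finset.sum_congr rfl fun j _ => intervalIntegral.integral_sub
    (Γ.intervalIntegrable_integrand hF j) (Γ.intervalIntegrable_integrand hG j)

theorem Cycle.integral_const_smul (Γ : Cycle) (c : ℂ) (F : ℂ → V) :
    Γ.integral (fun ζ => c • F ζ) = c • Γ.integral F := by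
  simp only [Cycle.integral, Finset.smul_sum]
  refine Finset.sum_congr rfl fun j _ => ?_
  rw [← intervalIntegral.integral_smul]
  refine intervalIntegral.integral_congr fun t _ => ?_
  simp only [smul_comm c]

theorem Cycle.integral_smul_const [CompleteSpace V] (Γ : Cycle) (F : ℂ → ℂ) (v : V) :
    Γ.integral (fun ζ => F ζ • v) = Γ.integral F • v := by
  simp only [Cycle.integral, Finset.sum_smul, ← smul_assoc]
  exact Finset.sum_congr rfl fun j _ => intervalIntegral.integral_smul_const _ _

theorem Cycle.integral_clm_apply {V' : Type*} [NormedAddCommGroup V'] [NormedSpace ℂ V']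
    [CompleteSpace V] [CompleteSpace V'] (Γ : Cycle) (L : V →L[ℂ] V') {F : ℂ → V}
    (hF : ContinuousOn F Γ.trace) :
    Γ.integral (fun ζ => L (F ζ)) = L (Γ.integral F) := by
  simp only [Cycle.integral, map_sum]
  refine Finset.sum_congr rfl fun j _ => ?_
  rw [← L.intervalIntegral_comp_comm (Γ.intervalIntegrable_integrand hF j)]
  simp only [map_smul]

/-- The fundamental theorem of calculus along an arc. -/
theorem integral_arc_eq_sub [CompleteSpace V] {γ : ℝ → ℂ} (hγ : ContDiff ℝ 1 γ) {F G : ℂ → V}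
    (hG : ∀ t ∈ Set.Icc (0 : ℝ) 1, HasDerivAt G (F (γ t)) (γ t))
    (hF : ContinuousOn (fun t => F (γ t)) (Set.Icc (0 : ℝ) 1)) :
    ∫ t in (0 : ℝ)..1, deriv γ t • F (γ t) = G (γ 1) - G (γ 0) := by
  refine intervalIntegral.integral_eq_sub_of_hasDerivAt (f := fun t => G (γ t)) (fun t ht => ?_) ?_
  · rw [Set.uIcc_of_le zero_le_one] at ht
    exact (hG t ht).scomp t (hγ.differentiable one_ne_zero t).hasDerivAt
  · refine ContinuousOn.intervalIntegrable ?_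
    rw [Set.uIcc_of_le zero_le_one]
    exact (hγ.continuous_deriv le_rfl).continuousOn.smul hF

theorem Cycle.sum_arc_one_eq {M : Type*} [AddCommMonoid M] (Γ : Cycle) (G : ℂ → M) :
    ∑ j, G (Γ.arc j 1) = ∑ j, G (Γ.arc j 0) := by
  have h := congrArg (fun m => (m.map G).sum) Γ.closed
  simpa [Multiset.map_map, Function.comp_def, List.sum_ofFn] using h

/-- A function with a primitive near a cycle has integral zero along it. -/
theorem Cycle.integral_eq_zero_of_hasDerivAt [CompleteSpace V] (Γ : Cycle) {F G : ℂ → V}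
    (hG : ∀ ζ ∈ Γ.trace, HasDerivAt G (F ζ) ζ) (hF : ContinuousOn F Γ.trace) :
    Γ.integral F = 0 := by
  have h : Γ.integral F = ∑ j, (G (Γ.arc j 1) - G (Γ.arc j 0)) :=
    Finset.sum_congr rfl fun j _ => integral_arc_eq_sub (Γ.contDiff j)
      (fun t ht => hG _ (Γ.arc_mem_trace j ht))
      (hF.comp (Γ.contDiff j).continuous.continuousOn fun _ ht => Γ.arc_mem_trace j ht)
  rw [h, Finset.sum_sub_distrib, Γ.sum_arc_one_eq, sub_self]

theorem continuousOn_sub_inv {w : ℂ} {s : Set ℂ} (hw : w ∉ s) :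
    ContinuousOn (fun ζ : ℂ => (ζ - w)⁻¹) s :=
  ContinuousOn.inv₀ (by fun_prop) fun ζ hζ h => hw (by rwa [← sub_eq_zero.1 h])

/-- The winding number is locally constant: `log ((ζ - w) / (ζ - w₀))` is a primitive of the
difference of the two integrands. -/
theorem Cycle.windingNumber_eq_of_norm_lt (Γ : Cycle) {w w₀ : ℂ}
    (h : ∀ ζ ∈ Γ.trace, ‖w - w₀‖ < ‖ζ - w₀‖) : Γ.windingNumber w = Γ.windingNumber w₀ := by
  have hw₀ : w₀ ∉ Γ.trace := fun hm => by
    simpa using (norm_nonneg (w - w₀)).trans_lt (h _ hm)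
  have hw : w ∉ Γ.trace := fun hm => (h _ hm).false
  have hne : ∀ ζ ∈ Γ.trace, ζ - w ≠ 0 ∧ ζ - w₀ ≠ 0 := fun ζ hζ =>
    ⟨fun h0 => hw (by rwa [← sub_eq_zero.1 h0]), fun h0 => hw₀ (by rwa [← sub_eq_zero.1 h0])⟩
  have key : Γ.integral (fun ζ => (ζ - w)⁻¹ - (ζ - w₀)⁻¹) = 0 := by
    refine Γ.integral_eq_zero_of_hasDerivAt
      (G := fun ζ => Complex.log ((ζ - w) / (ζ - w₀))) (fun ζ hζ => ?_)
      ((continuousOn_sub_inv hw).sub (continuousOn_sub_inv hw₀))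
    obtain ⟨h1, h2⟩ := hne ζ hζ
    have hslit : (ζ - w) / (ζ - w₀) ∈ Complex.slitPlane := by
      have : (ζ - w) / (ζ - w₀) = 1 + (w₀ - w) / (ζ - w₀) := by field_simp; ring
      rw [this]
      refine Complex.mem_slitPlane_of_norm_lt_one ?_
      rw [norm_div, div_lt_one (norm_pos_iff.2 h2), norm_sub_rev]
      exact h ζ hζ
    have hd : HasDerivAt (fun ζ => (ζ - w) / (ζ - w₀))
        ((1 * (ζ - w₀) - (ζ - w) * 1) / (ζ - w₀) ^ 2) ζ :=
      ((hasDerivAt_id ζ).sub_const w).div ((hasDerivAt_id ζ).sub_const w₀) h2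
    refine (hd.clog hslit).congr_deriv ?_
    field_simp
  rw [Γ.integral_sub (continuousOn_sub_inv hw) (continuousOn_sub_inv hw₀), sub_eq_zero] at key
  rw [Cycle.windingNumber, Cycle.windingNumber, key]

theorem Cycle.windingNumber_eq_zero_of_norm_lt (Γ : Cycle) {w : ℂ}
    (h : ∀ ζ ∈ Γ.trace, ‖ζ‖ < ‖w‖) : Γ.windingNumber w = 0 := by
  have hw : w ∉ Γ.trace := fun hm => (h _ hm).false
  have key : Γ.integral (fun ζ => (ζ - w)⁻¹) = 0 := by
    refine Γ.integral_eq_zero_of_hasDerivAt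
      (G := fun ζ => Complex.log ((w - ζ) / w)) (fun ζ hζ => ?_) (continuousOn_sub_inv hw)
    have hw0 : w ≠ 0 := norm_pos_iff.1 ((norm_nonneg _).trans_lt (h ζ hζ))
    have h1 : w - ζ ≠ 0 := fun h0 => hw (by rwa [sub_eq_zero.1 h0])
    have h2 : ζ - w ≠ 0 := fun h0 => hw (by rwa [← sub_eq_zero.1 h0])
    have hslit : (w - ζ) / w ∈ Complex.slitPlane := by
      have : (w - ζ) / w = 1 + (-ζ) / w := by field_simp; ring
      rw [this]
      refine Complex.mem_slitPlane_of_norm_lt_one ?_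
      rw [norm_div, div_lt_one (norm_pos_iff.2 hw0), norm_neg]
      exact h ζ hζ
    have hd : HasDerivAt (fun ζ => (w - ζ) / w) (-1 / w) ζ :=
      ((hasDerivAt_id ζ).const_sub w).div_const w
    refine (hd.clog hslit).congr_deriv ?_
    rw [← neg_sub w ζ]
    field_simp
  rw [Cycle.windingNumber, key, mul_zero]

/-- The order of the integrations along two cycles can be exchanged. -/
theorem Cycle.integral_integral_comm [CompleteSpace V] (Γ σ : Cycle) {H : ℂ → ℂ → V}
    (hH : ContinuousOn (Function.uncurry H) (Γ.trace ×ˢ σ.trace)) :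
    Γ.integral (fun z => σ.integral fun ζ => H z ζ) =
      σ.integral fun ζ => Γ.integral fun z => H z ζ := by
  let f : Fin Γ.card → Fin σ.card → ℝ → ℝ → V := fun j l t s =>
    deriv (Γ.arc j) t • deriv (σ.arc l) s • H (Γ.arc j t) (σ.arc l s)
  have hf : ∀ j l, Integrable (Function.uncurry (f j l))
      ((volume.restrict (Set.Ioc (0 : ℝ) 1)).prod (volume.restrict (Set.Ioc (0 : ℝ) 1))) := by
    intro j l
    have hc : ContinuousOn (Function.uncurry (f j l))
        (Set.Icc (0 : ℝ) 1 ×ˢ Set.Icc (0 : ℝ) 1) := by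
      have h1 := ((Γ.contDiff j).continuous_deriv le_rfl).comp (continuous_fst (X := ℝ) (Y := ℝ))
      have h2 := ((σ.contDiff l).continuous_deriv le_rfl).comp (continuous_snd (X := ℝ) (Y := ℝ))
      refine h1.continuousOn.smul (h2.continuousOn.smul ?_)
      exact hH.comp (((Γ.contDiff j).continuous.comp continuous_fst).prodMk
        ((σ.contDiff l).continuous.comp continuous_snd)).continuousOn
        fun p hp => ⟨Γ.arc_mem_trace j hp.1, σ.arc_mem_trace l hp.2⟩
    rw [Measure.prod_restrict]
    exact (hc.integrableOn_compact (isCompact_Icc.prod isCompact_Icc)).mono_set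
      (Set.prod_mono Set.Ioc_subset_Icc_self Set.Ioc_subset_Icc_self)
  have hl : ∀ j t, deriv (Γ.arc j) t • σ.integral (fun ζ => H (Γ.arc j t) ζ) =
      ∑ l, ∫ s in Set.Ioc (0 : ℝ) 1, f j l t s := by
    intro j t
    rw [Cycle.integral, Finset.smul_sum]
    refine Finset.sum_congr rfl fun l _ => ?_
    rw [intervalIntegral.integral_of_le zero_le_one, ← integral_smul]
  have hr : ∀ l s, deriv (σ.arc l) s • Γ.integral (fun z => H z (σ.arc l s)) =
      ∑ j, ∫ t in Set.Ioc (0 : ℝ) 1, f j l t s := by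
    intro l s
    rw [Cycle.integral, Finset.smul_sum]
    refine Finset.sum_congr rfl fun j _ => ?_
    rw [intervalIntegral.integral_of_le zero_le_one, ← integral_smul]
    simp only [f, smul_comm (deriv (σ.arc l) s)]
  have hL : Γ.integral (fun z => σ.integral fun ζ => H z ζ) =
      ∑ j, ∑ l, ∫ t in Set.Ioc (0 : ℝ) 1, ∫ s in Set.Ioc (0 : ℝ) 1, f j l t s := by
    rw [Cycle.integral]
    refine Finset.sum_congr rfl fun j _ => ?_
    simp only [hl]
    rw [intervalIntegral.integral_of_le zero_le_one, integral_finsetSum]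
    exact fun l _ => (hf j l).integral_prod_left
  have hR : σ.integral (fun ζ => Γ.integral fun z => H z ζ) =
      ∑ l, ∑ j, ∫ s in Set.Ioc (0 : ℝ) 1, ∫ t in Set.Ioc (0 : ℝ) 1, f j l t s := by
    rw [Cycle.integral]
    refine Finset.sum_congr rfl fun l _ => ?_
    simp only [hr]
    rw [intervalIntegral.integral_of_le zero_le_one, integral_finsetSum]
    exact fun j _ => (hf j l).integral_prod_right
  rw [hL, hR, Finset.sum_comm]
  exact Finset.sum_congr rfl fun l _ => Finset.sum_congr rfl fun j _ =>
    integral_integral_swap (hf j l)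

end Cycles

/-! ### Boundary cycles of unions of grid squares -/

/-- The point `δ (i + j √-1)` of the square lattice with mesh `δ`. -/
def latticePoint (δ : ℝ) (a : ℤ × ℤ) : ℂ := ⟨δ * a.1, δ * a.2⟩

/-- The closed square of side length `δ` with lower left corner `latticePoint δ a`. -/
def gridSquare (δ : ℝ) (a : ℤ × ℤ) : Set ℂ :=
  {z | (δ * a.1 ≤ z.re ∧ z.re ≤ δ * (a.1 + 1)) ∧ δ * a.2 ≤ z.im ∧ z.im ≤ δ * (a.2 + 1)}

/-- A directed edge of the grid: the pair `(a, k)` stands for the `k`-th side of the square with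
lower left corner `a`, the sides being numbered and directed counterclockwise, from the bottom. -/
abbrev GridEdge : Type := (ℤ × ℤ) × Fin 4

namespace GridEdge

/-- The starting point of a directed edge. -/
def src (e : GridEdge) : ℤ × ℤ := e.1 + ![(0, 0), (1, 0), (1, 1), (0, 1)] e.2

/-- The end point of a directed edge. -/
def tgt (e : GridEdge) : ℤ × ℤ := e.1 + ![(1, 0), (1, 1), (0, 1), (0, 0)] e.2

/-- The same edge with the opposite direction, as a side of the adjacent square. -/
def rev (e : GridEdge) : GridEdge := (e.1 + ![(0, -1), (1, 0), (0, 1), (-1, 0)] e.2, e.2 + 2)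

theorem rev_rev (e : GridEdge) : e.rev.rev = e := by
  obtain ⟨⟨i, j⟩, k⟩ := e
  fin_cases k <;> simp [rev]

theorem src_rev (e : GridEdge) : e.rev.src = e.tgt := by
  obtain ⟨⟨i, j⟩, k⟩ := e
  fin_cases k <;> simp [rev, src, tgt]

theorem tgt_rev (e : GridEdge) : e.rev.tgt = e.src := by
  rw [← src_rev, rev_rev]

/-- The affine parametrization of a directed edge. -/
def arc (δ : ℝ) (e : GridEdge) (t : ℝ) : ℂ :=
  latticePoint δ e.src + t * (latticePoint δ e.tgt - latticePoint δ e.src)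

theorem contDiff_arc (δ : ℝ) (e : GridEdge) : ContDiff ℝ 1 (arc δ e) := by
  have : ContDiff ℝ 1 fun t : ℝ => (t : ℂ) := Complex.ofRealCLM.contDiff
  exact contDiff_const.add (this.mul contDiff_const)

theorem deriv_arc (δ : ℝ) (e : GridEdge) (t : ℝ) :
    deriv (arc δ e) t = latticePoint δ e.tgt - latticePoint δ e.src := by
  have h := (((hasDerivAt_id t).ofReal_comp).mul_const
    (latticePoint δ e.tgt - latticePoint δ e.src)).const_add (latticePoint δ e.src)
  rw [Complex.ofReal_one, one_mul] at h
  exact h.deriv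

@[simp] theorem arc_zero (δ : ℝ) (e : GridEdge) : arc δ e 0 = latticePoint δ e.src := by
  simp [arc]

@[simp] theorem arc_one (δ : ℝ) (e : GridEdge) : arc δ e 1 = latticePoint δ e.tgt := by
  simp [arc]

theorem arc_rev (δ : ℝ) (e : GridEdge) (t : ℝ) : arc δ e.rev t = arc δ e (1 - t) := by
  simp only [arc, src_rev, tgt_rev]
  push_cast
  ring

theorem arc_mem_gridSquare {δ : ℝ} (hδ : 0 < δ) (e : GridEdge) {t : ℝ}
    (ht : t ∈ Set.Icc (0 : ℝ) 1) : arc δ e t ∈ gridSquare δ e.1 := by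
  obtain ⟨⟨i, j⟩, k⟩ := e
  have h1 := mul_nonneg hδ.le ht.1
  have h2 := mul_nonneg hδ.le (sub_nonneg.2 ht.2)
  fin_cases k <;> simp [arc, src, tgt, latticePoint, gridSquare] <;>
    refine ⟨?_, ?_⟩ <;> (try refine ⟨?_, ?_⟩) <;> nlinarith

section Integral

variable {V : Type*} [NormedAddCommGroup V] [NormedSpace ℂ V]

/-- The integral of a function along a directed edge. -/
def integral (δ : ℝ) (e : GridEdge) (F : ℂ → V) : V :=
  ∫ t in (0 : ℝ)..1, deriv (arc δ e) t • F (arc δ e t)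

theorem integral_rev (δ : ℝ) (e : GridEdge) (F : ℂ → V) :
    integral δ e.rev F = -integral δ e F := by
  have h := intervalIntegral.integral_comp_sub_left
    (fun t => deriv (arc δ e) t • F (arc δ e t)) (a := 0) (b := 1) (1 : ℝ)
  rw [sub_self, sub_zero] at h
  rw [integral, integral, ← h, ← intervalIntegral.integral_neg]
  refine intervalIntegral.integral_congr fun t _ => ?_
  simp only [deriv_arc, src_rev, tgt_rev, arc_rev]
  rw [← neg_smul, neg_sub]

theorem integral_eq_sub [CompleteSpace V] {δ : ℝ} {e : GridEdge} {F G : ℂ → V}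
    (hG : ∀ t ∈ Set.Icc (0 : ℝ) 1, HasDerivAt G (F (arc δ e t)) (arc δ e t))
    (hF : ContinuousOn (fun t => F (arc δ e t)) (Set.Icc (0 : ℝ) 1)) :
    integral δ e F = G (latticePoint δ e.tgt) - G (latticePoint δ e.src) := by
  have h := integral_arc_eq_sub (contDiff_arc δ e) hG hF
  rwa [arc_zero, arc_one] at h

/-- Cauchy's theorem for a square on which the integrand has a primitive. -/
theorem sum_integral_eq_zero [CompleteSpace V] {δ : ℝ} (hδ : 0 < δ) {a : ℤ × ℤ} {F G : ℂ → V}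
    (hG : ∀ ζ ∈ gridSquare δ a, HasDerivAt G (F ζ) ζ) (hF : ContinuousOn F (gridSquare δ a)) :
    ∑ k, integral δ (a, k) F = 0 := by
  have h : ∀ k, integral δ (a, k) F = G (latticePoint δ (tgt (a, k))) -
      G (latticePoint δ (src (a, k))) := fun k =>
    integral_eq_sub (fun t ht => hG _ (arc_mem_gridSquare hδ (a, k) ht))
      (hF.comp (contDiff_arc δ _).continuous.continuousOn
        fun t ht => arc_mem_gridSquare hδ (a, k) ht)
  simp only [h, Fin.sum_univ_four]
  simp [src, tgt]

theorem hasDerivAt_log_mul_sub {u z ζ : ℂ} (hu : u ≠ 0) (h : u * (ζ - z) ∈ Complex.slitPlane) :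
    HasDerivAt (fun ζ => Complex.log (u * (ζ - z))) (ζ - z)⁻¹ ζ := by
  have h0 : ζ - z ≠ 0 := fun h0 => by simp [h0] at h
  have hd : HasDerivAt (fun ζ => u * (ζ - z)) (u * 1) ζ :=
    ((hasDerivAt_id ζ).sub_const z).const_mul u
  refine (hd.clog h).congr_deriv ?_
  field_simp

theorem sum_integral_sub_inv_of_notMem {δ : ℝ} (hδ : 0 < δ) {a : ℤ × ℤ} {z : ℂ}
    (hz : z ∉ gridSquare δ a) : ∑ k, integral δ (a, k) (fun ζ => (ζ - z)⁻¹) = 0 := by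
  -- One of the four half planes through `z` that are parallel to the axes contains the square.
  obtain ⟨u, hu, h⟩ : ∃ u : ℂ, u ≠ 0 ∧ ∀ ζ ∈ gridSquare δ a, 0 < (u * (ζ - z)).re := by
    simp only [gridSquare, Set.mem_ofPred_eq, not_and_or, not_le] at hz
    rcases hz with (hz | hz) | hz | hz
    · exact ⟨1, one_ne_zero, fun ζ hζ => by
        simpa using lt_of_lt_of_le hz hζ.1.1⟩
    · exact ⟨-1, by simp, fun ζ hζ => by
        simpa using lt_of_le_of_lt hζ.1.2 hz⟩
    · exact ⟨-Complex.I, by simp, fun ζ hζ => by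
        simpa using lt_of_lt_of_le hz hζ.2.1⟩
    · exact ⟨Complex.I, by simp, fun ζ hζ => by
        simpa using lt_of_le_of_lt hζ.2.2 hz⟩
  exact sum_integral_eq_zero hδ (fun ζ hζ => hasDerivAt_log_mul_sub hu (Or.inl (h ζ hζ)))
    (continuousOn_sub_inv hz)

/-- The boundary of a square winds once around the points of its interior. The logarithm is a
primitive along the lower, right and upper sides, and `log (-·)` is one along the left side. -/
theorem sum_integral_sub_inv_of_mem_interior {δ : ℝ} {a : ℤ × ℤ} {z : ℂ}
    (h1 : δ * a.1 < z.re) (h2 : z.re < δ * (a.1 + 1)) (h3 : δ * a.2 < z.im)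
    (h4 : z.im < δ * (a.2 + 1)) :
    ∑ k, integral δ (a, k) (fun ζ => (ζ - z)⁻¹) = 2 * Real.pi * Complex.I := by
  obtain ⟨i, j⟩ := a
  simp only at h1 h2 h3 h4
  have key : ∀ (k : Fin 4) (u : ℂ), u ≠ 0 →
      (∀ t ∈ Set.Icc (0 : ℝ) 1, u * (arc δ ((i, j), k) t - z) ∈ Complex.slitPlane) →
      integral δ ((i, j), k) (fun ζ => (ζ - z)⁻¹) =
        Complex.log (u * (latticePoint δ (tgt ((i, j), k)) - z)) -
          Complex.log (u * (latticePoint δ (src ((i, j), k)) - z)) := by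
    intro k u hu h
    refine integral_eq_sub (G := fun ζ => Complex.log (u * (ζ - z)))
      (fun t ht => hasDerivAt_log_mul_sub hu (h t ht)) ?_
    refine ContinuousOn.inv₀ ?_ fun t ht h0 => ?_
    · exact ((contDiff_arc δ _).continuous.sub continuous_const).continuousOn
    · simpa [h0] using h t ht
  have k0 := key 0 1 one_ne_zero fun t ht => Or.inr (ne_of_lt (by
    simp [arc, src, tgt, latticePoint]; linarith))
  have k1 := key 1 1 one_ne_zero fun t ht => Or.inl (by
    simp [arc, src, tgt, latticePoint]; linarith)
  have k2 := key 2 1 one_ne_zero fun t ht => Or.inr (ne_of_gt (by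
    simp [arc, src, tgt, latticePoint]; linarith))
  have k3 := key 3 (-1) (by simp) fun t ht => Or.inl (by
    simp [arc, src, tgt, latticePoint]; linarith)
  rw [Fin.sum_univ_four, k0, k1, k2, k3]
  have hlow : (latticePoint δ (i, j) - z).im < 0 := by simp [latticePoint]; linarith
  have hupp : 0 < (latticePoint δ (i, j + 1) - z).im := by simp [latticePoint]; linarith
  have e1 : Complex.log (-(latticePoint δ (i, j) - z)) =
      Complex.log (latticePoint δ (i, j) - z) + Real.pi * Complex.I := by
    simp only [Complex.log, norm_neg, Complex.arg_neg_eq_arg_add_pi_of_im_neg hlow]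
    push_cast; ring
  have e2 : Complex.log (-(latticePoint δ (i, j + 1) - z)) =
      Complex.log (latticePoint δ (i, j + 1) - z) - Real.pi * Complex.I := by
    simp only [Complex.log, norm_neg, Complex.arg_neg_eq_arg_sub_pi_of_im_pos hupp]
    push_cast; ring
  simp only [src, tgt, one_mul, neg_mul]
  simp only [Matrix.cons_val, Prod.mk_add_mk, add_zero]
  rw [e1, e2]
  ring

end Integral

/-- The directed edges on the boundary of the union of a finite family of squares: those sides
of a square of the family whose opposite is not a side of a square of the family. -/
def boundary (S : Finset (ℤ × ℤ)) : Finset GridEdge :=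
  (S ×ˢ Finset.univ).filter fun e => e.rev.1 ∉ S

/-- Reversal permutes those sides of the squares of a family whose opposite is a side as well. -/
theorem sum_interior_rev {M : Type*} [AddCommMonoid M] (S : Finset (ℤ × ℤ)) (f : GridEdge → M) :
    ∑ e ∈ (S ×ˢ Finset.univ).filter (fun e : GridEdge => ¬ e.rev.1 ∉ S), f e.rev =
      ∑ e ∈ (S ×ˢ Finset.univ).filter (fun e : GridEdge => ¬ e.rev.1 ∉ S), f e := by
  refine Finset.sum_nbij' rev rev ?_ ?_ (fun e _ => e.rev_rev) (fun e _ => e.rev_rev)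
    fun e _ => rfl
  all_goals
    intro e he
    simp only [Finset.mem_filter, Finset.mem_product, Finset.mem_univ, and_true, not_not,
      rev_rev] at he ⊢
    exact he.symm

theorem sum_boundary_of_rev_eq_neg {V : Type*} [AddCommGroup V] [Module ℂ V]
    (S : Finset (ℤ × ℤ)) {f : GridEdge → V} (h : ∀ e, f e.rev = -f e) :
    ∑ e ∈ boundary S, f e = ∑ a ∈ S, ∑ k, f (a, k) := by
  have h1 := sum_interior_rev S f
  simp only [h, Finset.sum_neg_distrib] at h1
  have h2 : ∑ e ∈ (S ×ˢ Finset.univ).filter (fun e : GridEdge => ¬ e.rev.1 ∉ S), f e = 0 := by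
    have h3 : (2 : ℂ) • ∑ e ∈ (S ×ˢ Finset.univ).filter
        (fun e : GridEdge => ¬ e.rev.1 ∉ S), f e = 0 := by
      rw [two_smul]
      nth_rewrite 1 [← h1]
      exact neg_add_cancel _
    exact (smul_eq_zero.1 h3).resolve_left two_ne_zero
  rw [← Finset.sum_product' (f := fun a k => f (a, k)),
    ← Finset.sum_filter_add_sum_filter_not (S ×ˢ Finset.univ)
      (fun e : GridEdge => e.rev.1 ∉ S), h2, add_zero, boundary]

/-- Every lattice point is as often the end point as the starting point of a boundary edge. -/
theorem sum_boundary_src {M : Type*} [AddCancelCommMonoid M] (S : Finset (ℤ × ℤ))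
    (f : ℤ × ℤ → M) : ∑ e ∈ boundary S, f e.tgt = ∑ e ∈ boundary S, f e.src := by
  have h1 := sum_interior_rev S fun e => f e.src
  simp only [src_rev] at h1
  have h2 : ∑ e ∈ S ×ˢ Finset.univ, f (tgt e) = ∑ e ∈ S ×ˢ Finset.univ, f (src e) := by
    rw [Finset.sum_product, Finset.sum_product]
    refine Finset.sum_congr rfl fun a _ => ?_
    simp only [Fin.sum_univ_four, src, tgt, Matrix.cons_val]
    abel
  rw [← Finset.sum_filter_add_sum_filter_not _ (fun e : GridEdge => e.rev.1 ∉ S),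
    ← Finset.sum_filter_add_sum_filter_not (s := S ×ˢ Finset.univ)
      (p := fun e : GridEdge => e.rev.1 ∉ S) (f := fun e => f (src e)), h1] at h2
  exact add_right_cancel h2

end GridEdge

/-- The boundary of the union of a finite family of grid squares, as a cycle. -/
def gridCycle (δ : ℝ) (S : Finset (ℤ × ℤ)) : Cycle where
  card := (GridEdge.boundary S).card
  arc j := GridEdge.arc δ ((GridEdge.boundary S).equivFin.symm j)
  contDiff j := GridEdge.contDiff_arc δ _
  closed := by
    have key : ∀ f : GridEdge → ℂ,
        Finset.univ.val.map (fun j => f ((GridEdge.boundary S).equivFin.symm j)) =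
          ∑ e ∈ GridEdge.boundary S, {f e} := by
      intro f
      rw [← Finset.sum_coe_sort, ← (GridEdge.boundary S).equivFin.symm.sum_comp,
        Finset.sum_eq_multiset_sum, ← Multiset.sum_map_singleton (Multiset.map _ _),
        Multiset.map_map]
      rfl
    simp only [GridEdge.arc_zero, GridEdge.arc_one]
    rw [key fun e => latticePoint δ e.tgt, key fun e => latticePoint δ e.src]
    exact GridEdge.sum_boundary_src S fun a => {latticePoint δ a}

theorem gridCycle_integral {V : Type*} [NormedAddCommGroup V] [NormedSpace ℂ V] (δ : ℝ)
    (S : Finset (ℤ × ℤ)) (F : ℂ → V) :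
    (gridCycle δ S).integral F = ∑ a ∈ S, ∑ k, GridEdge.integral δ (a, k) F := by
  rw [← GridEdge.sum_boundary_of_rev_eq_neg S (f := fun e => GridEdge.integral δ e F)
      fun e => GridEdge.integral_rev δ e F,
    ← Finset.sum_coe_sort, ← (GridEdge.boundary S).equivFin.symm.sum_comp]
  rfl

theorem exists_of_mem_trace_gridCycle {δ : ℝ} (hδ : 0 < δ) {S : Finset (ℤ × ℤ)} {ζ : ℂ}
    (hζ : ζ ∈ (gridCycle δ S).trace) :
    ∃ a ∈ S, ∃ b ∉ S, ζ ∈ gridSquare δ a ∧ ζ ∈ gridSquare δ b := by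
  obtain ⟨j, t, ht, rfl⟩ := Set.mem_iUnion.1 hζ
  set e := (GridEdge.boundary S).equivFin.symm j
  have he := e.2
  simp only [GridEdge.boundary, Finset.mem_filter, Finset.mem_product, Finset.mem_univ,
    and_true] at he
  refine ⟨_, he.1, _, he.2, GridEdge.arc_mem_gridSquare hδ _ ht, ?_⟩
  have h := GridEdge.arc_mem_gridSquare hδ (GridEdge.rev e.1)
    (t := 1 - t) ⟨sub_nonneg.2 ht.2, by linarith [ht.1]⟩
  rw [GridEdge.arc_rev, sub_sub_cancel] at h
  exact h

/-! ### Cauchy's theorem for cycles and the holomorphic functional calculus -/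

theorem finite_setOf_gridSquare_inter_nonempty {δ : ℝ} (hδ : 0 < δ) {K : Set ℂ}
    (hK : Bornology.IsBounded K) : {a | (gridSquare δ a ∩ K).Nonempty}.Finite := by
  obtain ⟨R, hR⟩ := hK.subset_closedBall 0
  obtain ⟨N, hN⟩ := exists_nat_ge (R / δ + 1)
  have hN' : R + δ ≤ δ * N := by
    have := mul_le_mul_of_nonneg_left hN hδ.le
    rwa [mul_add, mul_div_cancel₀ _ hδ.ne', mul_one] at this
  refine ((Set.finite_Icc (-(N : ℤ)) N).prod (Set.finite_Icc (-(N : ℤ)) N)).subset ?_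
  rintro ⟨i, j⟩ ⟨z, ⟨⟨h1, h2⟩, h3, h4⟩, hz⟩
  have hzR : ‖z‖ ≤ R := by simpa using hR hz
  have h5 := abs_le.1 ((Complex.abs_re_le_norm z).trans hzR)
  have h6 := abs_le.1 ((Complex.abs_im_le_norm z).trans hzR)
  simp only at h1 h2 h3 h4
  have key : ∀ x y : ℝ, δ * x ≤ δ * y → x ≤ y := fun x y h => le_of_mul_le_mul_left h hδ
  have e1 : (i : ℝ) ≤ N := key _ _ (by linarith)
  have e2 : (j : ℝ) ≤ N := key _ _ (by linarith)
  have e3 : -(N : ℝ) ≤ i := key _ _ (by linarith)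
  have e4 : -(N : ℝ) ≤ j := key _ _ (by linarith)
  simp only [Set.mem_prod, Set.mem_Icc]
  exact ⟨⟨by exact_mod_cast e3, by exact_mod_cast e1⟩, by exact_mod_cast e4,
    by exact_mod_cast e2⟩

theorem gridSquare_subset_ball {δ : ℝ} (hδ : 0 < δ) {a : ℤ × ℤ} {z : ℂ}
    (hz : z ∈ gridSquare δ a) : gridSquare δ a ⊆ Metric.ball z (3 * δ) := by
  rintro ζ ⟨⟨h1, h2⟩, h3, h4⟩
  obtain ⟨⟨h5, h6⟩, h7, h8⟩ := hz
  rw [Metric.mem_ball, dist_eq_norm]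
  have h := Complex.norm_le_abs_re_add_abs_im (ζ - z)
  have hre : |(ζ - z).re| ≤ δ := by
    rw [Complex.sub_re, abs_le]; constructor <;> linarith
  have him : |(ζ - z).im| ≤ δ := by
    rw [Complex.sub_im, abs_le]; constructor <;> linarith
  linarith

theorem exists_mem_gridSquare {δ : ℝ} (hδ : 0 < δ) (z : ℂ) : ∃ a, z ∈ gridSquare δ a := by
  have key : ∀ x : ℝ, δ * ⌊x / δ⌋ ≤ x ∧ x ≤ δ * (⌊x / δ⌋ + 1) := fun x => by
    constructor
    · have := mul_le_mul_of_nonneg_left (Int.floor_le (x / δ)) hδ.le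
      rwa [mul_div_cancel₀ _ hδ.ne'] at this
    · have := mul_le_mul_of_nonneg_left (Int.lt_floor_add_one (x / δ)).le hδ.le
      rwa [mul_div_cancel₀ _ hδ.ne'] at this
  exact ⟨(⌊z.re / δ⌋, ⌊z.im / δ⌋), key z.re, key z.im⟩

theorem gridCycle_windingNumber_eq_one {δ : ℝ} (hδ : 0 < δ) {S : Finset (ℤ × ℤ)} {a : ℤ × ℤ}
    (ha : a ∈ S) {w : ℂ} (hw : w ∈ gridSquare δ a) (hwS : w ∉ (gridCycle δ S).trace) :
    (gridCycle δ S).windingNumber w = 1 := by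
  -- By local constancy, `w` can be moved into the interior of the square.
  obtain ⟨r, hr, hball⟩ := Metric.isOpen_iff.1
    (gridCycle δ S).isCompact_trace.isClosed.isOpen_compl w hwS
  let c : ℂ := ⟨δ * (a.1 + 1 / 2), δ * (a.2 + 1 / 2)⟩
  obtain ⟨s, ⟨hs0, hs1⟩, hsr⟩ : ∃ s : ℝ, (0 < s ∧ s < 1) ∧ ‖(s : ℂ) * (c - w)‖ < r := by
    have h1 : Tendsto (fun s : ℝ => ‖(s : ℂ) * (c - w)‖) (𝓝[>] 0) (𝓝 0) := by
      have : Continuous fun s : ℝ => ‖(s : ℂ) * (c - w)‖ := by fun_prop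
      simpa using (this.tendsto 0).mono_left nhdsWithin_le_nhds
    have h2 : ∀ᶠ s in 𝓝[>] (0 : ℝ), 0 < s ∧ s < 1 := Ioo_mem_nhdsGT (zero_lt_one' ℝ)
    exact (h2.and (h1.eventually_lt_const hr)).exists
  set w' : ℂ := w + s * (c - w)
  have hww' : (gridCycle δ S).windingNumber w' = (gridCycle δ S).windingNumber w := by
    refine Cycle.windingNumber_eq_of_norm_lt _ fun ζ hζ => ?_
    have h1 : ‖w' - w‖ < r := by simpa [w'] using hsr
    refine h1.trans_le (le_of_not_gt fun h2 => ?_)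
    exact hball (by rwa [Metric.mem_ball, dist_eq_norm]) hζ
  obtain ⟨⟨h1, h2⟩, h3, h4⟩ := hw
  have hre : w'.re = w.re + s * (δ * (a.1 + 1 / 2) - w.re) := by simp [w', c]
  have him : w'.im = w.im + s * (δ * (a.2 + 1 / 2) - w.im) := by simp [w', c]
  have i1 : δ * a.1 < w'.re := by rw [hre]; nlinarith [mul_pos hs0 hδ]
  have i2 : w'.re < δ * (a.1 + 1) := by rw [hre]; nlinarith [mul_pos hs0 hδ]
  have i3 : δ * a.2 < w'.im := by rw [him]; nlinarith [mul_pos hs0 hδ]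
  have i4 : w'.im < δ * (a.2 + 1) := by rw [him]; nlinarith [mul_pos hs0 hδ]
  rw [← hww', Cycle.windingNumber, gridCycle_integral, Finset.sum_eq_single a,
    GridEdge.sum_integral_sub_inv_of_mem_interior i1 i2 i3 i4,
    inv_mul_cancel₀ Complex.two_pi_I_ne_zero]
  · intro b _ hba
    refine GridEdge.sum_integral_sub_inv_of_notMem hδ fun hb => hba ?_
    obtain ⟨⟨b1, b2⟩, b3, b4⟩ := hb
    have key : ∀ m n : ℤ, δ * m < δ * (n + 1) → m ≤ n := fun m n h => by
      have := lt_of_mul_lt_mul_left h hδ.le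
      exact Int.lt_add_one_iff.1 (by exact_mod_cast this)
    exact Prod.ext
      (le_antisymm (key _ _ (b1.trans_lt i2)) (key _ _ (i1.trans_le b2)))
      (le_antisymm (key _ _ (b3.trans_lt i4)) (key _ _ (i3.trans_le b4)))
  · exact fun h => absurd ha h

/-- Every compact subset `K` of an open set `V` is surrounded in `V` by a cycle, for which
Cauchy's theorem holds: the boundary of the union of the squares of a fine grid that meet `K`. -/
theorem exists_cycle_of_isCompact {K V : Set ℂ} (hK : IsCompact K) (hV : IsOpen V) (hKV : K ⊆ V) :
    ∃ σ : Cycle, σ.trace ⊆ V \ K ∧ (∀ w ∈ K, σ.windingNumber w = 1) ∧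
      ∀ (E : Type) [NormedAddCommGroup E] [NormedSpace ℂ E] [CompleteSpace E] (F : ℂ → E),
        DifferentiableOn ℂ F V → σ.integral F = 0 := by
  obtain ⟨ε, hε, hεV⟩ := hK.exists_thickening_subset_open hV hKV
  set δ := ε / 3
  have hδ : 0 < δ := by positivity
  have hδV : ∀ z ∈ K, Metric.ball z (3 * δ) ⊆ V := fun z hz ζ hζ => by
    refine hεV (Metric.mem_thickening_iff.2 ⟨z, hz, ?_⟩)
    rwa [Metric.mem_ball, show 3 * δ = ε by simp only [δ]; ring] at hζ
  have hfin := finite_setOf_gridSquare_inter_nonempty hδ hK.isBounded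
  set S := hfin.toFinset
  have hS : ∀ a, a ∈ S ↔ (gridSquare δ a ∩ K).Nonempty := fun a => hfin.mem_toFinset
  have htr : (gridCycle δ S).trace ⊆ V \ K := by
    intro ζ hζ
    obtain ⟨a, ha, b, hb, hζa, hζb⟩ := exists_of_mem_trace_gridCycle hδ hζ
    obtain ⟨z, hza, hzK⟩ := (hS a).1 ha
    exact ⟨hδV z hzK (gridSquare_subset_ball hδ hza hζa), fun hζK => hb ((hS b).2 ⟨ζ, hζb, hζK⟩)⟩
  refine ⟨gridCycle δ S, htr, fun w hw => ?_, ?_⟩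
  · obtain ⟨a, ha⟩ := exists_mem_gridSquare hδ w
    exact gridCycle_windingNumber_eq_one hδ ((hS a).2 ⟨w, ha, hw⟩) ha fun h => (htr h).2 hw
  · intro E _ _ _ F hF
    rw [gridCycle_integral]
    refine Finset.sum_eq_zero fun a ha => ?_
    obtain ⟨z, hza, hzK⟩ := (hS a).1 ha
    have hd := hF.mono (hδV z hzK)
    obtain ⟨G, hG⟩ := hd.isExactOn_ball
    have hsub := gridSquare_subset_ball hδ hza
    exact GridEdge.sum_integral_eq_zero hδ (fun ζ hζ => hG ζ (hsub hζ)) (hd.continuousOn.mono hsub)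

/-- Cauchy's integral formula for a cycle along which Cauchy's theorem holds. -/
theorem Cycle.integral_sub_inv_smul {E : Type*} [NormedAddCommGroup E] [NormedSpace ℂ E]
    [CompleteSpace E] {σ : Cycle} {V : Set ℂ} (hV : IsOpen V) (hσV : σ.trace ⊆ V)
    (hσ : ∀ F : ℂ → E, DifferentiableOn ℂ F V → σ.integral F = 0) {F : ℂ → E}
    (hF : DifferentiableOn ℂ F V) {z : ℂ} (hz : z ∈ V) (hzσ : z ∉ σ.trace)
    (hwind : σ.windingNumber z = 1) :
    σ.integral (fun ζ => (ζ - z)⁻¹ • F ζ) = (2 * Real.pi * Complex.I : ℂ) • F z := by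
  have h1 := hσ _ ((Complex.differentiableOn_dslope (hV.mem_nhds hz)).2 hF)
  have h2 : Set.EqOn (dslope F z) (fun ζ => (ζ - z)⁻¹ • F ζ - (ζ - z)⁻¹ • F z) σ.trace := by
    intro ζ hζ
    rw [dslope_of_ne F (fun h => hzσ (by rwa [← h]) : ζ ≠ z), slope_def_module, smul_sub]
  have h3 := continuousOn_sub_inv hzσ
  rw [σ.integral_congr h2, σ.integral_sub (F := fun ζ => (ζ - z)⁻¹ • F ζ)
    (G := fun ζ => (ζ - z)⁻¹ • F z) (h3.smul (hF.continuousOn.mono hσV))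
    (h3.smul continuousOn_const), σ.integral_smul_const, sub_eq_zero] at h1
  rw [h1]
  congr 1
  rwa [Cycle.windingNumber, inv_mul_eq_iff_eq_mul₀ Complex.two_pi_I_ne_zero, mul_one] at hwind

/-- The homology version of Cauchy's theorem: two cycles in an open set `V` which wind equally
often around the points outside `V` give the same integrals of holomorphic functions. By Cauchy's
formula for a cycle `σ` which surrounds both of them and all points where the winding numbers
differ, the integrals are integrals of the winding numbers along `σ`. -/
theorem Cycle.integral_eq_of_windingNumber_eq {E : Type} [NormedAddCommGroup E] [NormedSpace ℂ E]
    [CompleteSpace E] {Γ₁ Γ₂ : Cycle} {V : Set ℂ} (hV : IsOpen V) (h₁ : Γ₁.trace ⊆ V)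
    (h₂ : Γ₂.trace ⊆ V) (hw : ∀ w ∉ V, Γ₁.windingNumber w = Γ₂.windingNumber w) {F : ℂ → E}
    (hF : DifferentiableOn ℂ F V) : Γ₁.integral F = Γ₂.integral F := by
  set K : Set ℂ := {w | w ∉ Γ₁.trace → w ∉ Γ₂.trace → Γ₁.windingNumber w ≠ Γ₂.windingNumber w}
  have hT : IsCompact (Γ₁.trace ∪ Γ₂.trace) := Γ₁.isCompact_trace.union Γ₂.isCompact_trace
  have hKV : K ⊆ V := fun w hwK => by
    by_contra hwV
    exact hwK (fun h => hwV (h₁ h)) (fun h => hwV (h₂ h)) (hw w hwV)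
  have hKc : IsCompact K := by
    refine Metric.isCompact_of_isClosed_isBounded ?_ ?_
    · rw [← isOpen_compl_iff, Metric.isOpen_iff]
      intro w hwK
      have hwK' : w ∉ Γ₁.trace ∧ w ∉ Γ₂.trace ∧ Γ₁.windingNumber w = Γ₂.windingNumber w := by
        simpa [K] using hwK
      obtain ⟨n1, n2, n3⟩ := hwK'
      obtain ⟨r, hr, hball⟩ := Metric.isOpen_iff.1 hT.isClosed.isOpen_compl w
        (fun h => h.elim n1 n2)
      refine ⟨r, hr, fun w' hw' hK' => ?_⟩
      have hlt : ∀ ζ ∈ Γ₁.trace ∪ Γ₂.trace, ‖w' - w‖ < ‖ζ - w‖ := fun ζ hζ => by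
        rw [Metric.mem_ball, dist_eq_norm] at hw'
        refine hw'.trans_le (le_of_not_gt fun h => hball ?_ hζ)
        rwa [Metric.mem_ball, dist_eq_norm]
      have hn := hball hw'
      refine hK' (fun h => hn (Or.inl h)) (fun h => hn (Or.inr h)) ?_
      rw [Γ₁.windingNumber_eq_of_norm_lt fun ζ hζ => hlt ζ (Or.inl hζ),
        Γ₂.windingNumber_eq_of_norm_lt fun ζ hζ => hlt ζ (Or.inr hζ), n3]
    · obtain ⟨R, hR⟩ := hT.isBounded.subset_closedBall 0
      refine (Metric.isBounded_closedBall (x := (0 : ℂ)) (r := R)).subset fun w hwK => ?_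
      by_contra hwR
      have hlt : ∀ ζ ∈ Γ₁.trace ∪ Γ₂.trace, ‖ζ‖ < ‖w‖ := fun ζ hζ => by
        have h1 := hR hζ
        simp only [mem_closedBall_zero_iff, not_le] at h1 hwR
        exact h1.trans_lt hwR
      refine hwK (fun h => hwR (hR (Or.inl h))) (fun h => hwR (hR (Or.inr h))) ?_
      rw [Γ₁.windingNumber_eq_zero_of_norm_lt fun ζ hζ => hlt ζ (Or.inl hζ),
        Γ₂.windingNumber_eq_zero_of_norm_lt fun ζ hζ => hlt ζ (Or.inr hζ)]
  obtain ⟨σ, hσt, hσ1, hσ0⟩ := exists_cycle_of_isCompact hKc hV hKV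
  have hσV : σ.trace ⊆ V := fun ζ hζ => (hσt hζ).1
  have key : ∀ Γ : Cycle, Γ.trace ⊆ K → (2 * Real.pi * Complex.I : ℂ) • Γ.integral F =
      -((2 * Real.pi * Complex.I : ℂ) • σ.integral fun ζ => Γ.windingNumber ζ • F ζ) := by
    intro Γ hΓ
    have hne : ∀ z ∈ Γ.trace, ∀ ζ ∈ σ.trace, ζ - z ≠ 0 := fun z hz ζ hζ h => by
      rw [sub_eq_zero.1 h] at hζ
      exact (hσt hζ).2 (hΓ hz)
    have e1 : (2 * Real.pi * Complex.I : ℂ) • Γ.integral F =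
        Γ.integral fun z => σ.integral fun ζ => (ζ - z)⁻¹ • F ζ := by
      rw [← Γ.integral_const_smul]
      refine Γ.integral_congr fun z hz => ?_
      exact (Cycle.integral_sub_inv_smul hV hσV (hσ0 E) hF (hKV (hΓ hz))
        (fun h => (hσt h).2 (hΓ hz)) (hσ1 z (hΓ hz))).symm
    rw [e1, Γ.integral_integral_comm, ← smul_neg, ← neg_one_smul ℂ (σ.integral _),
      ← σ.integral_const_smul, ← σ.integral_const_smul]
    · refine σ.integral_congr fun ζ _ => ?_
      rw [Γ.integral_smul_const, Cycle.windingNumber, ← smul_assoc, ← smul_assoc]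
      congr 1
      have e2 : Γ.integral (fun z => (ζ - z)⁻¹) = (-1 : ℂ) * Γ.integral fun z => (z - ζ)⁻¹ := by
        rw [← smul_eq_mul, ← Γ.integral_const_smul]
        refine Γ.integral_congr fun z _ => ?_
        simp only [smul_eq_mul]
        rw [← neg_sub, inv_neg, neg_one_mul]
      rw [e2]
      simp only [smul_eq_mul]
      field_simp [Complex.two_pi_I_ne_zero]
    · refine ContinuousOn.smul (ContinuousOn.inv₀ (by fun_prop) ?_) ?_
      · exact fun p hp => hne p.1 hp.1 p.2 hp.2
      · exact (hF.continuousOn.mono hσV).comp continuousOn_snd fun p hp => hp.2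
  have h := key Γ₁ (fun z hz h _ => absurd hz h)
  have h' := key Γ₂ (fun z hz _ h => absurd hz h)
  have hσw : σ.integral (fun ζ => Γ₁.windingNumber ζ • F ζ) =
      σ.integral fun ζ => Γ₂.windingNumber ζ • F ζ := by
    refine σ.integral_congr fun ζ hζ => ?_
    have hζK := (hσt hζ).2
    simp only [K, Set.mem_ofPred_eq, Classical.not_imp, not_not] at hζK
    simp only [hζK.2.2]
  rw [hσw, ← h'] at h
  exact smul_right_injective E Complex.two_pi_I_ne_zero h

/-- The holomorphic functional calculus is well defined: a cycle as required exists, and the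
integral is independent of it. -/
theorem isHolomorphicFunction_integral {B : Type} [NormedRing B] [NormedAlgebra ℂ B]
    [CompleteSpace B] {U : Set ℂ} (hU : IsOpen U) {g : ℂ → ℂ} (hg : DifferentiableOn ℂ g U) {b : B}
    {Γ : Cycle} (hΓ : Γ.Surrounds (spectrum ℂ b) U) :
    IsHolomorphicFunction U g b
      ((2 * Real.pi * Complex.I : ℂ)⁻¹ • Γ.integral fun ζ => g ζ • resolvent b ζ) := by
  refine ⟨⟨Γ, hΓ⟩, fun Γ' hΓ' => ?_⟩
  have htr : ∀ Γ : Cycle, Γ.Surrounds (spectrum ℂ b) U → Γ.trace ⊆ U \ spectrum ℂ b := by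
    rintro Γ hΓ _ h
    obtain ⟨j, t, ht, rfl⟩ := Set.mem_iUnion.1 h
    exact hΓ.mem j t ht
  congr 1
  refine Cycle.integral_eq_of_windingNumber_eq (hU.sdiff (spectrum.isClosed b)) (htr Γ hΓ)
    (htr Γ' hΓ') (fun w hw => ?_) ?_
  · by_cases hwU : w ∈ U
    · have hwb : w ∈ spectrum ℂ b := by
        by_contra h
        exact hw ⟨hwU, h⟩
      rw [hΓ.inner w hwb, hΓ'.inner w hwb]
    · rw [hΓ.outer w hwU, hΓ'.outer w hwU]
  · refine (hg.mono Set.sdiff_subset).smul fun ζ hζ => ?_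
    exact (spectrum.hasDerivAt_resolvent_const_left
      (not_not.1 hζ.2)).differentiableAt.differentiableWithinAt

/-! ### Families with relatively compact range -/

theorem totallyBounded_range_map {E F : Type*} [UniformSpace E] [CompleteSpace E]
    [UniformSpace F] {ι : Type*} {f : E → F} (hf : Continuous f) {u : ι → E}
    (hu : TotallyBounded (Set.range u)) : TotallyBounded (Set.range fun k => f (u k)) := by
  have hK := hu.closure.isCompact_of_isClosed isClosed_closure
  refine (hK.image hf).totallyBounded.subset ?_
  rintro _ ⟨k, rfl⟩
  exact Set.mem_image_of_mem f (subset_closure ⟨k, rfl⟩)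

theorem totallyBounded_range_prodMk {E F : Type*} [UniformSpace E] [UniformSpace F]
    [CompleteSpace E] [CompleteSpace F] {ι : Type*} {u : ι → E} {v : ι → F}
    (hu : TotallyBounded (Set.range u)) (hv : TotallyBounded (Set.range v)) :
    TotallyBounded (Set.range fun k => (u k, v k)) := by
  have hK := hu.closure.isCompact_of_isClosed isClosed_closure
  have hL := hv.closure.isCompact_of_isClosed isClosed_closure
  refine (hK.prod hL).totallyBounded.subset ?_
  rintro _ ⟨k, rfl⟩
  exact ⟨subset_closure ⟨k, rfl⟩, subset_closure ⟨k, rfl⟩⟩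

/-- Recurrence: a relatively compact orbit of an isometric action of `ℤ` returns arbitrarily
close to its starting point at arbitrarily late times. -/
theorem exists_dist_lt_of_totallyBounded_range {E : Type*} [PseudoMetricSpace E] {u : ℤ → E}
    (hu : TotallyBounded (Set.range u))
    (hiso : ∀ k l m, dist (u (k + m)) (u (l + m)) = dist (u k) (u l))
    {ε : ℝ} (hε : 0 < ε) (N : ℕ) : ∃ n : ℕ, N ≤ n ∧ dist (u n) (u 0) < ε := by
  obtain ⟨t, ht, hcov⟩ := Metric.totallyBounded_iff.1 hu (ε / 2) (half_pos hε)
  have h1 : ∀ m : ℕ, ∃ y : t, dist (u ((N + 1) * m)) y < ε / 2 := fun m => by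
    obtain ⟨y, hy, hm⟩ := Set.mem_iUnion₂.1 (hcov ⟨((N : ℤ) + 1) * m, rfl⟩)
    exact ⟨⟨y, hy⟩, hm⟩
  choose c hc using h1
  have := ht.to_subtype
  obtain ⟨m, m', hne, heq⟩ := Finite.exists_ne_map_eq_of_infinite c
  wlog hlt : m < m' generalizing m m'
  · exact this m' m hne.symm heq.symm (lt_of_le_of_ne (not_lt.1 hlt) hne.symm)
  obtain ⟨d, rfl⟩ := Nat.exists_eq_add_of_lt hlt
  refine ⟨(N + 1) * (d + 1), by nlinarith, ?_⟩
  have h2 := hiso (((N + 1) * (d + 1) : ℕ) : ℤ) 0 ((N + 1) * m)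
  rw [← h2, zero_add]
  have h3 : ((((N + 1) * (d + 1) : ℕ) : ℤ) + (N + 1) * m) = (N + 1) * ((m + d + 1 : ℕ) : ℤ) := by
    push_cast; ring
  rw [h3]
  have h4 := hc m
  have h5 := hc (m + d + 1)
  rw [← heq] at h5
  calc _ ≤ _ := dist_triangle_right _ _ (c m : E)
    _ < ε := by linarith

/-- Strong convergence of bounded operators to zero is uniform on relatively compact sets. -/
theorem tendsto_apply_of_totallyBounded_range {E F : Type*} [NormedAddCommGroup E]
    [NormedSpace ℂ E] [NormedAddCommGroup F] [NormedSpace ℂ F] {D : ℕ → E →L[ℂ] F} {C : ℝ}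
    (hC : ∀ k, ‖D k‖ ≤ C) (hD : ∀ x, Tendsto (fun k => D k x) atTop (𝓝 0)) {u : ℕ → E}
    (hu : TotallyBounded (Set.range u)) : Tendsto (fun k => D k (u k)) atTop (𝓝 0) := by
  have hC0 : 0 ≤ C := (norm_nonneg _).trans (hC 0)
  rw [Metric.tendsto_atTop]
  intro ε hε
  obtain ⟨t, ht, hcov⟩ := Metric.totallyBounded_iff.1 hu (ε / (2 * (C + 1))) (by positivity)
  have h1 : ∀ᶠ k in atTop, ∀ y ∈ t, ‖D k y‖ < ε / 2 :=
    (ht.eventually_all).2 fun y _ =>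
      (by simpa using (hD y).norm : Tendsto (fun k => ‖D k y‖) atTop (𝓝 0)).eventually_lt_const
        (half_pos hε)
  obtain ⟨N, hN⟩ := eventually_atTop.1 h1
  refine ⟨N, fun k hk => ?_⟩
  obtain ⟨y, hy, hky⟩ := Set.mem_iUnion₂.1 (hcov ⟨k, rfl⟩)
  rw [Metric.mem_ball, dist_eq_norm] at hky
  rw [dist_zero_right]
  calc ‖D k (u k)‖ = ‖D k (u k - y) + D k y‖ := by rw [← map_add, sub_add_cancel]
    _ ≤ C * (ε / (2 * (C + 1))) + ‖D k y‖ := (norm_add_le _ _).trans (add_le_add_left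
        (((D k).le_of_opNorm_le (hC k) _).trans (mul_le_mul_of_nonneg_left hky.le hC0)) _)
    _ ≤ ε / 2 + ‖D k y‖ := by
        refine add_le_add_left ?_ _
        rw [show ε / (2 * (C + 1)) = (ε / 2) / (C + 1) by field_simp, mul_div_assoc', div_le_iff₀
          (by linarith)]
        nlinarith
    _ < ε := by linarith [hN k hk y hy]

/-! ### Almost periodic functions -/

theorem shiftFun_apply (k : ℤ) (b : ℤ →ᵇ ℂ) (n : ℤ) : shiftFun k b n = b (n + k) := rfl

theorem isAlmostPeriodic_iff (b : ℤ →ᵇ ℂ) :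
    IsAlmostPeriodic b ↔ TotallyBounded (Set.range fun k : ℤ => shiftFun k b) :=
  ⟨fun h => h.totallyBounded.subset subset_closure,
    fun h => h.closure.isCompact_of_isClosed isClosed_closure⟩

theorem norm_shiftFun (k : ℤ) (b : ℤ →ᵇ ℂ) : ‖shiftFun k b‖ = ‖b‖ := by
  refine le_antisymm ((shiftFun k b).norm_le (norm_nonneg _) |>.2 fun n => b.norm_coe_le_norm _)
    (b.norm_le (norm_nonneg _) |>.2 fun n => ?_)
  have h := (shiftFun k b).norm_coe_le_norm (n - k)
  rwa [shiftFun_apply, sub_add_cancel] at h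

theorem shiftFun_sub (k : ℤ) (b c : ℤ →ᵇ ℂ) :
    shiftFun k (b - c) = shiftFun k b - shiftFun k c := rfl

theorem shiftFun_add_shiftFun (k m : ℤ) (b : ℤ →ᵇ ℂ) :
    shiftFun (k + m) b = shiftFun m (shiftFun k b) := by
  ext n
  simp only [shiftFun_apply]
  congr 1
  ring

theorem dist_shiftFun (b : ℤ →ᵇ ℂ) (k l m : ℤ) :
    dist (shiftFun (k + m) b) (shiftFun (l + m) b) = dist (shiftFun k b) (shiftFun l b) := by
  rw [shiftFun_add_shiftFun, shiftFun_add_shiftFun l, dist_eq_norm, dist_eq_norm, ← shiftFun_sub,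
    norm_shiftFun]

theorem IsAlmostPeriodic.sub {b c : ℤ →ᵇ ℂ} (hb : IsAlmostPeriodic b) (hc : IsAlmostPeriodic c) :
    IsAlmostPeriodic (b - c) := by
  rw [isAlmostPeriodic_iff] at *
  exact totallyBounded_range_map (f := fun p : (ℤ →ᵇ ℂ) × (ℤ →ᵇ ℂ) => p.1 - p.2) (by fun_prop)
    (totallyBounded_range_prodMk hb hc)

/-- An almost periodic function which vanishes at `+∞` is zero. -/
theorem IsAlmostPeriodic.eq_zero_of_tendsto {b : ℤ →ᵇ ℂ} (hb : IsAlmostPeriodic b)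
    (h : Tendsto (fun n : ℕ => b n) atTop (𝓝 0)) : b = 0 := by
  ext m
  change b m = 0
  rw [← norm_le_zero_iff]
  refine le_of_forall_pos_le_add fun ε hε => ?_
  obtain ⟨N, hN⟩ := Metric.tendsto_atTop.1 h (ε / 2) (half_pos hε)
  obtain ⟨n, hn, hd⟩ := exists_dist_lt_of_totallyBounded_range ((isAlmostPeriodic_iff b).1 hb)
    (dist_shiftFun b) (half_pos hε) (N + m.natAbs)
  have h1 : dist (b (m + n)) (b m) < ε / 2 := by
    have := (BoundedContinuousFunction.dist_coe_le_dist (f := shiftFun n b) (g := shiftFun 0 b)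
      m).trans_lt hd
    simpa only [shiftFun_apply, add_zero] using this
  have h2 := hN (m + n).toNat (by omega)
  rw [Int.toNat_of_nonneg (by omega)] at h2
  rw [dist_eq_norm] at h1 h2
  rw [sub_zero] at h2
  have h3 := norm_sub_norm_le (b m) (b (m + n))
  rw [norm_sub_rev] at h3
  linarith

theorem IsAPPartOfDiagonal.unique {B : L2N →L[ℂ] L2N} {f f' : ℤ →ᵇ ℂ}
    (hf : IsAPPartOfDiagonal B f) (hf' : IsAPPartOfDiagonal B f') : f = f' := by
  refine sub_eq_zero.1 ((hf.1.sub hf'.1).eq_zero_of_tendsto ?_)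
  have h := hf'.2.sub hf.2
  rw [sub_zero] at h
  refine h.congr fun n => ?_
  simp

/-- The mean of `f` over the `n` translates by `0, …, n - 1`. -/
def translateMean (n : ℕ) (f : ℤ →ᵇ ℂ) : ℤ →ᵇ ℂ :=
  ((n : ℝ)⁻¹ : ℝ) • ∑ r ∈ Finset.range n, shiftFun r f

theorem translateMean_apply (n : ℕ) (f : ℤ →ᵇ ℂ) (m : ℤ) :
    translateMean n f m = (n : ℂ)⁻¹ * ∑ r ∈ Finset.range n, f (m + r) := by
  simp [translateMean, shiftFun_apply]

/-- All but `2 r` of the summands cancel in the difference of the two sums of `n` translates. -/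
theorem norm_shiftFun_translateMean_sub_le (n r : ℕ) (f : ℤ →ᵇ ℂ) :
    ‖shiftFun r (translateMean n f) - translateMean n f‖ ≤ 2 * r * ‖f‖ / n := by
  refine BoundedContinuousFunction.norm_le (by positivity) |>.2 fun m => ?_
  have h1 : ∀ m : ℤ, ∑ i ∈ Finset.range n, f (m + r + i) - ∑ i ∈ Finset.range n, f (m + i) =
      ∑ i ∈ Finset.range r, (f (m + n + i) - f (m + i)) := by
    intro m
    have e1 := Finset.sum_range_add (fun i : ℕ => f (m + i)) r n
    have e2 := Finset.sum_range_add (fun i : ℕ => f (m + i)) n r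
    rw [add_comm n r, e1] at e2
    rw [Finset.sum_sub_distrib]
    push_cast at e2
    simp only [← add_assoc] at e2
    linear_combination e2
  rw [BoundedContinuousFunction.sub_apply, shiftFun_apply, translateMean_apply,
    translateMean_apply, ← mul_sub, h1, norm_mul, norm_inv, Complex.norm_natCast, mul_comm,
    ← div_eq_mul_inv]
  gcongr
  calc _ ≤ ∑ i ∈ Finset.range r, (‖f‖ + ‖f‖) := norm_sum_le_of_le _ fun i _ =>
        (norm_sub_le _ _).trans (add_le_add (f.norm_coe_le_norm _) (f.norm_coe_le_norm _))
    _ = 2 * r * ‖f‖ := by simp; ring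

/-- The means of the translates of an almost periodic function have a limit point, as they
belong to the convex hull of a relatively compact set. It is invariant under translations, i.e.
constant, and it is approximated by one of the means; hence it is the mean value. -/
theorem IsAlmostPeriodic.exists_hasMeanValue {f : ℤ →ᵇ ℂ} (hf : IsAlmostPeriodic f) :
    ∃ m : ℂ, HasMeanValue f m := by
  rw [isAlmostPeriodic_iff] at hf
  have hK := hf.convexHull.closure.isCompact_of_isClosed isClosed_closure
  have hmem : ∀ n : ℕ, translateMean (n + 1) f ∈
      closure (convexHull ℝ (Set.range fun k : ℤ => shiftFun k f)) := fun n => by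
    refine subset_closure ?_
    rw [translateMean, Finset.smul_sum]
    refine (convex_convexHull ℝ _).sum_mem (fun _ _ => by positivity) ?_
      fun r _ => subset_convexHull ℝ _ ⟨r, rfl⟩
    rw [Finset.sum_const, Finset.card_range, nsmul_eq_mul]
    exact mul_inv_cancel₀ (by positivity)
  obtain ⟨g, -, φ, hφ, hg⟩ := hK.tendsto_subseq hmem
  have hdiv : ∀ c : ℝ, Tendsto (fun n : ℕ => c / (n : ℝ)) atTop (𝓝 0) := fun c =>
    tendsto_const_div_atTop_nhds_zero_nat c
  have hcont : Continuous (shiftFun 1) := by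
    refine LipschitzWith.continuous (K := 1) (LipschitzWith.of_dist_le_mul fun b c => ?_)
    rw [dist_eq_norm, dist_eq_norm, ← shiftFun_sub, norm_shiftFun, NNReal.coe_one, one_mul]
  have hinv : shiftFun 1 g = g := by
    have h1 : Tendsto (fun n => shiftFun 1 (translateMean (φ n + 1) f) - translateMean (φ n + 1) f)
        atTop (𝓝 (shiftFun 1 g - g)) := ((hcont.tendsto g).comp hg).sub hg
    have h2 : Tendsto (fun n => shiftFun 1 (translateMean (φ n + 1) f) - translateMean (φ n + 1) f)
        atTop (𝓝 0) := by
      refine squeeze_zero_norm (fun n => ?_)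
        ((hdiv (2 * (1 : ℕ) * ‖f‖)).comp ((tendsto_add_atTop_nat 1).comp hφ.tendsto_atTop))
      exact norm_shiftFun_translateMean_sub_le (φ n + 1) 1 f
    exact sub_eq_zero.1 (tendsto_nhds_unique h1 h2)
  have hconst : ∀ r : ℕ, g r = g 0 := by
    intro r
    induction r with
    | zero => rfl
    | succ r ih =>
      rw [← ih]
      conv_rhs => rw [← hinv]
      rw [shiftFun_apply]
      push_cast
      rfl
  refine ⟨g 0, ?_⟩
  rw [HasMeanValue, Metric.tendsto_atTop]
  intro ε hε
  obtain ⟨n₀, hn₀⟩ := Metric.tendsto_atTop.1 hg (ε / 2) (half_pos hε)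
  specialize hn₀ n₀ le_rfl
  set q := φ n₀ + 1
  have hq : (q : ℂ) ≠ 0 := Nat.cast_ne_zero.2 (Nat.succ_ne_zero (φ n₀))
  obtain ⟨N, hN⟩ := Metric.tendsto_atTop.1 (hdiv (2 * q * ‖f‖)) (ε / 2) (half_pos hε)
  refine ⟨max N 1, fun n hn => ?_⟩
  have hn1 : 1 ≤ n := (le_max_right _ _).trans hn
  have hn0 : (n : ℂ) ≠ 0 := by exact_mod_cast (by omega : n ≠ 0)
  have hN' := hN n ((le_max_left _ _).trans hn)
  rw [dist_zero_right, Real.norm_of_nonneg (by positivity)] at hN'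
  -- The mean over `{0, …, n - 1}` of the `q`-th translate mean is close to `g 0` and to the
  -- mean of `f` itself.
  set s : ℂ := (n : ℂ)⁻¹ * ∑ r ∈ Finset.range n, translateMean q f r
  have h1 : ‖s - g 0‖ ≤ ε / 2 := by
    have e1 : s - g 0 = (n : ℂ)⁻¹ * ∑ r ∈ Finset.range n, (translateMean q f r - g r) := by
      simp only [hconst, Finset.sum_sub_distrib, Finset.sum_const, Finset.card_range,
        nsmul_eq_mul, mul_sub, s]
      rw [inv_mul_cancel_left₀ hn0]
    rw [e1, norm_mul, norm_inv, Complex.norm_natCast]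
    rw [inv_mul_le_iff₀ (by positivity)]
    have e2 : ∀ r ∈ Finset.range n, ‖translateMean q f r - g r‖ ≤ ε / 2 := fun r _ => by
      rw [← dist_eq_norm]
      exact (BoundedContinuousFunction.dist_coe_le_dist _).trans hn₀.le
    exact (norm_sum_le_of_le _ e2).trans (by simp)
  have h2 : ‖s - (∑ r ∈ Finset.range n, f r) / n‖ ≤ 2 * q * ‖f‖ / n := by
    have e1 : s = (q : ℂ)⁻¹ * ∑ i ∈ Finset.range q, translateMean n f i := by
      simp only [s, translateMean_apply, Finset.mul_sum]
      rw [Finset.sum_comm]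
      refine Finset.sum_congr rfl fun i _ => Finset.sum_congr rfl fun r _ => ?_
      rw [add_comm (i : ℤ)]
      ring
    have e2 : (∑ r ∈ Finset.range n, f r) / n = translateMean n f 0 := by
      simp only [translateMean_apply, zero_add]
      rw [div_eq_inv_mul]
    have e3 : s - (∑ r ∈ Finset.range n, f r) / n = (q : ℂ)⁻¹ *
        ∑ i ∈ Finset.range q, (shiftFun i (translateMean n f) - translateMean n f) 0 := by
      simp only [BoundedContinuousFunction.sub_apply, shiftFun_apply, zero_add,
        Finset.sum_sub_distrib, Finset.sum_const, Finset.card_range, nsmul_eq_mul, mul_sub]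
      rw [inv_mul_cancel_left₀ hq, e1, e2]
    rw [e3, norm_mul, norm_inv, Complex.norm_natCast, inv_mul_le_iff₀ (by positivity)]
    refine (norm_sum_le_of_le _ (n := fun _ => 2 * q * ‖f‖ / n) fun i hi => ?_).trans (by simp)
    refine (BoundedContinuousFunction.norm_coe_le_norm _ 0).trans
      ((norm_shiftFun_translateMean_sub_le n i f).trans ?_)
    have : (i : ℝ) ≤ q := by exact_mod_cast (Finset.mem_range.1 hi).le
    gcongr
  rw [dist_eq_norm]
  have h3 := norm_sub_le (s - g 0) (s - (∑ r ∈ Finset.range n, f r) / n)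
  rw [sub_sub_sub_cancel_left] at h3
  linarith

/-! ### Shifts on `ℓ²(ℤ)` and operators with almost periodic diagonals -/

theorem hasSum_shift (k : ℤ) (x : L2Z) :
    HasSum (fun n : ℤ => ‖x (n - k)‖ ^ (2 : ℝ≥0∞).toReal) (‖x‖ ^ (2 : ℝ≥0∞).toReal) :=
  (Equiv.subRight k).hasSum_iff.2 (lp.hasSum_norm (p := 2) (by simp) x)

/-- The bilateral shift `(S_k x)_n = x_{n - k}` on `ℓ²(ℤ)`. -/
def shiftIsometry (k : ℤ) : L2Z →ₗᵢ[ℂ] L2Z where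
  toFun x := ⟨fun n => x (n - k), memℓp_gen (hasSum_shift k x).summable⟩
  map_add' _ _ := rfl
  map_smul' _ _ := rfl
  norm_map' x := by
    have h := (lp.hasSum_norm (p := 2) (by simp)
      (⟨fun n => x (n - k), memℓp_gen (hasSum_shift k x).summable⟩ : L2Z)).unique (hasSum_shift k x)
    exact (Real.rpow_left_inj (norm_nonneg _) (norm_nonneg _) (by simp)).1 h

/-- The bilateral shift as a bounded operator. -/
def shiftOp (k : ℤ) : L2Z →L[ℂ] L2Z := (shiftIsometry k).toContinuousLinearMap

theorem shiftOp_apply (k : ℤ) (x : L2Z) (n : ℤ) : shiftOp k x n = x (n - k) := rfl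

theorem norm_shiftOp_apply (k : ℤ) (x : L2Z) : ‖shiftOp k x‖ = ‖x‖ := (shiftIsometry k).norm_map x

theorem shiftOp_shiftOp (k l : ℤ) (x : L2Z) : shiftOp k (shiftOp l x) = shiftOp (k + l) x := by
  ext n
  simp only [shiftOp_apply, sub_sub]

theorem shiftOp_zero (x : L2Z) : shiftOp 0 x = x := by
  ext n
  simp [shiftOp_apply]

theorem shiftOp_neg_shiftOp (k : ℤ) (x : L2Z) : shiftOp (-k) (shiftOp k x) = x := by
  rw [shiftOp_shiftOp, neg_add_cancel, shiftOp_zero]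

theorem shiftOp_shiftOp_neg (k : ℤ) (x : L2Z) : shiftOp k (shiftOp (-k) x) = x := by
  rw [shiftOp_shiftOp, add_neg_cancel, shiftOp_zero]

theorem shiftOp_single (k j : ℤ) : shiftOp k (lp.single 2 j 1) = lp.single 2 (j + k) (1 : ℂ) := by
  ext n
  rw [shiftOp_apply, lp.coeFn_single, lp.coeFn_single, Pi.single_apply, Pi.single_apply]
  simp only [sub_eq_iff_eq_add]

theorem star_shiftOp (k : ℤ) : star (shiftOp k) = shiftOp (-k) := by
  refine ((ContinuousLinearMap.eq_adjoint_iff _ _).2 fun x y => ?_).symm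
  rw [← (shiftIsometry k).inner_map_map (shiftOp (-k) x) y]
  change inner ℂ (shiftOp k (shiftOp (-k) x)) (shiftOp k y) = _
  rw [shiftOp_shiftOp_neg]

/-- The translate `S_{-k} X S_k` of an operator on `ℓ²(ℤ)`. -/
def conjShift (k : ℤ) (X : L2Z →L[ℂ] L2Z) : L2Z →L[ℂ] L2Z := shiftOp (-k) * X * shiftOp k

theorem conjShift_apply (k : ℤ) (X : L2Z →L[ℂ] L2Z) (x : L2Z) :
    conjShift k X x = shiftOp (-k) (X (shiftOp k x)) := rfl

theorem shiftOp_conjShift_apply (k : ℤ) (X : L2Z →L[ℂ] L2Z) (x : L2Z) :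
    shiftOp k (conjShift k X x) = X (shiftOp k x) := by
  rw [conjShift_apply, shiftOp_shiftOp_neg]

theorem conjShift_zero (X : L2Z →L[ℂ] L2Z) : conjShift 0 X = X := by
  ext1 x
  rw [conjShift_apply, neg_zero, shiftOp_zero, shiftOp_zero]

theorem conjShift_add (k : ℤ) (X Y : L2Z →L[ℂ] L2Z) :
    conjShift k (X + Y) = conjShift k X + conjShift k Y := by
  simp only [conjShift, mul_add, add_mul]

theorem conjShift_sub (k : ℤ) (X Y : L2Z →L[ℂ] L2Z) :
    conjShift k (X - Y) = conjShift k X - conjShift k Y := by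
  simp only [conjShift, mul_sub, sub_mul]

theorem conjShift_mul (k : ℤ) (X Y : L2Z →L[ℂ] L2Z) :
    conjShift k (X * Y) = conjShift k X * conjShift k Y := by
  ext1 x
  change shiftOp (-k) (X (Y (shiftOp k x))) =
    shiftOp (-k) (X (shiftOp k (shiftOp (-k) (Y (shiftOp k x)))))
  rw [shiftOp_shiftOp_neg]

theorem conjShift_star (k : ℤ) (X : L2Z →L[ℂ] L2Z) :
    conjShift k (star X) = star (conjShift k X) := by
  simp only [conjShift, star_mul, star_shiftOp, neg_neg, mul_assoc]

theorem conjShift_conjShift (k l : ℤ) (X : L2Z →L[ℂ] L2Z) :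
    conjShift k (conjShift l X) = conjShift (l + k) X := by
  ext1 x
  rw [conjShift_apply, conjShift_apply, conjShift_apply, shiftOp_shiftOp, shiftOp_shiftOp,
    neg_add_rev]

theorem norm_conjShift_le (k : ℤ) (X : L2Z →L[ℂ] L2Z) : ‖conjShift k X‖ ≤ ‖X‖ :=
  ContinuousLinearMap.opNorm_le_bound _ (norm_nonneg _) fun x => by
    rw [conjShift_apply, norm_shiftOp_apply]
    exact (X.le_opNorm _).trans_eq (by rw [norm_shiftOp_apply])

theorem norm_conjShift (k : ℤ) (X : L2Z →L[ℂ] L2Z) : ‖conjShift k X‖ = ‖X‖ := by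
  refine le_antisymm (norm_conjShift_le k X) ?_
  have h := norm_conjShift_le (-k) (conjShift k X)
  rwa [conjShift_conjShift, add_neg_cancel, conjShift_zero] at h

theorem dist_conjShift (X : L2Z →L[ℂ] L2Z) (k l m : ℤ) :
    dist (conjShift (k + m) X) (conjShift (l + m) X) = dist (conjShift k X) (conjShift l X) := by
  rw [← conjShift_conjShift, ← conjShift_conjShift, dist_eq_norm, dist_eq_norm, ← conjShift_sub,
    norm_conjShift]

/-- An operator on `ℓ²(ℤ)` is almost periodic if the set of its translates is relatively compact
in the operator norm. -/
def IsAlmostPeriodicOp (X : L2Z →L[ℂ] L2Z) : Prop :=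
  TotallyBounded (Set.range fun k : ℤ => conjShift k X)

theorem isAlmostPeriodicOp_of_conjShift_eq {X : L2Z →L[ℂ] L2Z} (h : ∀ k, conjShift k X = X) :
    IsAlmostPeriodicOp X := by
  refine (Set.Finite.totallyBounded (s := {X}) (Set.finite_singleton X)).subset ?_
  rintro _ ⟨k, rfl⟩
  exact h k

theorem IsAlmostPeriodicOp.add {X Y : L2Z →L[ℂ] L2Z} (hX : IsAlmostPeriodicOp X)
    (hY : IsAlmostPeriodicOp Y) : IsAlmostPeriodicOp (X + Y) := by
  have h := totallyBounded_range_map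
    (f := fun p : (L2Z →L[ℂ] L2Z) × (L2Z →L[ℂ] L2Z) => p.1 + p.2) (by fun_prop)
    (totallyBounded_range_prodMk hX hY)
  simpa only [IsAlmostPeriodicOp, conjShift_add] using h

theorem IsAlmostPeriodicOp.sub {X Y : L2Z →L[ℂ] L2Z} (hX : IsAlmostPeriodicOp X)
    (hY : IsAlmostPeriodicOp Y) : IsAlmostPeriodicOp (X - Y) := by
  have h := totallyBounded_range_map
    (f := fun p : (L2Z →L[ℂ] L2Z) × (L2Z →L[ℂ] L2Z) => p.1 - p.2) (by fun_prop)
    (totallyBounded_range_prodMk hX hY)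
  simpa only [IsAlmostPeriodicOp, conjShift_sub] using h

theorem IsAlmostPeriodicOp.mul {X Y : L2Z →L[ℂ] L2Z} (hX : IsAlmostPeriodicOp X)
    (hY : IsAlmostPeriodicOp Y) : IsAlmostPeriodicOp (X * Y) := by
  have h := totallyBounded_range_map
    (f := fun p : (L2Z →L[ℂ] L2Z) × (L2Z →L[ℂ] L2Z) => p.1 * p.2) (by fun_prop)
    (totallyBounded_range_prodMk hX hY)
  simpa only [IsAlmostPeriodicOp, conjShift_mul] using h

theorem IsAlmostPeriodicOp.star {X : L2Z →L[ℂ] L2Z} (hX : IsAlmostPeriodicOp X) :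
    IsAlmostPeriodicOp (star X) := by
  have h := totallyBounded_range_map (f := fun X : L2Z →L[ℂ] L2Z => Star.star X)
    continuous_star hX
  simpa only [IsAlmostPeriodicOp, conjShift_star] using h

theorem IsAlmostPeriodicOp.apply {X : L2Z →L[ℂ] L2Z} (hX : IsAlmostPeriodicOp X) (x : L2Z) :
    TotallyBounded (Set.range fun k : ℕ => conjShift k X x) := by
  refine (totallyBounded_range_map (f := fun X : L2Z →L[ℂ] L2Z => X x) (by fun_prop) hX).subset ?_
  rintro _ ⟨k, rfl⟩
  exact ⟨k, rfl⟩

theorem IsAlmostPeriodicOp.of_tendsto {X : ℕ → L2Z →L[ℂ] L2Z} {Y : L2Z →L[ℂ] L2Z}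
    (hX : ∀ n, IsAlmostPeriodicOp (X n)) (h : Tendsto X atTop (𝓝 Y)) : IsAlmostPeriodicOp Y := by
  refine Metric.totallyBounded_iff.2 fun ε hε => ?_
  obtain ⟨n, hn⟩ := ((Metric.tendsto_atTop.1 h) (ε / 2) (half_pos hε))
  obtain ⟨t, ht, hcov⟩ := Metric.totallyBounded_iff.1 (hX n) (ε / 2) (half_pos hε)
  refine ⟨t, ht, ?_⟩
  rintro _ ⟨k, rfl⟩
  obtain ⟨y, hy, hky⟩ := Set.mem_iUnion₂.1 (hcov ⟨k, rfl⟩)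
  refine Set.mem_iUnion₂.2 ⟨y, hy, ?_⟩
  rw [Metric.mem_ball] at hky ⊢
  have h1 : dist (conjShift k Y) (conjShift k (X n)) < ε / 2 := by
    rw [dist_eq_norm, ← conjShift_sub, norm_conjShift, ← dist_eq_norm, dist_comm]
    exact hn n le_rfl
  exact (dist_triangle _ _ _).trans_lt (by linarith)

/-- The main diagonal of an operator on `ℓ²(ℤ)`. -/
def diagZ (X : L2Z →L[ℂ] L2Z) : ℤ →ᵇ ℂ :=
  BoundedContinuousFunction.ofNormedAddCommGroupDiscrete (fun n => X (lp.single 2 n 1) n) ‖X‖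
    fun n => (lp.norm_apply_le_norm (by simp) _ n).trans ((X.le_opNorm _).trans_eq (by
      rw [lp.norm_single (by simp), norm_one, mul_one]))

theorem diagZ_apply (X : L2Z →L[ℂ] L2Z) (n : ℤ) : diagZ X n = X (lp.single 2 n 1) n := rfl

theorem norm_diagZ_le (X : L2Z →L[ℂ] L2Z) : ‖diagZ X‖ ≤ ‖X‖ :=
  (diagZ X).norm_le (norm_nonneg _) |>.2 fun n =>
    (lp.norm_apply_le_norm (by simp) _ n).trans ((X.le_opNorm _).trans_eq (by
      rw [lp.norm_single (by simp), norm_one, mul_one]))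

theorem diagZ_conjShift (k : ℤ) (X : L2Z →L[ℂ] L2Z) :
    diagZ (conjShift k X) = shiftFun k (diagZ X) := by
  ext n
  rw [diagZ_apply, conjShift_apply, shiftOp_apply, shiftOp_single, shiftFun_apply, diagZ_apply,
    sub_neg_eq_add]

theorem IsAlmostPeriodicOp.isAlmostPeriodic_diagZ {X : L2Z →L[ℂ] L2Z}
    (hX : IsAlmostPeriodicOp X) : IsAlmostPeriodic (diagZ X) := by
  rw [isAlmostPeriodic_iff]
  have hc : Continuous diagZ := by
    refine LipschitzWith.continuous (K := 1) (LipschitzWith.of_dist_le_mul fun X Y => ?_)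
    rw [dist_eq_norm, dist_eq_norm, NNReal.coe_one, one_mul]
    exact norm_diagZ_le (X - Y)
  simpa only [diagZ_conjShift] using totallyBounded_range_map hc hX

/-! ### Operators which are asymptotically almost periodic at `+∞` -/

/-- The embedding of `ℓ²(ℤ⁺)` into `ℓ²(ℤ)` as a bounded operator. -/
def inclOp : L2N →L[ℂ] L2Z := includeZ.toContinuousLinearMap

/-- The extension `J B J*` by zero of an operator on `ℓ²(ℤ⁺)` to `ℓ²(ℤ)`. -/
def extendZ (B : L2N →L[ℂ] L2N) : L2Z →L[ℂ] L2Z :=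
  inclOp ∘L B ∘L ContinuousLinearMap.adjoint inclOp

/-- The compression `J* X J` of an operator on `ℓ²(ℤ)` to `ℓ²(ℤ⁺)`. -/
def compressN (X : L2Z →L[ℂ] L2Z) : L2N →L[ℂ] L2N :=
  ContinuousLinearMap.adjoint inclOp ∘L X ∘L inclOp

theorem inclOp_apply (x : L2N) (k : ℤ) : inclOp x k = if 0 ≤ k then x k.toNat else 0 := rfl

theorem norm_inclOp_apply (x : L2N) : ‖inclOp x‖ = ‖x‖ := includeZ.norm_map x

theorem inclOp_single (n : ℕ) :
    inclOp (lp.single 2 n (1 : ℂ)) = lp.single 2 (n : ℤ) (1 : ℂ) := by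
  ext m
  rw [inclOp_apply, lp.coeFn_single, lp.coeFn_single, Pi.single_apply, Pi.single_apply]
  by_cases hm : 0 ≤ m
  · have : m.toNat = n ↔ m = (n : ℤ) := by omega
    simp [hm, this]
  · have : m ≠ (n : ℤ) := by omega
    simp [hm, this]

theorem adjoint_inclOp_apply (y : L2Z) (n : ℕ) :
    ContinuousLinearMap.adjoint inclOp y n = y n := by
  have h : inner ℂ (lp.single 2 n (1 : ℂ)) (ContinuousLinearMap.adjoint inclOp y) =
      inner ℂ (lp.single 2 (n : ℤ) (1 : ℂ)) y := by
    rw [ContinuousLinearMap.adjoint_inner_right, inclOp_single]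
  rw [lp.inner_single_left, lp.inner_single_left] at h
  simpa using h

theorem adjoint_inclOp_inclOp (x : L2N) : ContinuousLinearMap.adjoint inclOp (inclOp x) = x := by
  ext n
  rw [adjoint_inclOp_apply, inclOp_apply]
  simp

theorem norm_adjoint_inclOp_apply_le (y : L2Z) :
    ‖ContinuousLinearMap.adjoint inclOp y‖ ≤ ‖y‖ := by
  have h : ‖ContinuousLinearMap.adjoint inclOp‖ ≤ 1 := by
    rw [LinearIsometryEquiv.norm_map]
    exact includeZ.norm_toContinuousLinearMap_le
  simpa using (ContinuousLinearMap.adjoint inclOp).le_of_opNorm_le h y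

theorem extendZ_apply (B : L2N →L[ℂ] L2N) (x : L2Z) :
    extendZ B x = inclOp (B (ContinuousLinearMap.adjoint inclOp x)) := rfl

theorem norm_extendZ_apply_le (B : L2N →L[ℂ] L2N) (x : L2Z) : ‖extendZ B x‖ ≤ ‖B‖ * ‖x‖ := by
  rw [extendZ_apply, norm_inclOp_apply]
  exact (B.le_opNorm _).trans
    (mul_le_mul_of_nonneg_left (norm_adjoint_inclOp_apply_le x) (norm_nonneg _))

theorem extendZ_add (B C : L2N →L[ℂ] L2N) : extendZ (B + C) = extendZ B + extendZ C := by
  ext1 x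
  simp only [extendZ_apply, add_apply, map_add]

theorem extendZ_sub (B C : L2N →L[ℂ] L2N) : extendZ (B - C) = extendZ B - extendZ C := by
  ext1 x
  simp only [extendZ_apply, sub_apply, map_sub]

theorem extendZ_mul (B C : L2N →L[ℂ] L2N) : extendZ (B * C) = extendZ B * extendZ C := by
  ext1 x
  change inclOp (B (C _)) = inclOp (B (ContinuousLinearMap.adjoint inclOp (inclOp (C _))))
  rw [adjoint_inclOp_inclOp]

theorem compressN_star (X : L2Z →L[ℂ] L2Z) : star (compressN X) = compressN (star X) := by
  change ContinuousLinearMap.adjoint _ = _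
  rw [compressN, ContinuousLinearMap.adjoint_comp, ContinuousLinearMap.adjoint_comp,
    ContinuousLinearMap.adjoint_adjoint, ContinuousLinearMap.comp_assoc]
  rfl

/-- `B` on `ℓ²(ℤ⁺)` behaves at `+∞` like the operator `X` on `ℓ²(ℤ)`: the translates of
`J B J* - X` tend strongly to zero. -/
def IsAsymptotic (B : L2N →L[ℂ] L2N) (X : L2Z →L[ℂ] L2Z) : Prop :=
  ∀ x : L2Z, Tendsto (fun k : ℕ => (extendZ B - X) (shiftOp k x)) atTop (𝓝 0)

theorem IsAsymptotic.add {B C : L2N →L[ℂ] L2N} {X Y : L2Z →L[ℂ] L2Z} (hB : IsAsymptotic B X)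
    (hC : IsAsymptotic C Y) : IsAsymptotic (B + C) (X + Y) := fun x => by
  have h := (hB x).add (hC x)
  rw [add_zero] at h
  refine h.congr fun k => ?_
  rw [extendZ_add, add_sub_add_comm, add_apply]

theorem IsAsymptotic.sub {B C : L2N →L[ℂ] L2N} {X Y : L2Z →L[ℂ] L2Z} (hB : IsAsymptotic B X)
    (hC : IsAsymptotic C Y) : IsAsymptotic (B - C) (X - Y) := fun x => by
  have h := (hB x).sub (hC x)
  rw [sub_zero] at h
  refine h.congr fun k => ?_
  rw [extendZ_sub, sub_sub_sub_comm]
  exact (sub_apply _ _ _).symm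

theorem norm_mul_shiftOp_le (X : L2Z →L[ℂ] L2Z) (k : ℤ) : ‖X * shiftOp k‖ ≤ ‖X‖ :=
  ContinuousLinearMap.opNorm_le_bound _ (norm_nonneg _) fun x =>
    (X.le_opNorm (shiftOp k x)).trans_eq (congrArg (‖X‖ * ·) (norm_shiftOp_apply k x))

theorem tendsto_clm_apply_zero {E F : Type*} [NormedAddCommGroup E] [NormedSpace ℂ E]
    [NormedAddCommGroup F] [NormedSpace ℂ F] (L : E →L[ℂ] F) {u : ℕ → E}
    (hu : Tendsto u atTop (𝓝 0)) : Tendsto (fun k => L (u k)) atTop (𝓝 0) := by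
  have h := (L.continuous.tendsto 0).comp hu
  rwa [map_zero] at h

theorem IsAsymptotic.mul {B C : L2N →L[ℂ] L2N} {X Y : L2Z →L[ℂ] L2Z} (hB : IsAsymptotic B X)
    (hC : IsAsymptotic C Y) (hY : IsAlmostPeriodicOp Y) : IsAsymptotic (B * C) (X * Y) :=
  fun x => by
  have h1 := tendsto_clm_apply_zero (extendZ B) (hC x)
  have h2 : Tendsto (fun k : ℕ => ((extendZ B - X) * shiftOp k) (conjShift k Y x)) atTop (𝓝 0) :=
    tendsto_apply_of_totallyBounded_range (D := fun k : ℕ => (extendZ B - X) * shiftOp k)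
      (fun k => norm_mul_shiftOp_le _ k) hB (hY.apply x)
  have h := h1.add h2
  rw [add_zero] at h
  refine h.congr fun k => ?_
  have e : ((extendZ B - X) * shiftOp k) (conjShift k Y x) =
      (extendZ B - X) (shiftOp k (conjShift k Y x)) := rfl
  rw [e, shiftOp_conjShift_apply, extendZ_mul]
  change extendZ B (extendZ C _ - Y _) + (extendZ B (Y _) - X (Y _)) =
    extendZ B (extendZ C _) - X (Y _)
  rw [map_sub]
  abel

/-- The norm of the almost periodic operator `X` is determined by its behaviour at `+∞`, by
recurrence. -/
theorem IsAsymptotic.norm_le {B : L2N →L[ℂ] L2N} {X : L2Z →L[ℂ] L2Z} (h : IsAsymptotic B X)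
    (hX : IsAlmostPeriodicOp X) : ‖X‖ ≤ ‖B‖ := by
  refine ContinuousLinearMap.opNorm_le_bound _ (norm_nonneg _) fun x => ?_
  refine le_of_forall_pos_le_add fun ε hε => ?_
  obtain ⟨N, hN⟩ := Metric.tendsto_atTop.1 (h x) (ε / 2) (half_pos hε)
  obtain ⟨k, hk, hd⟩ := exists_dist_lt_of_totallyBounded_range hX (dist_conjShift X)
    (ε := ε / (2 * (‖x‖ + 1))) (by positivity) N
  have h1 := hN k hk
  rw [dist_zero_right, sub_apply] at h1
  rw [conjShift_zero, dist_eq_norm] at hd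
  have h2 : ‖conjShift k X x - X x‖ ≤ ε / 2 := by
    refine ((conjShift k X - X).le_of_opNorm_le hd.le x).trans ?_
    rw [show ε / (2 * (‖x‖ + 1)) = (ε / 2) / (‖x‖ + 1) by field_simp, div_mul_eq_mul_div,
      div_le_iff₀ (by positivity)]
    nlinarith [norm_nonneg x]
  have h3 : ‖conjShift k X x‖ = ‖X (shiftOp k x)‖ := by
    rw [conjShift_apply, norm_shiftOp_apply]
  have h4 := norm_extendZ_apply_le B (shiftOp k x)
  rw [norm_shiftOp_apply] at h4
  have h5 := norm_sub_norm_le (X (shiftOp k x)) (extendZ B (shiftOp k x))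
  rw [norm_sub_rev] at h5
  have h6 := norm_sub_norm_le (X x) (conjShift k X x)
  rw [norm_sub_rev] at h6
  linarith

/-- The vectors `S_k x` move into the range of `J` as `k → ∞`. -/
theorem tendsto_inclOp_adjoint_sub_shiftOp (x : L2Z) :
    Tendsto (fun k : ℕ => inclOp (ContinuousLinearMap.adjoint inclOp (shiftOp k x)) - shiftOp k x)
      atTop (𝓝 0) := by
  have hbound : ∀ (k : ℕ) (y : L2Z),
      ‖inclOp (ContinuousLinearMap.adjoint inclOp (shiftOp k y)) - shiftOp k y‖ ≤ 2 * ‖y‖ :=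
    fun k y => by
    refine (norm_sub_le _ _).trans ?_
    rw [norm_inclOp_apply, norm_shiftOp_apply]
    have := norm_adjoint_inclOp_apply_le (shiftOp k y)
    rw [norm_shiftOp_apply] at this
    linarith
  rw [Metric.tendsto_atTop]
  intro ε hε
  obtain ⟨s, hs⟩ := (Metric.tendsto_atTop.1 (lp.hasSum_single (p := 2) (by simp) x)) (ε / 2)
    (half_pos hε)
  specialize hs s le_rfl
  rw [dist_eq_norm, norm_sub_rev] at hs
  set y : L2Z := ∑ i ∈ s, lp.single 2 i (x i)
  obtain ⟨N, hN⟩ : ∃ N : ℕ, ∀ i ∈ s, -(N : ℤ) ≤ i := by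
    refine ⟨∑ i ∈ s, i.natAbs, fun i hi => ?_⟩
    have := Finset.single_le_sum (f := fun i : ℤ => i.natAbs) (fun _ _ => Nat.zero_le _) hi
    omega
  refine ⟨N, fun k hk => ?_⟩
  have hy : inclOp (ContinuousLinearMap.adjoint inclOp (shiftOp k y)) - shiftOp k y = 0 := by
    rw [sub_eq_zero]
    ext m
    rw [inclOp_apply]
    split_ifs with hm
    · rw [adjoint_inclOp_apply, Int.toNat_of_nonneg hm]
    · rw [shiftOp_apply, lp.coeFn_sum, Finset.sum_apply, Finset.sum_eq_zero]
      intro i hi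
      have := hN i hi
      rw [lp.coeFn_single, Pi.single_eq_of_ne]
      omega
  have h := hbound k (x - y)
  simp only [map_sub] at h
  rw [sub_sub_sub_comm, hy, sub_zero] at h
  rw [dist_zero_right]
  linarith

/-- The compression of an almost periodic operator behaves at `+∞` like the operator itself. -/
theorem isAsymptotic_compressN {X : L2Z →L[ℂ] L2Z} (hX : IsAlmostPeriodicOp X) :
    IsAsymptotic (compressN X) X := fun x => by
  let Q : L2Z →L[ℂ] L2Z := inclOp ∘L ContinuousLinearMap.adjoint inclOp - 1
  have hQ : ∀ x, Tendsto (fun k : ℕ => Q (shiftOp k x)) atTop (𝓝 0) :=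
    tendsto_inclOp_adjoint_sub_shiftOp
  have h1 := tendsto_clm_apply_zero (inclOp ∘L ContinuousLinearMap.adjoint inclOp ∘L X) (hQ x)
  have h2 : Tendsto (fun k : ℕ => (Q * shiftOp k) (conjShift k X x)) atTop (𝓝 0) :=
    tendsto_apply_of_totallyBounded_range (D := fun k : ℕ => Q * shiftOp k)
      (fun k => norm_mul_shiftOp_le _ k) hQ (hX.apply x)
  have h := h1.add h2
  rw [add_zero] at h
  refine h.congr fun k => ?_
  have e : (Q * shiftOp k) (conjShift k X x) = Q (shiftOp k (conjShift k X x)) := rfl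
  rw [e, shiftOp_conjShift_apply]
  set y := shiftOp k x
  change inclOp (ContinuousLinearMap.adjoint inclOp
      (X (inclOp (ContinuousLinearMap.adjoint inclOp y) - y))) +
    (inclOp (ContinuousLinearMap.adjoint inclOp (X y)) - X y) =
    inclOp (ContinuousLinearMap.adjoint inclOp
      (X (inclOp (ContinuousLinearMap.adjoint inclOp y)))) - X y
  simp only [map_sub]
  abel

theorem exists_isAsymptotic_compressN {X : L2Z →L[ℂ] L2Z} (hX : IsAlmostPeriodicOp X) :
    ∃ Y, IsAlmostPeriodicOp Y ∧ IsAsymptotic (compressN X) Y ∧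
      IsAsymptotic (star (compressN X)) (star Y) :=
  ⟨X, hX, isAsymptotic_compressN hX, by
    rw [compressN_star]; exact isAsymptotic_compressN hX.star⟩

theorem compressN_algebraMap (c : ℂ) :
    compressN (algebraMap ℂ (L2Z →L[ℂ] L2Z) c) = algebraMap ℂ (L2N →L[ℂ] L2N) c := by
  ext1 x
  change ContinuousLinearMap.adjoint inclOp (c • inclOp x) = c • x
  rw [map_smul, adjoint_inclOp_inclOp]

theorem isAlmostPeriodicOp_algebraMap (c : ℂ) :
    IsAlmostPeriodicOp (algebraMap ℂ (L2Z →L[ℂ] L2Z) c) := by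
  refine isAlmostPeriodicOp_of_conjShift_eq fun k => ?_
  ext1 x
  change shiftOp (-k) (c • shiftOp k x) = c • x
  rw [map_smul, shiftOp_neg_shiftOp]

/-- The algebra of all operators on `ℓ²(ℤ⁺)` which behave at `+∞`, together with their adjoints,
like an almost periodic operator on `ℓ²(ℤ)` and its adjoint. -/
def asymptoticAlgebra : StarSubalgebra ℂ (L2N →L[ℂ] L2N) where
  carrier := {B | ∃ X, IsAlmostPeriodicOp X ∧ IsAsymptotic B X ∧ IsAsymptotic (star B) (star X)}
  mul_mem' := by
    rintro B C ⟨X, hX, hB, hB'⟩ ⟨Y, hY, hC, hC'⟩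
    refine ⟨X * Y, hX.mul hY, hB.mul hC hY, ?_⟩
    rw [star_mul, star_mul]
    exact hC'.mul hB' hX.star
  add_mem' := by
    rintro B C ⟨X, hX, hB, hB'⟩ ⟨Y, hY, hC, hC'⟩
    refine ⟨X + Y, hX.add hY, hB.add hC, ?_⟩
    rw [star_add, star_add]
    exact hB'.add hC'
  algebraMap_mem' c := by
    rw [← compressN_algebraMap]
    exact exists_isAsymptotic_compressN (isAlmostPeriodicOp_algebraMap c)
  star_mem' := by
    rintro B ⟨X, hX, hB, hB'⟩
    exact ⟨star X, hX.star, hB', by rwa [star_star, star_star]⟩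

theorem compressN_mem_asymptoticAlgebra {X : L2Z →L[ℂ] L2Z} (hX : IsAlmostPeriodicOp X) :
    compressN X ∈ asymptoticAlgebra := exists_isAsymptotic_compressN hX

theorem IsAsymptotic.of_tendsto {B : ℕ → L2N →L[ℂ] L2N} {X : ℕ → L2Z →L[ℂ] L2Z}
    {B' : L2N →L[ℂ] L2N} {X' : L2Z →L[ℂ] L2Z} (h : ∀ n, IsAsymptotic (B n) (X n))
    (hB : Tendsto B atTop (𝓝 B')) (hX : Tendsto X atTop (𝓝 X')) : IsAsymptotic B' X' := by
  intro x
  rw [Metric.tendsto_atTop]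
  intro ε hε
  have hlim : Tendsto (fun n => (‖B' - B n‖ + ‖X' - X n‖) * ‖x‖) atTop (𝓝 0) := by
    have h1 := (tendsto_const_nhds (x := B')).sub hB
    have h2 := (tendsto_const_nhds (x := X')).sub hX
    have h3 := (h1.norm.add h2.norm).mul_const ‖x‖
    simpa only [sub_self, norm_zero, add_zero, zero_mul] using h3
  obtain ⟨n, hn⟩ := (hlim.eventually_lt_const (half_pos hε)).exists
  obtain ⟨N, hN⟩ := Metric.tendsto_atTop.1 (h n x) (ε / 2) (half_pos hε)
  refine ⟨N, fun k hk => ?_⟩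
  have h1 := hN k hk
  rw [dist_zero_right] at h1 ⊢
  have h2 := norm_extendZ_apply_le (B' - B n) (shiftOp k x)
  have h3 := (X' - X n).le_opNorm (shiftOp k x)
  rw [norm_shiftOp_apply] at h2 h3
  have h4 : (extendZ B' - X') (shiftOp k x) = (extendZ (B n) - X n) (shiftOp k x) +
      (extendZ (B' - B n) (shiftOp k x) - (X' - X n) (shiftOp k x)) := by
    rw [extendZ_sub]
    simp only [sub_apply]
    abel
  rw [h4]
  have h5 := norm_add_le ((extendZ (B n) - X n) (shiftOp k x))
    (extendZ (B' - B n) (shiftOp k x) - (X' - X n) (shiftOp k x))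
  have h6 := norm_sub_le (extendZ (B' - B n) (shiftOp k x)) ((X' - X n) (shiftOp k x))
  linarith

theorem isClosed_asymptoticAlgebra :
    IsClosed (asymptoticAlgebra : Set (L2N →L[ℂ] L2N)) := by
  refine isClosed_of_closure_subset fun B hB => ?_
  obtain ⟨b, hb, hlim⟩ := mem_closure_iff_seq_limit.1 hB
  choose X hX hbX hbX' using hb
  have hcauchy : CauchySeq X := by
    refine Metric.cauchySeq_iff.2 fun ε hε => ?_
    obtain ⟨N, hN⟩ := Metric.cauchySeq_iff.1 hlim.cauchySeq ε hε
    refine ⟨N, fun m hm n hn => lt_of_le_of_lt ?_ (hN m hm n hn)⟩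
    rw [dist_eq_norm, dist_eq_norm]
    exact ((hbX m).sub (hbX n)).norm_le ((hX m).sub (hX n))
  obtain ⟨Y, hY⟩ := cauchySeq_tendsto_of_complete hcauchy
  exact ⟨Y, IsAlmostPeriodicOp.of_tendsto hX hY, IsAsymptotic.of_tendsto hbX hlim hY,
    IsAsymptotic.of_tendsto hbX' ((continuous_star.tendsto B).comp hlim)
      ((continuous_star.tendsto Y).comp hY)⟩

/-- The operator of multiplication by a bounded function on `ℓ²(ℤ)`. -/
def mulOpZ (b : ℤ →ᵇ ℂ) : L2Z →L[ℂ] L2Z :=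
  LinearMap.mkContinuous
    { toFun := fun x => ⟨fun k => b k * x k,
        ((lp.memℓp x).const_mul (‖b‖ : ℂ)).mono' fun k => by
          simpa using mul_le_mul_of_nonneg_right (b.norm_coe_le_norm k) (norm_nonneg (x k))⟩
      map_add' := fun x y => by ext k; exact mul_add _ _ _
      map_smul' := fun c x => by ext k; exact mul_left_comm _ _ _ } ‖b‖ fun x => by
    have h : ‖(‖b‖ : ℂ) • x‖ = ‖b‖ * ‖x‖ := by rw [norm_smul]; simp
    rw [← h]
    refine lp.norm_mono (by simp) fun k => ?_
    have h2 : ‖((‖b‖ : ℂ) • x) k‖ = ‖b‖ * ‖x k‖ := by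
      rw [lp.coeFn_smul, Pi.smul_apply, norm_smul]; simp
    rw [h2]
    change ‖b k * x k‖ ≤ _
    rw [norm_mul]
    exact mul_le_mul_of_nonneg_right (b.norm_coe_le_norm k) (norm_nonneg (x k))

theorem mulOpZ_apply (b : ℤ →ᵇ ℂ) (x : L2Z) (k : ℤ) : mulOpZ b x k = b k * x k := rfl

theorem mulOp_apply (b : ℤ →ᵇ ℂ) (x : L2N) (k : ℕ) : mulOp b x k = b k * x k := rfl

theorem norm_mulOpZ_le (b : ℤ →ᵇ ℂ) : ‖mulOpZ b‖ ≤ ‖b‖ :=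
  LinearMap.mkContinuous_norm_le _ (norm_nonneg _) _

theorem isAlmostPeriodicOp_mulOpZ {b : ℤ →ᵇ ℂ} (hb : IsAlmostPeriodic b) :
    IsAlmostPeriodicOp (mulOpZ b) := by
  have hc : Continuous mulOpZ := by
    refine LipschitzWith.continuous (K := 1) (LipschitzWith.of_dist_le_mul fun b c => ?_)
    have e : mulOpZ b - mulOpZ c = mulOpZ (b - c) := by
      ext x k
      exact (sub_mul _ _ _).symm
    rw [dist_eq_norm, dist_eq_norm, NNReal.coe_one, one_mul, e]
    exact norm_mulOpZ_le _
  have hs : ∀ k, conjShift k (mulOpZ b) = mulOpZ (shiftFun k b) := fun k => by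
    ext x n
    rw [conjShift_apply, shiftOp_apply, mulOpZ_apply, shiftOp_apply, mulOpZ_apply, shiftFun_apply,
      sub_neg_eq_add, add_sub_cancel_right]
  simpa only [IsAlmostPeriodicOp, hs] using
    totallyBounded_range_map hc ((isAlmostPeriodic_iff b).1 hb)

theorem mulOp_eq_compressN (b : ℤ →ᵇ ℂ) : mulOp b = compressN (mulOpZ b) := by
  ext x n
  change _ = ContinuousLinearMap.adjoint inclOp (mulOpZ b (inclOp x)) n
  rw [adjoint_inclOp_apply, mulOpZ_apply, inclOp_apply, mulOp_apply]
  simp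

theorem ext_single {ι : Type*} [DecidableEq ι] {E : Type*} [NormedAddCommGroup E]
    [NormedSpace ℂ E] {X Y : lp (fun _ : ι => ℂ) 2 →L[ℂ] E}
    (h : ∀ j, X (lp.single 2 j 1) = Y (lp.single 2 j 1)) : X = Y := by
  refine lp.ext_continuousLinearMap (by simp) fun j => ?_
  ext
  exact h j

theorem conjShift_laurent (a : LinftyT) (k : ℤ) : conjShift k (laurent a) = laurent a := by
  refine ext_single fun j => ?_
  ext n
  rw [conjShift_apply, shiftOp_apply, shiftOp_single, laurent_matrix, laurent_matrix]
  congr 1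
  ring

theorem opAlgebra_le_asymptoticAlgebra : opAlgebra ≤ asymptoticAlgebra := by
  refine StarSubalgebra.topologicalClosure_minimal (StarAlgebra.adjoin_le ?_)
    isClosed_asymptoticAlgebra
  rintro _ (⟨a, rfl⟩ | ⟨b, hb, rfl⟩)
  · exact compressN_mem_asymptoticAlgebra
      (isAlmostPeriodicOp_of_conjShift_eq (conjShift_laurent a))
  · rw [mulOp_eq_compressN]
    exact compressN_mem_asymptoticAlgebra (isAlmostPeriodicOp_mulOpZ hb)

/-- The main diagonal of an operator in `opAlgebra` has an almost periodic part: the diagonal of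
the almost periodic operator on `ℓ²(ℤ)` to which it is asymptotic. -/
theorem exists_isAPPartOfDiagonal {B : L2N →L[ℂ] L2N} (hB : B ∈ opAlgebra) :
    ∃ f, IsAPPartOfDiagonal B f := by
  obtain ⟨X, hX, hBX, -⟩ := opAlgebra_le_asymptoticAlgebra hB
  refine ⟨diagZ X, hX.isAlmostPeriodic_diagZ, ?_⟩
  refine squeeze_zero_norm (fun n => ?_) (by simpa using (hBX (lp.single 2 0 1)).norm)
  have h := lp.norm_apply_le_norm (p := 2) (by simp)
    ((extendZ B - X) (shiftOp n (lp.single 2 0 1))) (n : ℤ)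
  refine le_trans (le_of_eq ?_) h
  rw [shiftOp_single, zero_add]
  congr 1
  change _ = extendZ B (lp.single 2 (n : ℤ) 1) n - X (lp.single 2 (n : ℤ) 1) n
  rw [extendZ_apply, ← inclOp_single, adjoint_inclOp_inclOp, inclOp_apply, inclOp_single,
    diagZ_apply]
  simp

/-! ### Sequences that are negligible in the normalized Hilbert–Schmidt norm -/

/-- The `j`-th standard basis vector of the range of `P_{n+1}`. -/
abbrev secBasis (n : ℕ) (j : Fin (n + 1)) : Sec n := EuclideanSpace.single j (1 : ℂ)

theorem norm_secBasis (n : ℕ) (j : Fin (n + 1)) : ‖secBasis n j‖ = 1 := by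
  simp [secBasis]

theorem embed_secBasis (n : ℕ) (j : Fin (n + 1)) :
    embed n (secBasis n j) = lp.single 2 (j : ℕ) (1 : ℂ) := by
  simp [embed, secBasis]

/-- The square of the Hilbert–Schmidt norm. -/
def hsSq {n : ℕ} (X : Sec n →L[ℂ] L2N) : ℝ := ∑ j, ‖X (secBasis n j)‖ ^ 2

theorem hsSq_nonneg {n : ℕ} (X : Sec n →L[ℂ] L2N) : 0 ≤ hsSq X :=
  Finset.sum_nonneg fun _ _ => sq_nonneg _

theorem hsSq_neg {n : ℕ} (X : Sec n →L[ℂ] L2N) : hsSq (-X) = hsSq X := by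
  simp [hsSq]

theorem hsSq_add_le {n : ℕ} (X Y : Sec n →L[ℂ] L2N) : hsSq (X + Y) ≤ 2 * hsSq X + 2 * hsSq Y := by
  simp only [hsSq, Finset.mul_sum, ← Finset.sum_add_distrib]
  refine Finset.sum_le_sum fun j _ => ?_
  have h1 := norm_add_le (X (secBasis n j)) (Y (secBasis n j))
  have h2 := pow_le_pow_left₀ (norm_nonneg _) h1 2
  rw [add_apply]
  nlinarith [sq_nonneg (‖X (secBasis n j)‖ - ‖Y (secBasis n j)‖)]

theorem hsSq_le {n : ℕ} (X : Sec n →L[ℂ] L2N) {c : ℝ} (hc : ‖X‖ ≤ c) :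
    hsSq X ≤ (n + 1) * c ^ 2 := by
  refine (Finset.sum_le_sum (g := fun _ => c ^ 2) fun j _ => ?_).trans (by simp)
  refine pow_le_pow_left₀ (norm_nonneg _) ?_ 2
  have := X.le_of_opNorm_le hc (secBasis n j)
  rwa [norm_secBasis, mul_one] at this

theorem hsSq_comp_left_le {n : ℕ} (T : L2N →L[ℂ] L2N) (X : Sec n →L[ℂ] L2N) :
    hsSq (T ∘L X) ≤ ‖T‖ ^ 2 * hsSq X := by
  simp only [hsSq, Finset.mul_sum]
  refine Finset.sum_le_sum fun j _ => ?_
  rw [← mul_pow]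
  exact pow_le_pow_left₀ (norm_nonneg _) (T.le_opNorm _) 2

/-- The sum `∑ |φ(e_j)|²` is the square of the norm of the vector that represents `φ`; passing from
`φ` to `φ ∘ Y` applies the adjoint of `Y` to this vector. -/
theorem sum_norm_functional_comp_le {n : ℕ} (φ : Sec n →L[ℂ] ℂ) (Y : Sec n →L[ℂ] Sec n) :
    ∑ j, ‖φ (Y (secBasis n j))‖ ^ 2 ≤ ‖Y‖ ^ 2 * ∑ j, ‖φ (secBasis n j)‖ ^ 2 := by
  set v := (InnerProductSpace.toDual ℂ (Sec n)).symm φ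
  have hv : ∀ u, φ u = inner ℂ v u := fun u =>
    (InnerProductSpace.toDual_symm_apply (𝕜 := ℂ)).symm
  have key : ∀ w : Sec n, ∑ j, ‖(inner ℂ w (secBasis n j) : ℂ)‖ ^ 2 = ‖w‖ ^ 2 := fun w => by
    rw [EuclideanSpace.norm_sq_eq]
    refine Finset.sum_congr rfl fun j _ => ?_
    rw [EuclideanSpace.inner_single_right]
    simp
  simp only [hv]
  simp only [← ContinuousLinearMap.adjoint_inner_left]
  rw [key, key, ← mul_pow]
  refine pow_le_pow_left₀ (norm_nonneg _)
    (((ContinuousLinearMap.adjoint Y).le_opNorm v).trans_eq ?_) 2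
  rw [LinearIsometryEquiv.norm_map]

theorem hasSum_norm_sq (x : L2N) : HasSum (fun i => ‖x i‖ ^ 2) (‖x‖ ^ 2) := by
  simpa using lp.hasSum_norm (p := 2) (by simp) x

/-- The Hilbert–Schmidt norm is estimated row by row. -/
theorem hsSq_comp_right_le {n : ℕ} (X : Sec n →L[ℂ] L2N) (Y : Sec n →L[ℂ] Sec n) :
    hsSq (X ∘L Y) ≤ ‖Y‖ ^ 2 * hsSq X := by
  have h : ∀ Z : Sec n →L[ℂ] L2N, HasSum (fun i => ∑ j, ‖Z (secBasis n j) i‖ ^ 2) (hsSq Z) :=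
    fun Z => hasSum_sum fun j _ => hasSum_norm_sq (Z (secBasis n j))
  refine hasSum_le (fun i => ?_) (h (X ∘L Y)) ((h X).mul_left _)
  exact sum_norm_functional_comp_le ((lp.evalCLM ℂ (fun _ : ℕ => ℂ) 2 i) ∘L X) Y

/-- A sequence of operators on the ranges of the `P_{n+1}` is negligible if its normalized
Hilbert–Schmidt norms tend to zero. -/
def IsNegligible (X : ∀ n, Sec n →L[ℂ] L2N) : Prop :=
  Tendsto (fun n => hsSq (X n) / (n + 1)) atTop (𝓝 0)

namespace IsNegligible

theorem of_le {X : ∀ n, Sec n →L[ℂ] L2N} {u : ℕ → ℝ} (hu : Tendsto u atTop (𝓝 0))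
    (h : ∀ᶠ n in atTop, hsSq (X n) / (n + 1) ≤ u n) : IsNegligible X :=
  squeeze_zero' (Eventually.of_forall fun n => div_nonneg (hsSq_nonneg _) (by positivity)) h hu

theorem congr' {X Y : ∀ n, Sec n →L[ℂ] L2N} (hX : IsNegligible X)
    (h : ∀ᶠ n in atTop, X n = Y n) : IsNegligible Y :=
  Tendsto.congr' (h.mono fun n hn => by rw [hn]) hX

theorem add {X Y : ∀ n, Sec n →L[ℂ] L2N} (hX : IsNegligible X) (hY : IsNegligible Y) :
    IsNegligible fun n => X n + Y n := by
  have h := (Tendsto.const_mul 2 hX).add (Tendsto.const_mul 2 hY)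
  rw [mul_zero, add_zero] at h
  refine of_le h (Eventually.of_forall fun n => ?_)
  rw [mul_div_assoc', mul_div_assoc', ← add_div]
  exact div_le_div_of_nonneg_right (hsSq_add_le _ _) (by positivity)

theorem neg {X : ∀ n, Sec n →L[ℂ] L2N} (hX : IsNegligible X) : IsNegligible fun n => -X n := by
  simpa only [IsNegligible, hsSq_neg] using hX

theorem comp_left {X : ∀ n, Sec n →L[ℂ] L2N} (hX : IsNegligible X) (T : ℕ → L2N →L[ℂ] L2N)
    {c : ℝ} (hT : ∀ᶠ n in atTop, ‖T n‖ ≤ c) : IsNegligible fun n => T n ∘L X n := by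
  have h := Tendsto.const_mul (c ^ 2) hX
  rw [mul_zero] at h
  refine of_le h (hT.mono fun n hn => ?_)
  rw [mul_div_assoc']
  refine div_le_div_of_nonneg_right ((hsSq_comp_left_le _ _).trans ?_) (by positivity)
  exact mul_le_mul_of_nonneg_right (pow_le_pow_left₀ (norm_nonneg _) hn 2) (hsSq_nonneg _)

theorem comp_right {X : ∀ n, Sec n →L[ℂ] L2N} (hX : IsNegligible X)
    (Y : ∀ n, Sec n →L[ℂ] Sec n) {c : ℝ} (hY : ∀ᶠ n in atTop, ‖Y n‖ ≤ c) :
    IsNegligible fun n => X n ∘L Y n := by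
  have h := Tendsto.const_mul (c ^ 2) hX
  rw [mul_zero] at h
  refine of_le h (hY.mono fun n hn => ?_)
  rw [mul_div_assoc']
  refine div_le_div_of_nonneg_right ((hsSq_comp_right_le _ _).trans ?_) (by positivity)
  exact mul_le_mul_of_nonneg_right (pow_le_pow_left₀ (norm_nonneg _) hn 2) (hsSq_nonneg _)

/-- Negligible sequences are closed under uniform limits. -/
theorem of_approx {X : ∀ n, Sec n →L[ℂ] L2N} {Y : ℕ → ∀ n, Sec n →L[ℂ] L2N} {u : ℕ → ℝ}
    (hu : Tendsto u atTop (𝓝 0)) (hY : ∀ k, IsNegligible (Y k))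
    (h : ∀ k n, ‖X n - Y k n‖ ≤ u k) : IsNegligible X := by
  rw [IsNegligible, Metric.tendsto_atTop]
  intro ε hε
  have hu2 : Tendsto (fun k => 2 * u k ^ 2) atTop (𝓝 0) := by
    simpa using (hu.pow 2).const_mul 2
  obtain ⟨k, hk⟩ := (hu2.eventually_lt_const (half_pos hε)).exists
  have h1 := Tendsto.const_mul 2 (hY k)
  rw [mul_zero] at h1
  obtain ⟨N, hN⟩ := eventually_atTop.1 (h1.eventually_lt_const (half_pos hε))
  refine ⟨N, fun n hn => ?_⟩
  have hn0 : (0 : ℝ) < n + 1 := by positivity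
  have h2 := hsSq_add_le (X n - Y k n) (Y k n)
  rw [sub_add_cancel] at h2
  have h3 := hsSq_le _ (h k n)
  have h4 := hN n hn
  rw [dist_zero_right, Real.norm_of_nonneg (div_nonneg (hsSq_nonneg _) hn0.le), div_lt_iff₀ hn0]
  rw [mul_div_assoc', div_lt_iff₀ hn0] at h4
  nlinarith

/-- The normalized traces of a negligible sequence tend to zero. -/
theorem tendsto_trace {X : ∀ n, Sec n →L[ℂ] Sec n} (hX : IsNegligible fun n => embed n ∘L X n) :
    Tendsto (fun n => (∑ j, X n (secBasis n j) j) / ((n : ℂ) + 1)) atTop (𝓝 0) := by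
  have h1 : Tendsto (fun n : ℕ => √(hsSq (embed n ∘L X n) / (n + 1))) atTop (𝓝 0) := by
    simpa using hX.sqrt
  refine squeeze_zero_norm (fun n => Real.le_sqrt_of_sq_le ?_) h1
  have hn0 : (0 : ℝ) < n + 1 := by positivity
  have h2 : ‖∑ j, X n (secBasis n j) j‖ ≤ ∑ j, ‖X n (secBasis n j)‖ :=
    norm_sum_le_of_le _ fun j _ => PiLp.norm_apply_le _ _
  have h3 : (∑ j, ‖X n (secBasis n j)‖) ^ 2 ≤ (n + 1) * hsSq (embed n ∘L X n) := by
    refine (sq_sum_le_card_mul_sum_sq (s := Finset.univ)).trans_eq ?_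
    simp [hsSq, norm_embed]
  have h4 : ‖(n : ℂ) + 1‖ = n + 1 := by
    rw [← Nat.cast_add_one, Complex.norm_natCast, Nat.cast_add_one]
  rw [norm_div, h4, div_pow, div_le_div_iff₀ (by positivity) hn0]
  have h5 := (pow_le_pow_left₀ (norm_nonneg _) h2 2).trans h3
  nlinarith

end IsNegligible

/-! ### Operators whose sections are asymptotically multiplicative -/

/-- The part `(1 - P_{n+1}) C P_{n+1}` of the operator `C`. -/
def offSection (n : ℕ) (C : L2N →L[ℂ] L2N) : Sec n →L[ℂ] L2N :=
  C ∘L embed n - embed n ∘L compress n C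

theorem offSection_apply (n : ℕ) (C : L2N →L[ℂ] L2N) (x : Sec n) :
    offSection n C x = C (embed n x) - embed n (restrict n (C (embed n x))) := rfl

theorem norm_embed_restrict_le (n : ℕ) (x : L2N) : ‖embed n (restrict n x)‖ ≤ ‖x‖ := by
  rw [norm_embed]; exact norm_restrict_le n x

theorem norm_offSection_le (n : ℕ) (C : L2N →L[ℂ] L2N) : ‖offSection n C‖ ≤ 2 * ‖C‖ :=
  ContinuousLinearMap.opNorm_le_bound _ (by positivity) fun x => by
    have h1 := norm_sub_le (C (embed n x)) (embed n (restrict n (C (embed n x))))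
    have h2 := norm_embed_restrict_le n (C (embed n x))
    have h3 := C.le_opNorm (embed n x)
    rw [norm_embed] at h3
    rw [offSection_apply]
    linarith

theorem offSection_add (n : ℕ) (C D : L2N →L[ℂ] L2N) :
    offSection n (C + D) = offSection n C + offSection n D := by
  ext1 x
  rw [add_apply]
  simp only [offSection_apply, add_apply, map_add]
  abel

theorem offSection_sub (n : ℕ) (C D : L2N →L[ℂ] L2N) :
    offSection n (C - D) = offSection n C - offSection n D := by
  ext1 x
  rw [sub_apply]
  simp only [offSection_apply, sub_apply, map_sub]
  abel

theorem norm_one_sub_embed_restrict_le (n : ℕ) :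
    ‖(1 : L2N →L[ℂ] L2N) - embed n ∘L restrict n‖ ≤ 2 :=
  ContinuousLinearMap.opNorm_le_bound _ zero_le_two fun x => by
    have h1 := norm_sub_le x (embed n (restrict n x))
    have h2 := norm_embed_restrict_le n x
    change ‖x - embed n (restrict n x)‖ ≤ _
    linarith

theorem offSection_mul (n : ℕ) (C D : L2N →L[ℂ] L2N) :
    offSection n (C * D) = offSection n C ∘L compress n D +
      ((1 - embed n ∘L restrict n) * C) ∘L offSection n D := by
  ext1 x
  change C (D (embed n x)) - embed n (restrict n (C (D (embed n x)))) =
    (C (embed n (restrict n (D (embed n x)))) -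
      embed n (restrict n (C (embed n (restrict n (D (embed n x))))))) +
    (C (D (embed n x) - embed n (restrict n (D (embed n x)))) -
      embed n (restrict n (C (D (embed n x) - embed n (restrict n (D (embed n x)))))))
  simp only [map_sub]
  abel

theorem IsNegligible.offSection_mul {C D : L2N →L[ℂ] L2N}
    (hC : IsNegligible fun n => offSection n C) (hD : IsNegligible fun n => offSection n D) :
    IsNegligible fun n => offSection n (C * D) := by
  simp only [SzegoAP.offSection_mul]
  refine (hC.comp_right _ (Eventually.of_forall fun n => norm_compress_le n D)).add
    (hD.comp_left (fun n => (1 - embed n ∘L restrict n) * C) (c := 2 * ‖C‖)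
      (Eventually.of_forall fun n => ?_))
  exact (norm_mul_le _ _).trans
    (mul_le_mul_of_nonneg_right (norm_one_sub_embed_restrict_le n) (norm_nonneg _))

/-- The columns of a Toeplitz operator are translates of one vector in `ℓ²`. Hence the squared
Hilbert–Schmidt norm of `(1 - P_n) T P_n` is a sum of `n` consecutive tails of this vector, and
its average tends to zero. -/
theorem isNegligible_offSection_compressN {X : L2Z →L[ℂ] L2Z} (hX : ∀ k, conjShift k X = X) :
    IsNegligible fun n => offSection n (compressN X) := by
  set y := ContinuousLinearMap.adjoint inclOp (X (lp.single 2 0 1))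
  set tail : ℕ → ℝ := fun p => ‖y - embed p (restrict p y)‖ ^ 2
  have htail : Tendsto tail atTop (𝓝 0) := by
    have h := (tendsto_const_nhds (x := y)).sub (tendsto_embed_restrict y)
    simpa using h.norm.pow 2
  have hcol : ∀ (n : ℕ) (j : Fin (n + 1)),
      ‖offSection n (compressN X) (secBasis n j)‖ ^ 2 = tail (n - j) := by
    -- Both sides are the norm of the part of the column beyond the index `n`.
    intro n j
    have hj : (j : ℕ) ≤ n := Nat.lt_succ_iff.1 j.2
    simp only [tail]
    rw [← norm_inclOp_apply (y - _), ← norm_shiftOp_apply j, ← norm_inclOp_apply (offSection _ _ _)]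
    congr 2
    rw [offSection_apply, embed_secBasis]
    have hx : ∀ m : ℤ, X (lp.single 2 (j : ℤ) 1) m = X (lp.single 2 0 1) (m - j) := fun m => by
      have h1 : X (shiftOp j (lp.single 2 0 1)) = shiftOp j (X (lp.single 2 0 1)) := by
        rw [← shiftOp_conjShift_apply, hX]
      rw [shiftOp_single, zero_add] at h1
      rw [h1, shiftOp_apply]
    have hc : ∀ m : ℕ, compressN X (lp.single 2 (j : ℕ) 1) m =
        X (lp.single 2 0 1) ((m : ℤ) - j) := fun m => by
      change ContinuousLinearMap.adjoint inclOp (X (inclOp _)) m = _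
      rw [adjoint_inclOp_apply, inclOp_single, hx]
    ext m
    rw [inclOp_apply, shiftOp_apply, inclOp_apply]
    simp only [lp.coeFn_sub, Pi.sub_apply, embed_apply, restrict_apply]
    by_cases hm : (n : ℤ) < m
    · rw [if_pos (by omega), if_pos (by omega), dif_neg (by omega), dif_neg (by omega), hc,
        adjoint_inclOp_apply, Int.toNat_of_nonneg (by omega), Int.toNat_of_nonneg (by omega)]
    · have e1 : (if 0 ≤ m then compressN X (lp.single 2 (j : ℕ) 1) m.toNat -
          (if h : m.toNat < n + 1 then compressN X (lp.single 2 (j : ℕ) 1) m.toNat else 0)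
          else 0) = 0 := by
        split_ifs
        · exact sub_self _
        · omega
        · rfl
      have e2 : (if 0 ≤ m - j then y (m - j).toNat -
          (if h : (m - j).toNat < n - j + 1 then y (m - j).toNat else 0) else 0) = 0 := by
        split_ifs
        · exact sub_self _
        · omega
        · rfl
      exact e1.trans e2.symm
  have hsum : ∀ n : ℕ, hsSq (offSection n (compressN X)) / (n + 1) =
      ((n + 1 : ℕ) : ℝ)⁻¹ * ∑ p ∈ Finset.range (n + 1), tail p := by
    intro n
    rw [← Finset.sum_range_reflect, Finset.sum_range, div_eq_inv_mul, hsSq]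
    push_cast
    congr 1
    refine Finset.sum_congr rfl fun j _ => ?_
    rw [hcol]
  simp only [IsNegligible, hsum]
  exact htail.cesaro.comp (tendsto_add_atTop_nat 1)

theorem isNegligible_offSection_mulOp (b : ℤ →ᵇ ℂ) :
    IsNegligible fun n => offSection n (mulOp b) := by
  have h : ∀ n, offSection n (mulOp b) = 0 := fun n => by
    ext x m
    rw [offSection_apply]
    change mulOp b (embed n x) m - embed n (restrict n (mulOp b (embed n x))) m = 0
    rw [embed_apply]
    split_ifs with hm
    · rw [restrict_apply, sub_self]
    · rw [mulOp_apply, embed_apply, dif_neg hm, mul_zero, sub_zero]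
  simp [IsNegligible, h, hsSq]

theorem star_mulOp (b : ℤ →ᵇ ℂ) : star (mulOp b) = mulOp (star b) := by
  refine ((ContinuousLinearMap.eq_adjoint_iff _ _).2 fun x y => ?_).symm
  rw [lp.inner_eq_tsum, lp.inner_eq_tsum]
  refine tsum_congr fun k => ?_
  rw [mulOp_apply, mulOp_apply]
  simp
  ring

theorem offSection_algebraMap (n : ℕ) (c : ℂ) :
    offSection n (algebraMap ℂ (L2N →L[ℂ] L2N) c) = 0 := by
  ext1 x
  change c • embed n x - embed n (restrict n (c • embed n x)) = 0
  rw [map_smul, restrict_embed, map_smul, sub_self]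

/-- The algebra of all operators `C` for which `(1 - P_n) C P_n` and `(1 - P_n) C* P_n` are
negligible. -/
def quasitriangularAlgebra : StarSubalgebra ℂ (L2N →L[ℂ] L2N) where
  carrier := {C | (IsNegligible fun n => offSection n C) ∧
    IsNegligible fun n => offSection n (star C)}
  mul_mem' := by
    rintro C D ⟨hC, hC'⟩ ⟨hD, hD'⟩
    refine ⟨hC.offSection_mul hD, ?_⟩
    rw [star_mul]
    exact hD'.offSection_mul hC'
  add_mem' := by
    rintro C D ⟨hC, hC'⟩ ⟨hD, hD'⟩
    constructor
    · simpa only [offSection_add] using hC.add hD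
    · simpa only [star_add, offSection_add] using hC'.add hD'
  algebraMap_mem' c := by
    constructor
    · simp [IsNegligible, offSection_algebraMap, hsSq]
    · simp only [← algebraMap_star_comm]
      simp [IsNegligible, offSection_algebraMap, hsSq]
  star_mem' := by
    rintro C ⟨hC, hC'⟩
    exact ⟨hC', by rwa [star_star]⟩

theorem isClosed_quasitriangularAlgebra :
    IsClosed (quasitriangularAlgebra : Set (L2N →L[ℂ] L2N)) := by
  refine isClosed_of_closure_subset fun C hC => ?_
  obtain ⟨c, hc, hlim⟩ := mem_closure_iff_seq_limit.1 hC
  have key : ∀ (d : ℕ → L2N →L[ℂ] L2N) (D : L2N →L[ℂ] L2N),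
      (∀ k, IsNegligible fun n => offSection n (d k)) → Tendsto d atTop (𝓝 D) →
      IsNegligible fun n => offSection n D := by
    intro d D hd hlim
    have hu : Tendsto (fun k => 2 * ‖D - d k‖) atTop (𝓝 0) := by
      simpa using (((tendsto_const_nhds (x := D)).sub hlim).norm).const_mul 2
    refine IsNegligible.of_approx hu hd fun k n => ?_
    rw [← offSection_sub]
    exact norm_offSection_le n _
  exact ⟨key c C (fun k => (hc k).1) hlim,
    key _ _ (fun k => (hc k).2) ((continuous_star.tendsto C).comp hlim)⟩

theorem opAlgebra_le_quasitriangularAlgebra : opAlgebra ≤ quasitriangularAlgebra := by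
  refine StarSubalgebra.topologicalClosure_minimal (StarAlgebra.adjoin_le ?_)
    isClosed_quasitriangularAlgebra
  rintro _ (⟨a, rfl⟩ | ⟨b, -, rfl⟩)
  · refine ⟨isNegligible_offSection_compressN (conjShift_laurent a), ?_⟩
    change IsNegligible fun n => offSection n (star (compressN (laurent a)))
    rw [compressN_star]
    exact isNegligible_offSection_compressN fun k => by rw [conjShift_star, conjShift_laurent]
  · refine ⟨isNegligible_offSection_mulOp b, ?_⟩
    rw [star_mulOp]
    exact isNegligible_offSection_mulOp _

/-! ### Sequences in the algebra of the finite sections method -/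

theorem W_eq_of_isStrongLimit {A : FP} {V : L2N →L[ℂ] L2N} (h : IsStrongLimit (A : SeqAlg) V) :
    W A = V :=
  (W_spec A).unique h

theorem W_add (A B : FP) : W (A + B) = W A + W B :=
  W_eq_of_isStrongLimit ((W_spec A).add (W_spec B))

theorem W_mul (A B : FP) : W (A * B) = W A * W B :=
  W_eq_of_isStrongLimit ((W_spec A).mul (W_spec B))

theorem W_algebraMap (c : ℂ) : W (algebraMap ℂ FP c) = algebraMap ℂ (L2N →L[ℂ] L2N) c :=
  W_eq_of_isStrongLimit (isStrongLimit_algebraMap c)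

theorem W_one : W 1 = 1 := by
  simpa using W_algebraMap 1

theorem W_finiteSections (T : L2N →L[ℂ] L2N) : W (finiteSections T) = T :=
  W_eq_of_isStrongLimit (isStrongLimit_sectionsSeq T)

theorem W_sub (A B : FP) : W (A - B) = W A - W B := by
  rw [eq_sub_iff_add_eq, ← W_add, sub_add_cancel]

theorem inner_extendSec_adjoint {n : ℕ} (X : Sec n →L[ℂ] Sec n) (x y : L2N) :
    inner ℂ (extendSec (ContinuousLinearMap.adjoint X) x) y = inner ℂ x (extendSec X y) := by
  simp only [extendSec, ContinuousLinearMap.comp_apply]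
  rw [← ContinuousLinearMap.adjoint_inner_right, ← restrict,
    ContinuousLinearMap.adjoint_inner_left, restrict, ContinuousLinearMap.adjoint_inner_left]

theorem W_star (A : FP) : W (star A) = star (W A) := by
  refine (ContinuousLinearMap.eq_adjoint_iff _ _).2 fun x y => ?_
  have h1 : Tendsto (fun n => inner ℂ (extendSec (((star A : FP) : SeqAlg) n) x) y)
      atTop (𝓝 (inner ℂ (W (star A) x) y)) := (W_spec (star A) x).inner tendsto_const_nhds
  have h2 : Tendsto (fun n => inner ℂ x (extendSec ((A : SeqAlg) n) y)) atTop
      (𝓝 (inner ℂ x (W A y))) := tendsto_const_nhds.inner (W_spec A y)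
  exact tendsto_nhds_unique h1
    (h2.congr fun n => (inner_extendSec_adjoint ((A : SeqAlg) n) x y).symm)

theorem norm_entry_le (A : FP) (n : ℕ) : ‖entry A n‖ ≤ ‖A‖ := SeqAlg.norm_apply_le _ n

theorem norm_extendSec_le {n : ℕ} (X : Sec n →L[ℂ] Sec n) : ‖extendSec X‖ ≤ ‖X‖ :=
  ContinuousLinearMap.opNorm_le_bound _ (norm_nonneg _) fun x => by
    simp only [extendSec, ContinuousLinearMap.comp_apply]
    rw [norm_embed]
    exact (X.le_opNorm _).trans (mul_le_mul_of_nonneg_left (norm_restrict_le n x) (norm_nonneg _))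

theorem norm_W_le (A : FP) : ‖W A‖ ≤ ‖A‖ :=
  ContinuousLinearMap.opNorm_le_bound _ (norm_nonneg _) fun x =>
    le_of_tendsto (W_spec A x).norm (Eventually.of_forall fun n =>
      (extendSec _).le_of_opNorm_le ((norm_extendSec_le _).trans (norm_entry_le A n)) x)

theorem W_eq_zero_of_mem_nullIdeal {A : FP} (hA : A ∈ nullIdeal) : W A = 0 := by
  refine W_eq_of_isStrongLimit fun x => ?_
  have h : Tendsto (fun n => ‖entry A n‖ * ‖x‖) atTop (𝓝 0) := by
    have h := Tendsto.mul_const ‖x‖ (show Tendsto (fun n => ‖entry A n‖) atTop (𝓝 0) from hA)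
    rwa [zero_mul] at h
  exact squeeze_zero_norm (fun n => (extendSec _).le_of_opNorm_le (norm_extendSec_le _) x) h

theorem compress_sub (n : ℕ) (S T : L2N →L[ℂ] L2N) :
    compress n (S - T) = compress n S - compress n T := by
  simp only [compress, ContinuousLinearMap.sub_comp, ContinuousLinearMap.comp_sub]

theorem compress_add (n : ℕ) (S T : L2N →L[ℂ] L2N) :
    compress n (S + T) = compress n S + compress n T := by
  simp only [compress, ContinuousLinearMap.add_comp, ContinuousLinearMap.comp_add]

theorem compress_algebraMap (n : ℕ) (c : ℂ) :
    compress n (algebraMap ℂ (L2N →L[ℂ] L2N) c) = algebraMap ℂ (Sec n →L[ℂ] Sec n) c := by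
  ext1 x
  change restrict n (c • embed n x) = c • x
  rw [map_smul, restrict_embed]

/-- A sequence `(X_n)` of operators on the ranges of the `P_{n+1}` is negligible if the sequence
`(X_n P_{n+1})` is. -/
def SecNegligible (X : ∀ n, Sec n →L[ℂ] Sec n) : Prop := IsNegligible fun n => embed n ∘L X n

namespace SecNegligible

theorem congr' {X Y : ∀ n, Sec n →L[ℂ] Sec n} (hX : SecNegligible X)
    (h : ∀ᶠ n in atTop, X n = Y n) : SecNegligible Y :=
  IsNegligible.congr' hX (h.mono fun n hn => by rw [hn])

theorem add {X Y : ∀ n, Sec n →L[ℂ] Sec n} (hX : SecNegligible X) (hY : SecNegligible Y) :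
    SecNegligible fun n => X n + Y n := by
  simpa only [SecNegligible, ContinuousLinearMap.comp_add] using IsNegligible.add hX hY

theorem neg {X : ∀ n, Sec n →L[ℂ] Sec n} (hX : SecNegligible X) :
    SecNegligible fun n => -X n := by
  simpa only [SecNegligible, ContinuousLinearMap.comp_neg] using IsNegligible.neg hX

theorem zero : SecNegligible fun _ => 0 := by
  simp [SecNegligible, IsNegligible, hsSq]

theorem mul_left {X : ∀ n, Sec n →L[ℂ] Sec n} (hX : SecNegligible X)
    (C : ∀ n, Sec n →L[ℂ] Sec n) {c : ℝ} (hC : ∀ᶠ n in atTop, ‖C n‖ ≤ c) :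
    SecNegligible fun n => C n * X n := by
  have h := IsNegligible.comp_left hX (fun n => extendSec (C n))
    (hC.mono fun n hn => (norm_extendSec_le _).trans hn)
  refine IsNegligible.congr' h (Eventually.of_forall fun n => ?_)
  ext1 x
  change embed n (C n (restrict n (embed n (X n x)))) = embed n (C n (X n x))
  rw [restrict_embed]

theorem mul_right {X : ∀ n, Sec n →L[ℂ] Sec n} (hX : SecNegligible X)
    (C : ∀ n, Sec n →L[ℂ] Sec n) {c : ℝ} (hC : ∀ᶠ n in atTop, ‖C n‖ ≤ c) :
    SecNegligible fun n => X n * C n :=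
  IsNegligible.comp_right hX C hC

theorem of_approx {X : ∀ n, Sec n →L[ℂ] Sec n} {Y : ℕ → ∀ n, Sec n →L[ℂ] Sec n} {u : ℕ → ℝ}
    (hu : Tendsto u atTop (𝓝 0)) (hY : ∀ k, SecNegligible (Y k))
    (h : ∀ k n, ‖X n - Y k n‖ ≤ u k) : SecNegligible X := by
  refine IsNegligible.of_approx hu hY fun k n => ?_
  rw [← ContinuousLinearMap.comp_sub]
  refine (ContinuousLinearMap.opNorm_le_bound _ (norm_nonneg _) fun x => ?_).trans (h k n)
  rw [ContinuousLinearMap.comp_apply, norm_embed]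
  exact (X n - Y k n).le_opNorm x

end SecNegligible

/-- Finite sections of operators in `opAlgebra` are multiplicative up to negligible sequences:
`P_n B C P_n - P_n B P_n C P_n = P_n B (1 - P_n) C P_n`. -/
theorem secNegligible_compress_mul (B : L2N →L[ℂ] L2N) {C : L2N →L[ℂ] L2N} (hC : C ∈ opAlgebra) :
    SecNegligible fun n => compress n (B * C) - compress n B * compress n C := by
  have h := (opAlgebra_le_quasitriangularAlgebra hC).1.comp_left
    (fun n => extendSec (compress n 1) * B) (c := ‖B‖) (Eventually.of_forall fun n => ?_)
  · refine IsNegligible.congr' h (Eventually.of_forall fun n => ?_)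
    ext1 x
    change embed n (restrict n (embed n (restrict n (B (C (embed n x) -
      embed n (restrict n (C (embed n x)))))))) = embed n (restrict n (B (C (embed n x))) -
        restrict n (B (embed n (restrict n (C (embed n x))))))
    rw [restrict_embed, map_sub B, map_sub (restrict n)]
  · refine ContinuousLinearMap.opNorm_le_bound _ (norm_nonneg _) fun x => ?_
    change ‖embed n (restrict n (embed n (restrict n (B x))))‖ ≤ _
    rw [restrict_embed, norm_embed]
    exact (norm_restrict_le n _).trans (B.le_opNorm x)

/-- The algebra of all sequences in `FP` which agree with the finite sections of their strong
limit up to a negligible sequence, together with their adjoints, and whose strong limit belongs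
to `opAlgebra`. -/
def sectionLikeAlgebra : StarSubalgebra ℂ FP where
  carrier := {A | W A ∈ opAlgebra ∧ (SecNegligible fun n => entry A n - compress n (W A)) ∧
    SecNegligible fun n => entry (star A) n - compress n (W (star A))}
  mul_mem' := by
    have key : ∀ A B : FP, W B ∈ opAlgebra →
        (SecNegligible fun n => entry A n - compress n (W A)) →
        (SecNegligible fun n => entry B n - compress n (W B)) →
        SecNegligible fun n => entry (A * B) n - compress n (W (A * B)) := by
      intro A B hWB hA hB
      have h1 := hA.mul_right (entry B) (Eventually.of_forall (norm_entry_le B))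
      have h2 := hB.mul_left (fun n => compress n (W A))
        (Eventually.of_forall fun n => norm_compress_le n (W A))
      have h3 := (secNegligible_compress_mul (W A) hWB).neg
      refine ((h1.add h2).add h3).congr' (Eventually.of_forall fun n => ?_)
      have e : entry (A * B) n = entry A n * entry B n := rfl
      rw [e, W_mul, sub_mul, mul_sub]
      abel
    rintro A B ⟨hWA, hA, hA'⟩ ⟨hWB, hB, hB'⟩
    refine ⟨by rw [W_mul]; exact mul_mem hWA hWB, key A B hWB hA hB, ?_⟩
    rw [star_mul]
    exact key _ _ (by rw [W_star]; exact star_mem hWA) hB' hA'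
  add_mem' := by
    have key : ∀ A B : FP,
        (SecNegligible fun n => entry A n - compress n (W A)) →
        (SecNegligible fun n => entry B n - compress n (W B)) →
        SecNegligible fun n => entry (A + B) n - compress n (W (A + B)) := by
      intro A B hA hB
      refine (hA.add hB).congr' (Eventually.of_forall fun n => ?_)
      have e : entry (A + B) n = entry A n + entry B n := rfl
      rw [e, W_add, compress_add, add_sub_add_comm]
    rintro A B ⟨hWA, hA, hA'⟩ ⟨hWB, hB, hB'⟩
    refine ⟨by rw [W_add]; exact add_mem hWA hWB, key A B hA hB, ?_⟩
    rw [star_add]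
    exact key _ _ hA' hB'
  algebraMap_mem' c := by
    have key : ∀ c : ℂ, SecNegligible fun n =>
        entry (algebraMap ℂ FP c) n - compress n (W (algebraMap ℂ FP c)) := fun c => by
      refine SecNegligible.zero.congr' (Eventually.of_forall fun n => ?_)
      rw [W_algebraMap, compress_algebraMap]
      exact (sub_self _).symm
    refine ⟨by rw [W_algebraMap]; exact algebraMap_mem _ c, key c, ?_⟩
    rw [← algebraMap_star_comm]
    exact key _
  star_mem' := by
    rintro A ⟨hWA, hA, hA'⟩
    refine ⟨by rw [W_star]; exact star_mem hWA, hA', ?_⟩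
    rw [star_star]
    exact hA

theorem isClosed_opAlgebra : IsClosed (opAlgebra : Set (L2N →L[ℂ] L2N)) :=
  StarSubalgebra.isClosed_topologicalClosure _

theorem tendsto_W {A : FP} {a : ℕ → FP} (h : Tendsto a atTop (𝓝 A)) :
    Tendsto (fun k => W (a k)) atTop (𝓝 (W A)) := by
  rw [tendsto_iff_norm_sub_tendsto_zero] at h ⊢
  refine squeeze_zero (fun _ => norm_nonneg _) (fun k => ?_) h
  rw [← W_sub]
  exact norm_W_le _

theorem isClosed_sectionLikeAlgebra : IsClosed (sectionLikeAlgebra : Set FP) := by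
  refine isClosed_of_closure_subset fun A hA => ?_
  obtain ⟨a, ha, hlim⟩ := mem_closure_iff_seq_limit.1 hA
  have key : ∀ (b : ℕ → FP) (B : FP),
      (∀ k, SecNegligible fun n => entry (b k) n - compress n (W (b k))) →
      Tendsto b atTop (𝓝 B) → SecNegligible fun n => entry B n - compress n (W B) := by
    intro b B hb hlim
    have hu : Tendsto (fun k => 2 * ‖B - b k‖) atTop (𝓝 0) := by
      simpa using (((tendsto_const_nhds (x := B)).sub hlim).norm).const_mul 2
    refine SecNegligible.of_approx hu hb fun k n => ?_
    have e : entry B n - compress n (W B) - (entry (b k) n - compress n (W (b k))) =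
        entry (B - b k) n - compress n (W (B - b k)) := by
      have e' : entry (B - b k) n = entry B n - entry (b k) n := rfl
      rw [e', W_sub, compress_sub]
      abel
    rw [e]
    refine (norm_sub_le _ _).trans ?_
    have h1 := norm_entry_le (B - b k) n
    have h2 := (norm_compress_le n (W (B - b k))).trans (norm_W_le (B - b k))
    linarith
  exact ⟨isClosed_opAlgebra.mem_of_tendsto (tendsto_W hlim)
      (Eventually.of_forall fun k => (ha k).1), key a A (fun k => (ha k).2.1) hlim,
    key _ _ (fun k => (ha k).2.2) ((continuous_star.tendsto A).comp hlim)⟩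

theorem seqAlgebra_le_sectionLikeAlgebra : seqAlgebra ≤ sectionLikeAlgebra := by
  refine StarSubalgebra.topologicalClosure_minimal (StarAlgebra.adjoin_le ?_)
    isClosed_sectionLikeAlgebra
  rintro _ ⟨T, hT, rfl⟩
  have key : ∀ T : L2N →L[ℂ] L2N, SecNegligible fun n =>
      entry (finiteSections T) n - compress n (W (finiteSections T)) := fun T => by
    refine SecNegligible.zero.congr' (Eventually.of_forall fun n => ?_)
    rw [W_finiteSections]
    exact (sub_self _).symm
  refine ⟨by rwa [W_finiteSections], key T, ?_⟩
  have e : star (finiteSections T) = finiteSections (star T) :=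
    Subtype.ext (star_sectionsSeq T)
  rw [e]
  exact key _

/-- Resolvents of operators in `opAlgebra` belong to it, as `C*`-subalgebras are inverse closed. -/
theorem resolvent_mem_opAlgebra {B : L2N →L[ℂ] L2N} (hB : B ∈ opAlgebra) {ζ : ℂ}
    (hζ : ζ ∉ spectrum ℂ B) : resolvent B ζ ∈ opAlgebra := by
  have hu : IsUnit (algebraMap ℂ (L2N →L[ℂ] L2N) ζ - B) := not_not.1 hζ
  have : IsClosed (opAlgebra : Set (L2N →L[ℂ] L2N)) := isClosed_opAlgebra
  have hmem : algebraMap ℂ (L2N →L[ℂ] L2N) ζ - B ∈ opAlgebra :=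
    sub_mem (algebraMap_mem _ ζ) hB
  have hu' : IsUnit (⟨_, hmem⟩ : opAlgebra) := (StarSubalgebra.coe_isUnit opAlgebra).1 hu
  obtain ⟨v, hv⟩ := hu'
  rw [resolvent, ← hu.unit_spec, Ring.inverse_unit]
  have h1 : (hu.unit * ((v⁻¹ : opAlgebraˣ) : opAlgebra) : L2N →L[ℂ] L2N) = 1 := by
    rw [hu.unit_spec]
    have := congrArg (Subtype.val) v.mul_inv
    rw [hv] at this
    exact this
  rw [Units.inv_eq_of_mul_eq_one_right h1]
  exact ((v⁻¹ : opAlgebraˣ) : opAlgebra).2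

/-- If the entries of `ζ - A` have uniformly bounded inverses, then these inverses agree up to a
negligible sequence with the finite sections of the inverse of `ζ - W(A)`. -/
theorem secNegligible_resolvent_sub {A : FP} (hA : A ∈ seqAlgebra) {ζ : ℂ}
    (hζ : ζ ∉ spectrum ℂ (W A)) {R : ∀ n, Sec n →L[ℂ] Sec n} {c : ℝ}
    (hR : ∀ᶠ n in atTop, ‖R n‖ ≤ c)
    (hRA : ∀ᶠ n in atTop, R n * (algebraMap ℂ _ ζ - entry A n) = 1) :
    SecNegligible fun n => R n - compress n (resolvent (W A) ζ) := by
  obtain ⟨hW, hn, -⟩ := seqAlgebra_le_sectionLikeAlgebra hA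
  set V := resolvent (W A) ζ
  have hV : V ∈ opAlgebra := resolvent_mem_opAlgebra hW hζ
  have hu : IsUnit (algebraMap ℂ (L2N →L[ℂ] L2N) ζ - W A) := not_not.1 hζ
  have hmul : (algebraMap ℂ (L2N →L[ℂ] L2N) ζ - W A) * V = 1 := Ring.mul_inverse_cancel _ hu
  have h1 := secNegligible_compress_mul (algebraMap ℂ (L2N →L[ℂ] L2N) ζ - W A) hV
  have h2 := hn.mul_right (fun n => compress n V)
    (Eventually.of_forall fun n => norm_compress_le n V)
  refine ((h1.add h2).mul_left R hR).congr' (hRA.mono fun n hn => ?_)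
  have e1 : compress n ((algebraMap ℂ (L2N →L[ℂ] L2N) ζ - W A) * V) = 1 := by
    rw [hmul]
    simpa using compress_algebraMap n 1
  rw [e1, compress_sub, compress_algebraMap]
  have e2 : (1 : Sec n →L[ℂ] Sec n) - (algebraMap ℂ _ ζ - compress n (W A)) * compress n V +
      (entry A n - compress n (W A)) * compress n V =
      1 - (algebraMap ℂ _ ζ - entry A n) * compress n V := by
    simp only [sub_mul]
    abel
  rw [e2, mul_sub, mul_one, ← mul_assoc, hn, one_mul]

/-! ### Traces of resolvents -/

section Trace

open Polynomial

/-- The trace of a resolvent is the logarithmic derivative of the characteristic polynomial. -/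
theorem trace_eq_sum_roots_charpoly_inv {m : Type*} [Fintype m] [DecidableEq m]
    {A R : Matrix m m ℂ} {ζ : ℂ} (h : R * (Matrix.scalar m ζ - A) = 1) :
    R.trace = (A.charpoly.roots.map fun a => (ζ - a)⁻¹).sum := by
  set d := (Matrix.scalar m ζ - A).det
  have hd : d ≠ 0 := fun h0 => by
    have := congrArg Matrix.det h
    rw [Matrix.det_mul, show (Matrix.scalar m ζ - A).det = 0 from h0, mul_zero,
      Matrix.det_one] at this
    exact zero_ne_one this
  have h' : (Matrix.scalar m ζ - A) * R = 1 := mul_eq_one_comm.1 h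
  have hcomp : A.charpoly.comp (X + C ζ) =
      C d * Matrix.det (1 + (X : ℂ[X]) • R.map C) := by
    refine Polynomial.funext fun t => ?_
    rw [eval_comp, Matrix.eval_charpoly, eval_mul, eval_C, ← coe_evalRingHom, RingHom.map_det]
    have e1 : (evalRingHom t).mapMatrix (1 + (X : ℂ[X]) • R.map C) = 1 + t • R := by
      ext i j
      simp only [RingHom.mapMatrix_apply, Matrix.map_apply, Matrix.add_apply, Matrix.smul_apply,
        Matrix.one_apply, smul_eq_mul, coe_evalRingHom, eval_add, eval_mul, eval_X, eval_C,
        apply_ite (eval t), eval_one, eval_zero]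
    rw [e1, ← Matrix.det_mul, mul_add, mul_one, mul_smul_comm, h']
    congr 1
    ext i j
    simp [Matrix.one_apply, Matrix.diagonal_apply]
    split_ifs <;> ring
  have hroot : A.charpoly.eval ζ = d := Matrix.eval_charpoly A ζ
  have hder := congrArg (fun p => (derivative p).eval 0) hcomp
  simp only [derivative_comp, derivative_mul, derivative_C, zero_mul, zero_add, eval_mul, eval_C,
    Matrix.derivative_det_one_add_X_smul, derivative_add, derivative_X, add_zero, eval_comp,
    eval_add, eval_X, one_mul] at hder
  have hlog := (IsAlgClosed.splits A.charpoly).eval_derivative_div_eval_of_ne_zero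
    (x := ζ) (by rwa [hroot])
  rw [hder, hroot, mul_div_cancel_left₀ _ hd] at hlog
  simpa only [one_div] using hlog

/-- The sum on the left is the trace of `R = (ζ - X)⁻¹`. -/
theorem sum_diag_eq_sum_eigenvalues_inv {n : ℕ} {X R : Sec n →L[ℂ] Sec n} {ζ : ℂ}
    (h : R * (algebraMap ℂ _ ζ - X) = 1) :
    ∑ j, R (secBasis n j) j = ((eigenvalues X).map fun a => (ζ - a)⁻¹).sum := by
  set b := (EuclideanSpace.basisFun (Fin (n + 1)) ℂ).toBasis
  have hdiag : ∑ j, R (secBasis n j) j =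
      (LinearMap.toMatrix b b (R : Sec n →ₗ[ℂ] Sec n)).trace := by
    refine Finset.sum_congr rfl fun j _ => ?_
    rw [Matrix.diag_apply, LinearMap.toMatrix_apply]
    simp [b]
  rw [hdiag, eigenvalues, ← LinearMap.charpoly_toMatrix _ b]
  refine trace_eq_sum_roots_charpoly_inv ?_
  have h' : (R : Sec n →ₗ[ℂ] Sec n) * (algebraMap ℂ _ ζ - (X : Sec n →ₗ[ℂ] Sec n)) = 1 := by
    ext1 x
    exact congrArg (fun T : Sec n →L[ℂ] Sec n => T x) h
  have h2 := congrArg (LinearMap.toMatrixAlgEquiv b) h'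
  rw [map_mul, map_sub, map_one, AlgEquiv.commutes] at h2
  exact h2

end Trace

theorem exists_eigenvector_of_mem_eigenvalues {n : ℕ} {X : Sec n →L[ℂ] Sec n} {a : ℂ}
    (h : a ∈ eigenvalues X) : ∃ x : Sec n, x ≠ 0 ∧ X x = a • x := by
  have h1 : Module.End.HasEigenvalue (X : Sec n →ₗ[ℂ] Sec n) a := by
    rw [Module.End.hasEigenvalue_iff_isRoot_charpoly]
    exact (Polynomial.mem_roots'.1 h).2
  obtain ⟨x, hx⟩ := h1.exists_hasEigenvector
  exact ⟨x, hx.2, hx.apply_eq_smul⟩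

/-! ### Stability -/

/-- The entries of `ζ - A` are bounded below by `δ > 0`, uniformly for large `n` and for `ζ` in
the set `s`. As the entries act on finite dimensional spaces, this means that they have uniformly
bounded inverses. -/
def StableOn (A : FP) (s : Set ℂ) : Prop :=
  ∃ δ > 0, ∀ᶠ n in atTop, ∀ ζ ∈ s, ∀ x : Sec n, δ * ‖x‖ ≤ ‖ζ • x - entry A n x‖

theorem StableOn.mono {A : FP} {s t : Set ℂ} (hst : s ⊆ t) (h : StableOn A t) : StableOn A s := by
  obtain ⟨δ, hδ, h⟩ := h
  exact ⟨δ, hδ, h.mono fun n hn ζ hζ => hn ζ (hst hζ)⟩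

theorem StableOn.union {A : FP} {s t : Set ℂ} (hs : StableOn A s) (ht : StableOn A t) :
    StableOn A (s ∪ t) := by
  obtain ⟨δ, hδ, hs⟩ := hs
  obtain ⟨ε, hε, ht⟩ := ht
  refine ⟨min δ ε, lt_min hδ hε, (hs.and ht).mono fun n hn ζ hζ x => ?_⟩
  rcases hζ with hζ | hζ
  · exact (mul_le_mul_of_nonneg_right (min_le_left _ _) (norm_nonneg x)).trans (hn.1 ζ hζ x)
  · exact (mul_le_mul_of_nonneg_right (min_le_right _ _) (norm_nonneg x)).trans (hn.2 ζ hζ x)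

theorem StableOn.exists_mem_nhds {A : FP} {ζ₀ : ℂ} (h : StableOn A {ζ₀}) :
    ∃ t ∈ 𝓝 ζ₀, StableOn A t := by
  obtain ⟨δ, hδ, h⟩ := h
  refine ⟨Metric.ball ζ₀ (δ / 2), Metric.ball_mem_nhds _ (half_pos hδ), δ / 2, half_pos hδ,
    h.mono fun n hn ζ hζ x => ?_⟩
  have h1 := hn ζ₀ rfl x
  rw [Metric.mem_ball, dist_eq_norm] at hζ
  have h2 : ‖ζ₀ • x - entry A n x‖ ≤ ‖ζ • x - entry A n x‖ + ‖ζ - ζ₀‖ * ‖x‖ := by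
    rw [← norm_smul, sub_smul]
    refine le_trans (le_of_eq ?_) (norm_sub_le _ _)
    congr 1
    abel
  have h3 := mul_le_mul_of_nonneg_right hζ.le (norm_nonneg x)
  linarith

theorem stableOn_of_isCompact {A : FP} {s : Set ℂ} (hs : IsCompact s)
    (h : ∀ ζ ∈ s, StableOn A {ζ}) : StableOn A s := by
  refine hs.induction_on ⟨1, one_pos, by simp⟩ (fun s t hst ht => ht.mono hst)
    (fun s t hs ht => hs.union ht) fun ζ hζ => ?_
  obtain ⟨t, ht, hAt⟩ := (h ζ hζ).exists_mem_nhds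
  exact ⟨t, mem_nhdsWithin_of_mem_nhds ht, hAt⟩

theorem isOpen_setOf_stableOn (A : FP) : IsOpen {ζ | StableOn A {ζ}} := by
  refine isOpen_iff_mem_nhds.2 fun ζ hζ => ?_
  obtain ⟨t, ht, hAt⟩ := StableOn.exists_mem_nhds hζ
  exact mem_of_superset ht fun ζ' hζ' => hAt.mono (Set.singleton_subset_iff.2 hζ')

theorem stableOn_of_norm_lt {A : FP} {ζ : ℂ} (h : ‖A‖ < ‖ζ‖) : StableOn A {ζ} := by
  refine ⟨‖ζ‖ - ‖A‖, sub_pos.2 h, Eventually.of_forall ?_⟩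
  intro n ζ' hζ' x
  rw [Set.mem_singleton_iff.1 hζ']
  have h2 := (entry A n).le_of_opNorm_le (norm_entry_le A n) x
  have h3 := norm_sub_norm_le (ζ • x) (entry A n x)
  rw [norm_smul] at h3
  linarith

/-- Outside the stability spectrum, `ζ - A` is invertible modulo null sequences. -/
theorem exists_inverse_of_notMem_stabilitySpectrum {A : FP} {ζ : ℂ}
    (h : ζ ∉ stabilitySpectrum A) : ∃ R R' : FP,
      R * (algebraMap ℂ FP ζ - A) - 1 ∈ nullIdeal ∧
      (algebraMap ℂ FP ζ - A) * R' - 1 ∈ nullIdeal := by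
  have hu : IsUnit (algebraMap ℂ (FP ⧸ nullIdeal) ζ - Ideal.Quotient.mk nullIdeal A) := not_not.1 h
  have e : algebraMap ℂ (FP ⧸ nullIdeal) ζ - Ideal.Quotient.mk nullIdeal A =
      Ideal.Quotient.mk nullIdeal (algebraMap ℂ FP ζ - A) :=
    ((Ideal.Quotient.mk nullIdeal).map_sub (algebraMap ℂ FP ζ) A).symm
  rw [e] at hu
  generalize algebraMap ℂ FP ζ - A = B at hu ⊢
  obtain ⟨r, hr⟩ := hu.exists_left_inv
  obtain ⟨r', hr'⟩ := hu.exists_right_inv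
  obtain ⟨R, rfl⟩ := Ideal.Quotient.mk_surjective r
  obtain ⟨R', rfl⟩ := Ideal.Quotient.mk_surjective r'
  refine ⟨R, R', (Ideal.Quotient.eq (I := nullIdeal)).1 ?_,
    (Ideal.Quotient.eq (I := nullIdeal)).1 ?_⟩
  · exact ((Ideal.Quotient.mk nullIdeal).map_mul R B).trans hr
  · exact ((Ideal.Quotient.mk nullIdeal).map_mul B R').trans hr'

/-- Outside the stability spectrum, the sequence `ζ - A` is stable. -/
theorem stableOn_of_notMem_stabilitySpectrum {A : FP} {ζ : ℂ} (h : ζ ∉ stabilitySpectrum A) :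
    StableOn A {ζ} := by
  obtain ⟨R, -, hmem, -⟩ := exists_inverse_of_notMem_stabilitySpectrum h
  set E := R * (algebraMap ℂ FP ζ - A) - 1
  have hlim : Tendsto (fun n => ‖entry E n‖) atTop (𝓝 0) := hmem
  refine ⟨1 / (2 * (‖R‖ + 1)), by positivity,
    (hlim.eventually_lt_const (half_pos one_pos)).mono ?_⟩
  intro n hn ζ' hζ' x
  rw [Set.mem_singleton_iff.1 hζ']
  have h1 : entry E n x = entry R n (ζ • x - entry A n x) - x := rfl
  have h2 := (entry E n).le_of_opNorm_le hn.le x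
  rw [h1] at h2
  have h3 := (entry R n).le_of_opNorm_le (norm_entry_le R n) (ζ • x - entry A n x)
  have h4 := norm_sub_norm_le x (entry R n (ζ • x - entry A n x))
  rw [norm_sub_rev] at h4
  rw [div_mul_eq_mul_div, one_mul, div_le_iff₀ (by positivity)]
  nlinarith [norm_nonneg (ζ • x - entry A n x)]

/-- `W` induces a homomorphism on the quotient algebra, hence the spectrum of `W(A)` is contained
in the stability spectrum. -/
theorem spectrum_W_subset (A : FP) : spectrum ℂ (W A) ⊆ stabilitySpectrum A := by
  intro ζ hζ
  by_contra h
  refine hζ ?_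
  obtain ⟨R, R', hmem, hmem'⟩ := exists_inverse_of_notMem_stabilitySpectrum h
  have e := W_eq_zero_of_mem_nullIdeal hmem
  have e' := W_eq_zero_of_mem_nullIdeal hmem'
  rw [W_sub, W_mul, W_sub, W_algebraMap, W_one, sub_eq_zero] at e e'
  exact isUnit_iff_exists.2 ⟨W R', e', by rwa [left_inv_eq_right_inv e e'] at e⟩

/-- An operator on a finite dimensional space which is bounded below has a bounded inverse. -/
theorem exists_mul_eq_one_of_le {n : ℕ} {Y : Sec n →L[ℂ] Sec n} {δ : ℝ} (hδ : 0 < δ)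
    (h : ∀ x, δ * ‖x‖ ≤ ‖Y x‖) : ∃ R : Sec n →L[ℂ] Sec n, R * Y = 1 ∧ ‖R‖ ≤ δ⁻¹ := by
  have hinj : Function.Injective (Y : Sec n →ₗ[ℂ] Sec n) := by
    refine (injective_iff_map_eq_zero _).2 fun x hx => ?_
    have h1 := h x
    change Y x = 0 at hx
    rw [hx, norm_zero] at h1
    exact norm_le_zero_iff.1 (by nlinarith)
  let e := LinearEquiv.ofInjectiveEndo (Y : Sec n →ₗ[ℂ] Sec n) hinj
  have he : ∀ x, e x = Y x := fun x => rfl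
  refine ⟨LinearMap.mkContinuous (e.symm : Sec n →ₗ[ℂ] Sec n) δ⁻¹ fun y => ?_, ?_, ?_⟩
  · have h1 := h (e.symm y)
    rw [← he, e.apply_symm_apply] at h1
    rw [inv_mul_eq_div, le_div_iff₀ hδ, mul_comm]
    exact h1
  · ext1 x
    change e.symm (Y x) = x
    rw [← he, e.symm_apply_apply]
  · exact LinearMap.mkContinuous_norm_le _ (inv_nonneg.2 hδ.le) _

/-! ### The limit of the spectral means -/

theorem Cycle.integral_mem {V : Type*} [NormedAddCommGroup V] [NormedSpace ℂ V] [CompleteSpace V]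
    (Γ : Cycle) (S : Submodule ℂ V) (hS : IsClosed (S : Set V)) {F : ℂ → V}
    (hF : ContinuousOn F Γ.trace) (hmem : ∀ ζ ∈ Γ.trace, F ζ ∈ S) : Γ.integral F ∈ S := by
  -- This makes the quotient by `S` a normed space.
  have := hS
  have h0 : Γ.integral (fun ζ => S.mkQL (F ζ)) = Γ.integral fun _ => (0 : V ⧸ S) :=
    Γ.integral_congr fun ζ hζ => by
      simpa using hmem ζ hζ
  rw [Γ.integral_clm_apply S.mkQL hF] at h0
  have h1 : Γ.integral (fun _ => (0 : V ⧸ S)) = 0 := by simp [Cycle.integral]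
  rw [h1] at h0
  simpa using h0

theorem Cycle.integral_multiset_sum (Γ : Cycle) (s : Multiset ℂ) {F : ℂ → ℂ → ℂ}
    (hF : ∀ a ∈ s, ContinuousOn (F a) Γ.trace) :
    Γ.integral (fun ζ => (s.map fun a => F a ζ).sum) = (s.map fun a => Γ.integral (F a)).sum := by
  have hc : ∀ t : Multiset ℂ, (∀ a ∈ t, ContinuousOn (F a) Γ.trace) →
      ContinuousOn (fun ζ => (t.map fun a => F a ζ).sum) Γ.trace := fun t ht => by
    simpa using continuousOn_multiset_sum t ht
  induction s using Multiset.induction with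
  | empty => simp [Cycle.integral]
  | cons a s ih =>
    have h1 := hF a (Multiset.mem_cons_self a s)
    have h2 : ∀ b ∈ s, ContinuousOn (F b) Γ.trace := fun b hb => hF b (Multiset.mem_cons_of_mem hb)
    have h3 := Γ.integral_sub (hc _ hF) h1
    simp only [Multiset.map_cons, Multiset.sum_cons, add_sub_cancel_left] at h3 ⊢
    rw [ih h2] at h3
    rw [h3]
    ring

/-- Bounded convergence for integrals along a cycle. -/
theorem Cycle.tendsto_integral_zero (Γ : Cycle) {F : ℕ → ℂ → ℂ} {c : ℝ}
    (hF : ∀ᶠ n in atTop, ContinuousOn (F n) Γ.trace)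
    (hc : ∀ᶠ n in atTop, ∀ ζ ∈ Γ.trace, ‖F n ζ‖ ≤ c)
    (hlim : ∀ ζ ∈ Γ.trace, Tendsto (fun n => F n ζ) atTop (𝓝 0)) :
    Tendsto (fun n => Γ.integral (F n)) atTop (𝓝 0) := by
  have h : Tendsto (fun n => Γ.integral (F n)) atTop
      (𝓝 (∑ j : Fin Γ.card, ∫ t in (0 : ℝ)..1, (0 : ℂ))) := by
    refine tendsto_finsetSum _ fun j _ => ?_
    refine intervalIntegral.tendsto_integral_filter_of_dominated_convergence
      (fun t => ‖deriv (Γ.arc j) t‖ * c) ?_ ?_ ?_ ?_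
    · refine hF.mono fun n hn => ?_
      rw [Set.uIoc_of_le zero_le_one]
      exact ((Γ.continuousOn_integrand hn j).mono Set.Ioc_subset_Icc_self).aestronglyMeasurable
        measurableSet_Ioc
    · refine hc.mono fun n hn => Eventually.of_forall fun t ht => ?_
      rw [Set.uIoc_of_le zero_le_one] at ht
      rw [norm_smul]
      exact mul_le_mul_of_nonneg_left
        (hn _ (Γ.arc_mem_trace j (Set.Ioc_subset_Icc_self ht))) (norm_nonneg _)
    · exact (((Γ.contDiff j).continuous_deriv le_rfl).norm.mul continuous_const).intervalIntegrable
        0 1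
    · refine Eventually.of_forall fun t ht => ?_
      rw [Set.uIoc_of_le zero_le_one] at ht
      have h1 := (hlim _ (Γ.arc_mem_trace j (Set.Ioc_subset_Icc_self ht))).const_smul
        (deriv (Γ.arc j) t)
      rwa [smul_zero] at h1
  simpa using h

/-- The sum of the first `n + 1` entries of the main diagonal. -/
def diagSum (n : ℕ) : (L2N →L[ℂ] L2N) →L[ℂ] ℂ :=
  ∑ j ∈ Finset.range (n + 1), (lp.evalCLM ℂ (fun _ : ℕ => ℂ) 2 j) ∘L
    ContinuousLinearMap.apply ℂ L2N (lp.single 2 j (1 : ℂ))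

theorem diagSum_apply (n : ℕ) (T : L2N →L[ℂ] L2N) :
    diagSum n T = ∑ j ∈ Finset.range (n + 1), T (lp.single 2 j 1) j := by
  simp only [diagSum, sum_apply]
  rfl

theorem diagSum_eq_sum_compress (n : ℕ) (T : L2N →L[ℂ] L2N) :
    diagSum n T = ∑ j, compress n T (secBasis n j) j := by
  rw [diagSum_apply, Finset.sum_range]
  refine Finset.sum_congr rfl fun j _ => ?_
  simp only [compress, ContinuousLinearMap.comp_apply]
  rw [restrict_apply, embed_secBasis]

theorem norm_sum_diag_le {n : ℕ} (X : Sec n →L[ℂ] Sec n) {c : ℝ} (hc : ‖X‖ ≤ c) :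
    ‖∑ j, X (secBasis n j) j‖ ≤ (n + 1) * c := by
  refine (norm_sum_le_of_le _ (n := fun _ => c) fun j _ => ?_).trans (by simp)
  have h := X.le_of_opNorm_le hc (secBasis n j)
  rw [norm_secBasis, mul_one] at h
  exact (PiLp.norm_apply_le _ _).trans h

theorem norm_natCast_add_one (n : ℕ) : ‖(n : ℂ) + 1‖ = n + 1 := by
  rw [← Nat.cast_add_one, Complex.norm_natCast, Nat.cast_add_one]

/-- If the diagonal of `B` is asymptotic to a function with mean value `m`, then the means of the
diagonal of `B` tend to `m`. -/
theorem tendsto_diagSum_div {B : L2N →L[ℂ] L2N} {f : ℤ →ᵇ ℂ} (hf : IsAPPartOfDiagonal B f) {m : ℂ}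
    (hm : HasMeanValue f m) : Tendsto (fun n : ℕ => diagSum n B / ((n : ℂ) + 1)) atTop (𝓝 m) := by
  have h1 := (hf.2.cesaro_smul.comp (tendsto_add_atTop_nat 1)).add
    (Tendsto.comp hm (tendsto_add_atTop_nat 1))
  rw [zero_add] at h1
  refine h1.congr fun n => ?_
  simp only [Function.comp_apply, diagSum_apply, Finset.sum_sub_distrib, Complex.real_smul]
  push_cast
  ring

theorem Cycle.Surrounds.of_trace {Γ : Cycle} {K L U : Set ℂ} (hKL : K ⊆ L)
    (htr : Γ.trace ⊆ U \ L) (h1 : ∀ w ∈ L, Γ.windingNumber w = 1)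
    (h0 : ∀ F : ℂ → ℂ, DifferentiableOn ℂ F U → Γ.integral F = 0) : Γ.Surrounds K U where
  mem j t ht := ⟨(htr (Γ.arc_mem_trace j ht)).1, fun h => (htr (Γ.arc_mem_trace j ht)).2 (hKL h)⟩
  inner w hw := h1 w (hKL hw)
  outer w hw := by
    rw [Cycle.windingNumber, h0, mul_zero]
    refine DifferentiableOn.inv (by fun_prop) fun ζ hζ h => hw ?_
    rwa [← sub_eq_zero.1 h]

/-- Outside a neighborhood of the set of the unstable points of norm at most `‖A‖`, the sequence is
stable, since all points of larger norm are. -/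
theorem stableOn_of_notMem_interior {A : FP} {L : Set ℂ}
    (hL : Metric.closedBall 0 ‖A‖ \ {ζ | StableOn A {ζ}} ⊆ interior L) {ζ : ℂ}
    (hζ : ζ ∉ interior L) : StableOn A {ζ} := by
  by_contra h
  by_cases hn : ‖A‖ < ‖ζ‖
  · exact h (stableOn_of_norm_lt hn)
  · exact hζ (hL ⟨by simpa using hn, h⟩)

theorem norm_le_of_mem_eigenvalues {A : FP} {n : ℕ} {a : ℂ} (ha : a ∈ eigenvalues (entry A n)) :
    ‖a‖ ≤ ‖A‖ := by
  obtain ⟨x, hx, hax⟩ := exists_eigenvector_of_mem_eigenvalues ha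
  have h := (entry A n).le_of_opNorm_le (norm_entry_le A n) x
  rw [hax, norm_smul] at h
  exact le_of_mul_le_mul_right h (norm_pos_iff.2 hx)

theorem eventually_eigenvalues_subset {A : FP} {L : Set ℂ}
    (hL : Metric.closedBall 0 ‖A‖ \ {ζ | StableOn A {ζ}} ⊆ interior L) :
    ∀ᶠ n in atTop, ∀ a ∈ eigenvalues (entry A n), a ∈ L := by
  obtain ⟨δ, hδ, h⟩ := stableOn_of_isCompact
    (IsCompact.diff (isCompact_closedBall (0 : ℂ) ‖A‖) isOpen_interior)
    fun ζ hζ => stableOn_of_notMem_interior hL hζ.2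
  refine h.mono fun n hn a ha => ?_
  by_contra haL
  obtain ⟨x, hx, hax⟩ := exists_eigenvector_of_mem_eigenvalues ha
  have h1 := hn a ⟨by simpa using norm_le_of_mem_eigenvalues ha,
    fun h => haL (interior_subset h)⟩ x
  rw [hax, sub_self, norm_zero] at h1
  nlinarith [norm_pos_iff.2 hx]

/-- The Szegő-type limit theorem for the integrals which represent `g` of the eigenvalues and
`g(W(A))`: the traces of the resolvents of `A_n` and the diagonal sums of the resolvent of `W(A)`
agree asymptotically in the mean, boundedly on the cycle. -/
theorem tendsto_sum_eigenvalues_sub_diagSum {A : FP} (hA : A ∈ seqAlgebra) {U L : Set ℂ}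
    (hU : IsOpen U) (hLU : L ⊆ U) (hWL : spectrum ℂ (W A) ⊆ L)
    (hL : Metric.closedBall 0 ‖A‖ \ {ζ | StableOn A {ζ}} ⊆ interior L)
    {g : ℂ → ℂ} (hg : DifferentiableOn ℂ g U) {Γ : Cycle} (htr : Γ.trace ⊆ U \ L)
    (hΓ1 : ∀ w ∈ L, Γ.windingNumber w = 1)
    (hΓ0 : ∀ F : ℂ → ℂ, DifferentiableOn ℂ F U → Γ.integral F = 0) :
    Tendsto (fun n : ℕ => (((eigenvalues (entry A n)).map g).sum - diagSum n
      ((2 * Real.pi * Complex.I : ℂ)⁻¹ • Γ.integral fun ζ => g ζ • resolvent (W A) ζ)) /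
        ((n : ℂ) + 1)) atTop (𝓝 0) := by
  have hgc : ContinuousOn g Γ.trace := hg.continuousOn.mono fun ζ hζ => (htr hζ).1
  have hnot : ∀ ζ ∈ Γ.trace, ζ ∉ spectrum ℂ (W A) := fun ζ hζ h => (htr hζ).2 (hWL h)
  have hVc : ContinuousOn (resolvent (W A)) Γ.trace := fun ζ hζ =>
    (spectrum.hasDerivAt_resolvent_const_left
      (not_not.1 (hnot ζ hζ))).continuousAt.continuousWithinAt
  have hLint : interior L ⊆ L := interior_subset
  obtain ⟨δ, hδ, hstab⟩ := stableOn_of_isCompact Γ.isCompact_trace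
    fun ζ hζ => stableOn_of_notMem_interior hL fun h => (htr hζ).2 (hLint h)
  have hlow : ∀ᶠ n in atTop, ∀ ζ ∈ Γ.trace, ∃ R : Sec n →L[ℂ] Sec n,
      R * (algebraMap ℂ _ ζ - entry A n) = 1 ∧ ‖R‖ ≤ δ⁻¹ :=
    hstab.mono fun n hn ζ hζ => exists_mul_eq_one_of_le hδ (hn ζ hζ)
  have heig := eventually_eigenvalues_subset hL
  -- the traces of the resolvents of the entries
  set τ : ℕ → ℂ → ℂ := fun n ζ => ((eigenvalues (entry A n)).map fun a => (ζ - a)⁻¹).sum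
  have hτc : ∀ᶠ n in atTop, ContinuousOn (τ n) Γ.trace := heig.mono fun n hn => by
    simpa [τ] using continuousOn_multiset_sum (f := fun a ζ => (ζ - a)⁻¹) (eigenvalues (entry A n))
      fun a ha => continuousOn_sub_inv fun h => (htr h).2 (hn a ha)
  set d : ℕ → ℂ → ℂ := fun n ζ => (τ n ζ - diagSum n (resolvent (W A) ζ)) / ((n : ℂ) + 1)
  have hsc : ∀ n, ContinuousOn (fun ζ => diagSum n (resolvent (W A) ζ)) Γ.trace := fun n =>
    (diagSum n).continuous.comp_continuousOn hVc
  obtain ⟨cV, hcV⟩ := Γ.isCompact_trace.exists_bound_of_continuousOn hVc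
  obtain ⟨cg, hcg⟩ := Γ.isCompact_trace.exists_bound_of_continuousOn hgc
  have hdbound : ∀ᶠ n in atTop, ∀ ζ ∈ Γ.trace, ‖d n ζ‖ ≤ δ⁻¹ + cV := hlow.mono fun n hn ζ hζ => by
    obtain ⟨R, hR, hRc⟩ := hn ζ hζ
    have h1 := norm_sum_diag_le R hRc
    rw [sum_diag_eq_sum_eigenvalues_inv hR] at h1
    have h2 := norm_sum_diag_le (compress n (resolvent (W A) ζ))
      ((norm_compress_le n _).trans (hcV ζ hζ))
    rw [← diagSum_eq_sum_compress] at h2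
    simp only [d]
    rw [norm_div, norm_natCast_add_one, div_le_iff₀ (by positivity)]
    refine (norm_sub_le _ _).trans ?_
    linarith
  have hdlim : ∀ ζ ∈ Γ.trace, Tendsto (fun n => d n ζ) atTop (𝓝 0) := by
    intro ζ hζ
    have hlow' : ∀ n, ∃ R : Sec n →L[ℂ] Sec n,
        (∃ R : Sec n →L[ℂ] Sec n, R * (algebraMap ℂ _ ζ - entry A n) = 1 ∧ ‖R‖ ≤ δ⁻¹) →
        R * (algebraMap ℂ _ ζ - entry A n) = 1 ∧ ‖R‖ ≤ δ⁻¹ := fun n => by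
      by_cases h : ∃ R : Sec n →L[ℂ] Sec n, R * (algebraMap ℂ _ ζ - entry A n) = 1 ∧ ‖R‖ ≤ δ⁻¹
      · obtain ⟨R, hR⟩ := h
        exact ⟨R, fun _ => hR⟩
      · exact ⟨0, fun h' => absurd h' h⟩
    choose R hR using hlow'
    have hR' : ∀ᶠ n in atTop, R n * (algebraMap ℂ _ ζ - entry A n) = 1 ∧ ‖R n‖ ≤ δ⁻¹ :=
      hlow.mono fun n hn => hR n (hn ζ hζ)
    have hneg := secNegligible_resolvent_sub hA (hnot ζ hζ) (hR'.mono fun n h => h.2)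
      (hR'.mono fun n h => h.1)
    refine (IsNegligible.tendsto_trace hneg).congr' (hR'.mono fun n hn => ?_)
    have e : ∀ j, (R n - compress n (resolvent (W A) ζ)) (secBasis n j) j =
        R n (secBasis n j) j - compress n (resolvent (W A) ζ) (secBasis n j) j := fun j => rfl
    simp only [e, Finset.sum_sub_distrib]
    rw [sum_diag_eq_sum_eigenvalues_inv hn.1, ← diagSum_eq_sum_compress]
  have hmain : Tendsto (fun n => Γ.integral fun ζ => g ζ * d n ζ) atTop (𝓝 0) := by
    refine Γ.tendsto_integral_zero (c := cg * (δ⁻¹ + cV))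
      (hτc.mono fun n hn => hgc.mul ((hn.sub (hsc n)).div_const _))
      (hdbound.mono fun n hn ζ hζ => ?_) fun ζ hζ => ?_
    · rw [norm_mul]
      exact mul_le_mul (hcg ζ hζ) (hn ζ hζ) (norm_nonneg _) ((norm_nonneg _).trans (hcg ζ hζ))
    · simpa using (hdlim ζ hζ).const_mul (g ζ)
  have hmain' := hmain.const_mul (2 * Real.pi * Complex.I : ℂ)⁻¹
  rw [mul_zero] at hmain'
  refine hmain'.congr' ((heig.and hτc).mono fun n hn => ?_)
  obtain ⟨hn, hτn⟩ := hn
  have hn0 : (n : ℂ) + 1 ≠ 0 := by exact_mod_cast Nat.succ_ne_zero n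
  have e1 : ∀ a ∈ eigenvalues (entry A n),
      Γ.integral (fun ζ => (ζ - a)⁻¹ * g ζ) = (2 * Real.pi * Complex.I : ℂ) * g a := fun a ha =>
    Cycle.integral_sub_inv_smul hU (fun ζ hζ => (htr hζ).1) hΓ0 hg (hLU (hn a ha))
      (fun h => (htr h).2 (hn a ha)) (hΓ1 a (hn a ha))
  have e2 : Γ.integral (fun ζ => τ n ζ * g ζ) =
      (2 * Real.pi * Complex.I : ℂ) * ((eigenvalues (entry A n)).map g).sum := by
    simp only [τ, ← Multiset.sum_map_mul_right]
    rw [Γ.integral_multiset_sum, ← Multiset.sum_map_mul_left, Multiset.map_congr rfl e1]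
    exact fun a ha => (continuousOn_sub_inv fun h => (htr h).2 (hn a ha)).mul hgc
  have e3 : diagSum n (Γ.integral fun ζ => g ζ • resolvent (W A) ζ) =
      Γ.integral fun ζ => g ζ * diagSum n (resolvent (W A) ζ) := by
    rw [← Γ.integral_clm_apply (F := fun ζ => g ζ • resolvent (W A) ζ) (diagSum n) (hgc.smul hVc)]
    simp only [map_smul, smul_eq_mul]
  have e4 : Γ.integral (fun ζ => g ζ * d n ζ) = ((n : ℂ) + 1)⁻¹ *
      (Γ.integral (fun ζ => τ n ζ * g ζ) -
        Γ.integral fun ζ => g ζ * diagSum n (resolvent (W A) ζ)) := by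
    rw [← Γ.integral_sub (F := fun ζ => τ n ζ * g ζ)
      (G := fun ζ => g ζ * diagSum n (resolvent (W A) ζ)) (hτn.mul hgc) (hgc.mul (hsc n)),
      ← smul_eq_mul, ← Γ.integral_const_smul]
    refine Γ.integral_congr fun ζ _ => ?_
    simp only [d, smul_eq_mul]
    ring
  beta_reduce
  rw [e4, e2, map_smul, e3, smul_eq_mul]
  field_simp [Complex.two_pi_I_ne_zero]

end

end SzegoAP

theorem theorem5p2 (A : SzegoAP.FP) (hA : A ∈ SzegoAP.seqAlgebra) (U : Set ℂ) (hU : IsOpen U)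
    (hAU : SzegoAP.stabilitySpectrum A ⊆ U) (g : ℂ → ℂ) (hg : DifferentiableOn ℂ g U) :
    ∃ gW : SzegoAP.L2N →L[ℂ] SzegoAP.L2N,
      SzegoAP.IsHolomorphicFunction U g (SzegoAP.W A) gW ∧
      gW ∈ SzegoAP.opAlgebra ∧
      (∃! f : ℤ →ᵇ ℂ, SzegoAP.IsAPPartOfDiagonal gW f) ∧
      ∀ f : ℤ →ᵇ ℂ, SzegoAP.IsAPPartOfDiagonal gW f →
        ∃ m : ℂ, SzegoAP.HasMeanValue f m ∧
          Tendsto (fun n : ℕ => ((SzegoAP.eigenvalues (SzegoAP.entry A n)).map g).sum / ((n : ℂ) + 1))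
            atTop (𝓝 m) := by
  -- `K` contains the spectrum of `W(A)` and all limit points of eigenvalues of the entries.
  set K := spectrum ℂ (SzegoAP.W A) ∪
    (Metric.closedBall 0 ‖A‖ \ {ζ | SzegoAP.StableOn A {ζ}})
  have hK : IsCompact K := (spectrum.isCompact _).union
    ((isCompact_closedBall _ _).diff (SzegoAP.isOpen_setOf_stableOn A))
  have hKU : K ⊆ U := by
    refine Set.union_subset ((SzegoAP.spectrum_W_subset A).trans hAU) fun ζ hζ => hAU ?_
    by_contra h
    exact hζ.2 (SzegoAP.stableOn_of_notMem_stabilitySpectrum h)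
  obtain ⟨L, hL, hKL, hLU⟩ := exists_compact_between hK hU hKU
  obtain ⟨Γ, htr, hΓ1, hΓ0⟩ := SzegoAP.exists_cycle_of_isCompact hL hU hLU
  have hWL : spectrum ℂ (SzegoAP.W A) ⊆ L :=
    (Set.subset_union_left.trans hKL).trans interior_subset
  have hW : SzegoAP.W A ∈ SzegoAP.opAlgebra := (SzegoAP.seqAlgebra_le_sectionLikeAlgebra hA).1
  have hgW : (2 * Real.pi * Complex.I : ℂ)⁻¹ •
      Γ.integral (fun ζ => g ζ • resolvent (SzegoAP.W A) ζ) ∈ SzegoAP.opAlgebra := by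
    refine SMulMemClass.smul_mem _ (Γ.integral_mem SzegoAP.opAlgebra.toSubalgebra.toSubmodule
      SzegoAP.isClosed_opAlgebra (fun ζ hζ => ?_) fun ζ hζ => ?_)
    · refine ((hg.continuousOn ζ (htr hζ).1).mono fun ζ hζ => (htr hζ).1).smul ?_
      exact (spectrum.hasDerivAt_resolvent_const_left
        (not_not.1 fun h => (htr hζ).2 (hWL h))).continuousAt.continuousWithinAt
    · exact SMulMemClass.smul_mem (s := SzegoAP.opAlgebra) _
        (SzegoAP.resolvent_mem_opAlgebra hW fun h => (htr hζ).2 (hWL h))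
  refine ⟨_, SzegoAP.isHolomorphicFunction_integral hU hg
    (SzegoAP.Cycle.Surrounds.of_trace hWL htr hΓ1 (hΓ0 ℂ)), hgW, ?_, fun f hf => ?_⟩
  · obtain ⟨f, hf⟩ := SzegoAP.exists_isAPPartOfDiagonal hgW
    exact ⟨f, hf, fun f' hf' => hf'.unique hf⟩
  · obtain ⟨m, hm⟩ := hf.1.exists_hasMeanValue
    refine ⟨m, hm, ?_⟩
    have h := (SzegoAP.tendsto_sum_eigenvalues_sub_diagSum hA hU hLU hWL
      (Set.subset_union_right.trans hKL) hg htr hΓ1 (hΓ0 ℂ)).add (SzegoAP.tendsto_diagSum_div hf hm)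
    rw [zero_add] at h
    refine h.congr fun n => ?_
    rw [← add_div, sub_add_cancel]
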